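/- Let $k>d\ge 3$ be integers and let $\Gamma=\langle s_1,\dots,s_d : s_1^k=\dots=s_d^k=e\rangle$ be the $d$-fold free product of copies of $\mathbb Z/k\mathbb Z$. Let $X=\{x\in\mathbb Z_2^\Gamma : \sum_{j=0}^{k-1}x_{gs_i^j}=0 \text{ for all } g\in\Gamma,\ 1\le i\le d\}$, let $m_X$ be its Haar probability measure, regarded as a measure on $\mathbb Z_2^\Gamma$, and let $T$ be the shift action $(T^gx)_h=x_{g^{-1}h}$. Let $n$ range over the positive multiples of $k$ and put $V_n=\{1,\dots,n\}$. A homomorphism $\sigma:\Gamma\to\mathrm{Sym}(V)$ is $k$-uniform if every cycle of every $\sigma(s_i)$ has length exactly $k$; let $\mathbb P_n$ be the uniform distribution on the set $\mathrm{Hom}_{\mathrm{unif}}(\Gamma,\mathrm{Sym}(V_n))$ of $k$-uniform homomorphisms. For such $\sigma$ let $\mu_\sigma$ be the uniform distribution on the code $X_\sigma=\{\mathbf x\in\mathbb Z_2^{V}:\sum_{j=0}^{k-1}x_{\sigma(s_i)^j v}=0 \text{ for all } v\in V,\ 1\le i\le d\}$. Notation: for $\sigma:\Gamma\to\mathrm{Sym}(V)$,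 $\mathbf x\in\mathbb Z_2^{V}$ and $v\in V$ put $\Pi^\sigma_v(\mathbf x)=(x_{\sigma(g^{-1})v})_{g\in\Gamma}$ and $P^\sigma_{\mathbf x}=|V|^{-1}\sum_{v\in V}\delta_{\Pi^\sigma_v(\mathbf x)}$. For a set $\mathcal O$ of Borel probability measures on $\mathbb Z_2^\Gamma$ (with the weak* topology), $\Omega(\sigma,\mathcal O)=\{\mathbf x : P^\sigma_{\mathbf x}\in\mathcal O\}$. $B_r\subset\Gamma$ is the closed ball of radius $r$ about $e$ for the word length of the generating set $\{s_i^j:1\le i\le d,\ 1\le j\le k-1\}$, $\sigma^{B_r}(S)=\{\sigma(f)s:f\in B_r,\ s\in S\}$, $\nu_B$ is the marginal of $\nu$ on the coordinates in $B$, and $\mathrm H$ is Shannon entropy. **Theorem.** There are sets $\Omega_n'\subseteq\mathrm{Hom}_{\mathrm{unif}}(\Gamma,\mathrm{Sym}(V_n))$ with $\mathbb P_n(\Omega_n')\to1$ such that, whenever $\sigma_n\in\mathrm{Hom}_{\mathrm{unif}}(\Gamma,\mathrm{Sym}(V_n))$ for every $n$ and $\sigma_n\in\Omega'_n$ for all sufficiently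 large $n$, the sequence $\Sigma=(\sigma_n)_n$ is a sofic approximation to $\Gamma$ (that is, for every $g\ne e$ the proportion of $v\in V_n$ fixed by $\sigma_n(g)$ tends to $0$), and, with $\mu_n=\mu_{\sigma_n}$: 1. $(\mu_n)_n$ has property M with respect to $m_X$: for every $\varepsilon>0$ and every integer $r\ge0$ there are $S_n\subseteq V_n$ with $\liminf_n|S_n|/|V_n|>0$ and $\mathrm H\big((\mu_n)_{\sigma_n^{B_r}(S_n)}\big)\ge|S_n|\,\big(\mathrm H((m_X)_{B_r})-\varepsilon\big)$ for all $n$. 2. $(\mu_n)_n$ converges locally and empirically to $m_X$: for every open $\mathcal O\ni m_X$, $|V_n|^{-1}\,|\{v\in V_n:(\Pi^{\sigma_n}_v)_*\mu_n\in\mathcal O\}|\to1$ and $\mu_n(\{\mathbf x : P^{\sigma_n}_{\mathbf x}\in\mathcal O\})\to1$. 3. $(X,m_X,T)$ has totally shattered microstate spaces along $\Sigma$: for every open $\mathcal O\ni m_X$ the set $\Omega(\sigma_n,\mathcal O)$ is nonempty for all large $n$; and there is $\delta>0$ such that for every $\varepsilon>0$ there are an open $\mathcal O\ni m_X$ and an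 $n_0$ such that for all $n\ge n_0$ and all $\mathbf x,\mathbf y\in\Omega(\sigma_n,\mathcal O)$ the normalized Hamming distance $|V_n|^{-1}|\{v\in V_n:\mathbf x(v)\ne\mathbf y(v)\}|$ is either $\ge\delta$ or $<\varepsilon$. -/

import Mathlib

open MeasureTheory Filter Topology

noncomputable section

namespace ParityCheck

/-! ### Shift systems over a countable group and maps into finite symmetric groups -/

section General

variable {Γ A V : Type*}

/-- The pullback name of `x : V → A` at `v`, an element of `A ^ Γ`. -/
def pullback [Group Γ] (σ : Γ → Equiv.Perm V) (v : V) (x : V → A) : Γ → A :=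
  fun g => x (σ g⁻¹ v)

theorem measurable_pullback [Group Γ] [MeasurableSpace A] (σ : Γ → Equiv.Perm V) (v : V) :
    Measurable (pullback (A := A) σ v) :=
  measurable_pi_lambda _ fun _ => measurable_pi_apply _

/-- The empirical measure `|V|⁻¹ ∑ᵥ δ_{Π_v(x)}` of `x : V → A`. -/
def empirical [Group Γ] [MeasurableSpace A] [Fintype V] [Nonempty V]
    (σ : Γ → Equiv.Perm V) (x : V → A) : ProbabilityMeasure (Γ → A) :=
  ⟨(Fintype.card V : ENNReal)⁻¹ • ∑ v : V, Measure.dirac (pullback σ v x), ⟨by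
    simp only [Measure.smul_apply, Measure.coe_finsetSum, Finset.sum_apply, measure_univ,
      Finset.sum_const, Finset.card_univ, nsmul_eq_mul, mul_one, smul_eq_mul]
    exact ENNReal.inv_mul_cancel (by simp) (by simp)⟩⟩

/-- The set `Ω(σ, O)` of `(O, σ)`-microstates. -/
def microstates [Group Γ] [MeasurableSpace A] [Fintype V] [Nonempty V]
    (σ : Γ → Equiv.Perm V) (O : Set (ProbabilityMeasure (Γ → A))) : Set (V → A) :=
  {x | empirical σ x ∈ O}

/-- The localization of `κ` at `v`: the law of the pullback name at `v` of a `κ`-random sample. -/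
def localization [Group Γ] [MeasurableSpace A] (σ : Γ → Equiv.Perm V)
    (κ : ProbabilityMeasure (V → A)) (v : V) : ProbabilityMeasure (Γ → A) :=
  κ.map (measurable_pullback σ v).aemeasurable

/-- The normalized Hamming distance on `A ^ V`. -/
def normHamming [Fintype V] [DecidableEq A] (x y : V → A) : ℝ :=
  (hammingDist x y : ℝ) / Fintype.card V

/-- Shannon entropy (natural logarithm) of the marginal of `κ` on the coordinates in `B`;
used for finite `B` and finite `A`, when the sum is a finite one. -/
def marginalEntropy {I : Type*} [MeasurableSpace A] (κ : ProbabilityMeasure (I → A))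
    (B : Set I) : ℝ :=
  ∑' a : B → A, Real.negMulLog
    (((κ : Measure (I → A)).map (fun x (i : B) => x i)).real {a})

/-- The closed ball of radius `r` about the identity for the word length relative to `E`. -/
def wordBall [Group Γ] (E : Set Γ) (r : ℕ) : Set Γ :=
  {g | ∃ l : List Γ, (∀ x ∈ l, x ∈ E) ∧ l.prod = g ∧ l.length ≤ r}

/-- `σ^B(S) = {σ(f) s : f ∈ B, s ∈ S}`. -/
def spread (σ : Γ → Equiv.Perm V) (B : Set Γ) (S : Set V) : Set V :=
  Set.image2 (fun f s => σ f s) B S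

end General

/-! ### Sequences of maps `σ n : Γ → Sym (V n)`

The index `n` ranges over an ordered index type `ι` (below: the positive multiples of `k`). -/

section Sequences

variable {Γ A ι : Type*} [Group Γ] [Preorder ι] {V : ι → Type*} [∀ n, Fintype (V n)]

/-- `σ` is a sofic approximation to `Γ`. -/
def IsSoficApprox (σ : ∀ n, Γ → Equiv.Perm (V n)) : Prop :=
  (∀ g h : Γ, Tendsto (fun n =>
      (Set.ncard {v : V n | σ n (g * h) v = σ n g (σ n h v)} : ℝ) / Fintype.card (V n))
      atTop (𝓝 1)) ∧
  (∀ g : Γ, g ≠ 1 → Tendsto (fun n =>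
      (Set.ncard {v : V n | σ n g v = v} : ℝ) / Fintype.card (V n)) atTop (𝓝 0))

/-- Property M of the model measure sequence `κ` relative to `μ`, for the word metric of `E`. -/
def PropertyM [MeasurableSpace A] (E : Set Γ) (σ : ∀ n, Γ → Equiv.Perm (V n))
    (κ : ∀ n, ProbabilityMeasure (V n → A)) (μ : ProbabilityMeasure (Γ → A)) : Prop :=
  ∀ ε : ℝ, 0 < ε → ∀ r : ℕ, ∃ S : ∀ n, Finset (V n),
    0 < liminf (fun n => ((S n).card : ℝ) / Fintype.card (V n)) atTop ∧
    ∀ n, ((S n).card : ℝ) * (marginalEntropy μ (wordBall E r) - ε) ≤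
      marginalEntropy (κ n) (spread (σ n) (wordBall E r) (S n))

variable [Countable Γ] [Finite A] [TopologicalSpace A] [DiscreteTopology A]
  [MeasurableSpace A] [BorelSpace A]

/-- Local convergence of the model measure sequence `κ` to `μ`. -/
def ConvergesLocally (σ : ∀ n, Γ → Equiv.Perm (V n))
    (κ : ∀ n, ProbabilityMeasure (V n → A)) (μ : ProbabilityMeasure (Γ → A)) : Prop :=
  ∀ O : Set (ProbabilityMeasure (Γ → A)), IsOpen O → μ ∈ O →
    Tendsto (fun n =>
      (Set.ncard {v : V n | localization (σ n) (κ n) v ∈ O} : ℝ) / Fintype.card (V n))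
      atTop (𝓝 1)

variable [∀ n, Nonempty (V n)]

/-- Empirical convergence of the model measure sequence `κ` to `μ`. -/
def ConvergesEmpirically (σ : ∀ n, Γ → Equiv.Perm (V n))
    (κ : ∀ n, ProbabilityMeasure (V n → A)) (μ : ProbabilityMeasure (Γ → A)) : Prop :=
  ∀ O : Set (ProbabilityMeasure (Γ → A)), IsOpen O → μ ∈ O →
    Tendsto (fun n => (κ n : Measure (V n → A)).real {x | empirical (σ n) x ∈ O})
      atTop (𝓝 1)

/-- The shift system with measure `μ` has microstates along `σ`. -/
def HasMicrostates (σ : ∀ n, Γ → Equiv.Perm (V n)) (μ : ProbabilityMeasure (Γ → A)) : Prop :=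
  ∀ O : Set (ProbabilityMeasure (Γ → A)), IsOpen O → μ ∈ O →
    ∀ᶠ n in atTop, (microstates (σ n) O).Nonempty

/-- The shift system with measure `μ` has totally shattered microstate spaces along `σ`. -/
def TotallyShattered [DecidableEq A] (σ : ∀ n, Γ → Equiv.Perm (V n))
    (μ : ProbabilityMeasure (Γ → A)) : Prop :=
  HasMicrostates σ μ ∧
  ∃ δ : ℝ, 0 < δ ∧ ∀ ε : ℝ, 0 < ε →
    ∃ O : Set (ProbabilityMeasure (Γ → A)), IsOpen O ∧ μ ∈ O ∧
      ∃ n₀ : ι, ∀ n, n₀ ≤ n → ∀ x ∈ microstates (σ n) O, ∀ y ∈ microstates (σ n) O,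
        δ ≤ normHamming x y ∨ normHamming x y < ε

end Sequences

/-! ### The parity check subshift -/

/-- The `d`-fold free product of cyclic groups of order `k`. -/
abbrev Gam (d k : ℕ) : Type :=
  Monoid.CoprodI (fun _ : Fin d => Multiplicative (ZMod k))

instance (d k : ℕ) : Countable (Gam d k) := by
  have : Countable (ZMod k) := by
    cases k with
    | zero => exact inferInstanceAs (Countable ℤ)
    | succ m => exact inferInstanceAs (Countable (Fin (m + 1)))
  have : Countable (Multiplicative (ZMod k)) := inferInstanceAs (Countable (ZMod k))
  have : Countable (FreeMonoid (Σ _ : Fin d, Multiplicative (ZMod k))) :=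
    inferInstanceAs (Countable (List (Σ _ : Fin d, Multiplicative (ZMod k))))
  exact (Con.mk'_surjective (c := conGen (Monoid.CoprodI.Rel
    (fun _ : Fin d => Multiplicative (ZMod k))))).countable

/-- The generator `s_i`. -/
def gen {d k : ℕ} (i : Fin d) : Gam d k :=
  Monoid.CoprodI.of (i := i) (Multiplicative.ofAdd (1 : ZMod k))

/-- The symmetric generating set `{s_i ^ j : 1 ≤ j ≤ k - 1}` that defines the word metric. -/
def gens (d k : ℕ) : Set (Gam d k) :=
  {g | ∃ (i : Fin d) (j : ℕ), 1 ≤ j ∧ j < k ∧ g = gen i ^ j}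

/-- The parity check subshift `X`, a subgroup of `(ℤ/2) ^ Γ`. -/
def X (d k : ℕ) : AddSubgroup (Gam d k → ZMod 2) where
  carrier := {x | ∀ (g : Gam d k) (i : Fin d), ∑ j ∈ Finset.range k, x (g * gen i ^ j) = 0}
  zero_mem' := by intro g i; simp
  add_mem' := by
    intro x y hx hy g i
    simp [Finset.sum_add_distrib, hx g i, hy g i]
  neg_mem' := by
    intro x hx g i
    simp [hx g i]

theorem isClosed_X (d k : ℕ) : IsClosed (X d k : Set (Gam d k → ZMod 2)) := by
  have : (X d k : Set (Gam d k → ZMod 2)) = ⋂ (g : Gam d k) (i : Fin d),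
      {x | ∑ j ∈ Finset.range k, x (g * gen i ^ j) = 0} := by
    ext x
    simp only [Set.mem_iInter]
    exact Iff.rfl
  rw [this]
  refine isClosed_iInter fun g => isClosed_iInter fun i => ?_
  exact isClosed_eq (by fun_prop) continuous_const

instance (d k : ℕ) : CompactSpace (X d k) :=
  isCompact_iff_compactSpace.mp (isClosed_X d k).isCompact

/-- The Haar probability measure `m_X`, as a measure on `(ℤ/2) ^ Γ`. -/
def haarX (d k : ℕ) : ProbabilityMeasure (Gam d k → ZMod 2) :=
  ⟨(Measure.addHaarMeasure (⊤ : TopologicalSpace.PositiveCompacts (X d k))).map Subtype.val,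
    ⟨by
      rw [Measure.map_apply measurable_subtype_coe MeasurableSet.univ]
      exact Measure.addHaarMeasure_self
        (K₀ := (⊤ : TopologicalSpace.PositiveCompacts (X d k)))⟩⟩

/-! ### Uniform homomorphisms and their codes -/

/-- A permutation is `k`-uniform if every point lies in a cycle of length exactly `k`. -/
def IsUniformPerm {V : Type*} (k : ℕ) (τ : Equiv.Perm V) : Prop :=
  ∀ v, Function.minimalPeriod τ v = k

/-- `Hom_unif(Γ, Sym(V))`: homomorphisms that map every generator to a `k`-uniform permutation. -/
abbrev UnifHom (d k : ℕ) (V : Type*) : Type _ :=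
  {σ : Gam d k →* Equiv.Perm V // ∀ i : Fin d, IsUniformPerm k (σ (gen i))}

/-- The code `X_σ`. -/
def code {d k : ℕ} {V : Type*} (σ : Gam d k →* Equiv.Perm V) : Submodule (ZMod 2) (V → ZMod 2) where
  carrier := {x | ∀ (v : V) (i : Fin d), ∑ j ∈ Finset.range k, x ((σ (gen i) ^ j) v) = 0}
  zero_mem' := by intro v i; simp
  add_mem' := by
    intro x y hx hy v i
    simp [Finset.sum_add_distrib, hx v i, hy v i]
  smul_mem' := by
    intro c x hx v i
    simp [← Finset.mul_sum, hx v i]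

/-- The uniform distribution `μ_σ` on the code `X_σ`. -/
def codeMeasure {d k : ℕ} {V : Type*} [Finite V] (σ : Gam d k →* Equiv.Perm V) :
    ProbabilityMeasure (V → ZMod 2) :=
  ⟨ProbabilityTheory.uniformOn (code σ : Set (V → ZMod 2)),
    ProbabilityTheory.isProbabilityMeasure_uniformOn (Set.toFinite _) ⟨0, (code σ).zero_mem⟩⟩

/-- The sizes `n`: positive multiples of `k`. -/
abbrev Size (k : ℕ) : Type := {n : ℕ // 0 < n ∧ k ∣ n}

instance {k : ℕ} (n : Size k) : Nonempty (Fin n.1) := ⟨⟨0, n.2.1⟩⟩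

/-- The probability `ℙ_n(Ω)` of `Ω` under the uniform distribution on `Hom_unif(Γ, Sym(n))`. -/
def unifProb {d k n : ℕ} (Ω : Set (UnifHom d k (Fin n))) : ℝ :=
  (Ω.ncard : ℝ) / Nat.card (UnifHom d k (Fin n))

end ParityCheck

end

open ParityCheck

/-!
Throughout, `V = {1, …, n}`, a *cycle of type `i`* is a cycle of `σ (gen i)`, and an *invariant
tuple* `A` (`InvTuple`) consists of one union `A i` of cycles of type `i` for each generator. The
code of `σ` is cut out by one parity check for each cycle, so a linear functional on
`(ℤ/2) ^ V` vanishes on the code if and only if it is the pairing with the odd set of an invariant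
tuple, the set of points lying in an odd number of the `A i` (`exists_invTuple_of_code_le_ker`).
All assertions are reduced to statements about invariant tuples, and these hold for most `σ` by
first moment estimates.

**Random part.** A fixed set of `a` points is a union of cycles of a random `k`-uniform permutation
with probability `C(n/k, a/k) / C(n, a)` (`weight`), and the generators act independently; this
gives a union bound and a Markov bound over families of tuples (`unifProb_exists_le`,
`mul_unifProb_le`). They show that `σ` is typical (`IsTypical`) with probability tending to one
(`exists_tendsto_unifProb_isTypical`), that is:

* an invariant tuple with a small odd set has no member of intermediate size
  (`exists_unifProb_mid_le`; a tuple is determined by its odd set and all members but one, so the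
  largest weight is gained for free, and this beats the other entropy factors because `d < k`);
* a small number `m` of cycles covers more than `(k + 1) m / 2` points
  (`unifProb_small_union_le`);
* a small nonempty set `W` meets more than `(2 d + 1) |W| / 4` cycles
  (`unifProb_few_cycles_le`, where `d ≥ 3` is used);
* there are `o(n)` short cyclic configurations (`sum_shortFam_le`).

The last property makes the proportion of fixed points of `σ g`, `g ≠ 1`, tend to zero, since a
fixed point produces a short closed walk in the hypergraph of cycles (`card_fixed_le`). Hence most
points have injective balls, and these balls are the same as in the Cayley graph of the group.

**Extension of patterns.** The deterministic core is `IsTypical.exists_codeword`: patterns of the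
subshift on the balls around a separated set `S` of at most a small multiple of `n` points are
induced by one codeword. By duality, an obstruction is an invariant tuple whose odd set lies in the
union `Y` of the balls, and the patterns do not annihilate it. Its large members can be replaced by
their complements, so the tuple has few cycles. Cycles inside `Y` do annihilate the patterns and
are removed. By convexity of balls (`wordBall_convex`), each remaining cycle meets `Y` in at
most one point; as points outside `Y` are covered at least twice, `m` such cycles cover at most
`(k + 1) m / 2` points, against typicality.

Consequently the patterns of a random codeword on separated balls are independent and distributed
as under the Haar measure, both measures having uniform images in finite groups
(`measureReal_preimage_singleton`). One ball gives local convergence, pairs give empirical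
convergence by Chebyshev's inequality, and a greedily chosen separated set of positive density gives
property M, entropies being logarithms of numbers of patterns (`marginalEntropy_eq`).

**Shattering.** Let `W` be the set where two good microstates `x`, `y` differ, and suppose it is
small and nonempty. It meets more than `(2 d + 1) |W| / 4` cycles but has only `d |W|` incidences
with cycles, so more than `|W| / 2` cycles are met exactly once. At each of these a check fails for
`x` or for `y`, and microstates violate few checks (`IsTypical.card_ne_lt`).
-/

namespace ParityCheck

/-! ### Uniform permutations and their invariant sets -/

section UniformPerm

variable {V : Type*} {k : ℕ} {τ : Equiv.Perm V}

theorem IsUniformPerm.pow_eq_one (h : IsUniformPerm k τ) : τ ^ k = 1 := by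
  ext v
  have := Function.iterate_minimalPeriod (f := τ) (x := v)
  rw [h v, Equiv.Perm.iterate_eq_pow] at this
  simpa using this

theorem IsUniformPerm.pow_mod (h : IsUniformPerm k τ) (m : ℕ) : τ ^ (m % k) = τ ^ m :=
  (pow_eq_pow_mod m h.pow_eq_one).symm

theorem IsUniformPerm.pow_apply_inj (h : IsUniformPerm k τ) (v : V) {a b : ℕ} (ha : a < k)
    (hb : b < k) : (τ ^ a) v = (τ ^ b) v ↔ a = b := by
  rw [← Equiv.Perm.iterate_eq_pow, ← Equiv.Perm.iterate_eq_pow]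
  exact Function.iterate_eq_iterate_iff_of_lt_minimalPeriod (by rwa [h v]) (by rwa [h v])

theorem IsUniformPerm.conj (h : IsUniformPerm k τ) (ρ : Equiv.Perm V) :
    IsUniformPerm k (ρ * τ * ρ⁻¹) := by
  intro v
  rw [← h (ρ⁻¹ v), Function.minimalPeriod_eq_minimalPeriod_iff]
  intro n
  rw [Function.IsPeriodicPt, Function.IsFixedPt, Function.IsPeriodicPt, Function.IsFixedPt,
    Equiv.Perm.iterate_eq_pow, Equiv.Perm.iterate_eq_pow, conj_pow, Equiv.Perm.mul_apply,
    Equiv.Perm.mul_apply]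
  constructor
  · intro hv
    exact ρ.injective (by simpa using hv)
  · intro hv
    rw [hv]; simp

/-- `A` is a union of cycles of `τ`. -/
def IsInv (τ : Equiv.Perm V) (A : Finset V) : Prop := ∀ v, τ v ∈ A ↔ v ∈ A

theorem IsInv.pow {A : Finset V} (hA : IsInv τ A) (j : ℕ) (v : V) : (τ ^ j) v ∈ A ↔ v ∈ A := by
  induction j with
  | zero => simp
  | succ j ih => rw [pow_succ', Equiv.Perm.mul_apply, hA, ih]

/-- The cycle of a `k`-uniform permutation through `v`. -/
def orb [DecidableEq V] (k : ℕ) (τ : Equiv.Perm V) (v : V) : Finset V :=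
  (Finset.range k).image fun j => (τ ^ j) v

variable [DecidableEq V]

theorem IsUniformPerm.card_orb (h : IsUniformPerm k τ) (v : V) : (orb k τ v).card = k := by
  rw [orb, Finset.card_image_of_injOn, Finset.card_range]
  intro a ha b hb hab
  simp only [Finset.coe_range, Set.mem_Iio] at ha hb
  exact (h.pow_apply_inj v ha hb).1 hab

theorem pow_mem_orb (hk : 0 < k) (h : IsUniformPerm k τ) (v : V) (m : ℕ) :
    (τ ^ m) v ∈ orb k τ v :=
  Finset.mem_image.2 ⟨m % k, Finset.mem_range.2 (Nat.mod_lt _ hk), by rw [h.pow_mod]⟩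

theorem self_mem_orb (hk : 0 < k) (v : V) : v ∈ orb k τ v :=
  Finset.mem_image.2 ⟨0, Finset.mem_range.2 hk, by simp⟩

theorem mem_orb_iff [Finite V] (hk : 0 < k) (h : IsUniformPerm k τ) {v w : V} :
    w ∈ orb k τ v ↔ τ.SameCycle v w := by
  constructor
  · intro hw
    obtain ⟨j, -, rfl⟩ := Finset.mem_image.1 hw
    exact (Equiv.Perm.SameCycle.refl τ v).pow_right
  · intro hw
    obtain ⟨j, rfl⟩ := hw.exists_nat_pow_eq
    exact pow_mem_orb hk h v j

theorem orb_eq_of_mem [Finite V] (hk : 0 < k) (h : IsUniformPerm k τ) {v w : V}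
    (hw : w ∈ orb k τ v) : orb k τ w = orb k τ v := by
  have hw' := (mem_orb_iff hk h).1 hw
  ext u
  rw [mem_orb_iff hk h, mem_orb_iff hk h]
  exact ⟨hw'.trans, hw'.symm.trans⟩

theorem sum_orb (h : IsUniformPerm k τ) {M : Type*} [AddCommMonoid M] (f : V → M) (v : V) :
    ∑ w ∈ orb k τ v, f w = ∑ j ∈ Finset.range k, f ((τ ^ j) v) := by
  rw [orb, Finset.sum_image]
  intro a ha b hb hab
  simp only [Finset.coe_range, Set.mem_Iio] at ha hb
  exact (h.pow_apply_inj v ha hb).1 hab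

instance [Fintype V] (A : Finset V) : DecidablePred fun τ : Equiv.Perm V => IsInv τ A :=
  fun τ => inferInstanceAs (Decidable (∀ v, τ v ∈ A ↔ v ∈ A))

theorem IsInv.orb_subset {A : Finset V} (hA : IsInv τ A) {v : V} (hv : v ∈ A) :
    orb k τ v ⊆ A := by
  intro w hw
  obtain ⟨j, -, rfl⟩ := Finset.mem_image.1 hw
  exact (hA.pow j v).2 hv

theorem IsInv.compl [Fintype V] {A : Finset V} (hA : IsInv τ A) : IsInv τ Aᶜ := fun v => by
  simp [hA v]

theorem isInv_orb [Finite V] (hk : 0 < k) (h : IsUniformPerm k τ) (v : V) :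
    IsInv τ (orb k τ v) := fun w => by
  rw [mem_orb_iff hk h, mem_orb_iff hk h, Equiv.Perm.sameCycle_apply_right]

theorem isInv_biUnion {ι : Type*} {s : Finset ι} {f : ι → Finset V}
    (hf : ∀ i ∈ s, IsInv τ (f i)) : IsInv τ (s.biUnion f) := fun v => by
  simp only [Finset.mem_biUnion]
  exact exists_congr fun i => and_congr_right fun hi => hf i hi v

/-- The set of cycles contained in `A`. -/
def cycles (k : ℕ) (τ : Equiv.Perm V) (A : Finset V) : Finset (Finset V) := A.image (orb k τ)

theorem biUnion_cycles (hk : 0 < k) {A : Finset V} (hA : IsInv τ A) :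
    (cycles k τ A).biUnion id = A := by
  ext v
  simp only [cycles, Finset.mem_biUnion, Finset.mem_image, id]
  constructor
  · rintro ⟨_, ⟨w, hw, rfl⟩, hv⟩
    exact hA.orb_subset hw hv
  · exact fun hv => ⟨_, ⟨v, hv, rfl⟩, self_mem_orb hk v⟩

variable [Fintype V]

theorem sum_eq_sum_cycles (hk : 0 < k) (h : IsUniformPerm k τ) {A : Finset V} (hA : IsInv τ A)
    {M : Type*} [AddCommMonoid M] (f : V → M) :
    ∑ v ∈ A, f v = ∑ c ∈ cycles k τ A, ∑ v ∈ c, f v := by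
  conv_lhs => rw [← biUnion_cycles hk hA]
  rw [Finset.sum_biUnion]
  · rfl
  · intro c hc c' hc' hne
    simp only [cycles, Finset.coe_image, Set.mem_image] at hc hc'
    obtain ⟨v, -, rfl⟩ := hc
    obtain ⟨w, -, rfl⟩ := hc'
    refine Finset.disjoint_left.2 fun u hu hu' => hne ?_
    exact (orb_eq_of_mem hk h hu).symm.trans (orb_eq_of_mem hk h hu')

theorem card_eq_mul_card_cycles (hk : 0 < k) (h : IsUniformPerm k τ) {A : Finset V}
    (hA : IsInv τ A) : A.card = k * (cycles k τ A).card := by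
  rw [Finset.card_eq_sum_ones, sum_eq_sum_cycles hk h hA, Finset.sum_congr rfl (g := fun _ => k),
    Finset.sum_const, smul_eq_mul, mul_comm]
  intro c hc
  obtain ⟨v, -, rfl⟩ := Finset.mem_image.1 hc
  rw [← Finset.card_eq_sum_ones, h.card_orb]

theorem IsInv.dvd_card (hk : 0 < k) (h : IsUniformPerm k τ) {A : Finset V}
    (hA : IsInv τ A) : k ∣ A.card := ⟨_, card_eq_mul_card_cycles hk h hA⟩

theorem sum_eq_zero_of_sum_orb_eq_zero (hk : 0 < k) (h : IsUniformPerm k τ) {A : Finset V}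
    (hA : IsInv τ A) {M : Type*} [AddCommMonoid M] (f : V → M)
    (hf : ∀ v ∈ A, ∑ w ∈ orb k τ v, f w = 0) : ∑ v ∈ A, f v = 0 := by
  rw [sum_eq_sum_cycles hk h hA]
  refine Finset.sum_eq_zero fun c hc => ?_
  obtain ⟨v, hv, rfl⟩ := Finset.mem_image.1 hc
  exact hf v hv

/-- An invariant set is determined by the cycles it contains. -/
theorem card_isInv_le (hk : 0 < k) (h : IsUniformPerm k τ) (m : ℕ) :
    ((Finset.univ.powersetCard (k * m)).filter fun A : Finset V => IsInv τ A).card ≤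
      (Fintype.card V / k).choose m := by
  have huniv : IsInv τ (Finset.univ : Finset V) := fun v => by simp
  have hN : Fintype.card V / k = (cycles k τ Finset.univ).card := by
    rw [← Finset.card_univ, card_eq_mul_card_cycles hk h huniv, Nat.mul_div_cancel_left _ hk]
  rw [hN, ← Finset.card_powersetCard]
  refine Finset.card_le_card_of_injOn (cycles k τ) ?_ ?_
  · intro A hA
    rw [Finset.mem_coe, Finset.mem_filter, Finset.mem_powersetCard] at hA
    rw [Finset.mem_coe, Finset.mem_powersetCard]
    refine ⟨Finset.image_subset_image (Finset.subset_univ A), ?_⟩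
    have := card_eq_mul_card_cycles hk h hA.2
    rw [hA.1.2] at this
    exact (Nat.eq_of_mul_eq_mul_left hk this).symm
  · intro A hA B hB hAB
    rw [Finset.mem_coe, Finset.mem_filter] at hA hB
    rw [← biUnion_cycles hk hA.2, ← biUnion_cycles hk hB.2, hAB]

end UniformPerm

/-! ### The probability that a fixed set is invariant -/

section Weight

variable {V : Type*} [Fintype V] [DecidableEq V] {k : ℕ}

/-- The probability that a given set of `a` points is a union of cycles of a random `k`-uniform
permutation of `n` points. -/
noncomputable def weight (n k a : ℕ) : ℝ :=
  if k ∣ a then ((n / k).choose (a / k) : ℝ) / n.choose a else 0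

theorem weight_nonneg (n k a : ℕ) : 0 ≤ weight n k a := by
  unfold weight; split_ifs <;> positivity

noncomputable instance : DecidablePred fun τ : Equiv.Perm V => IsUniformPerm k τ :=
  Classical.decPred _

/-- The finite set of `k`-uniform permutations. -/
noncomputable def uniformPerms (V : Type*) [Fintype V] [DecidableEq V] (k : ℕ) :
    Finset (Equiv.Perm V) :=
  Finset.univ.filter fun τ => IsUniformPerm k τ

/-- Conjugation permutes the uniform permutations, so only the size of the set matters. -/
theorem card_filter_isInv_eq {A B : Finset V} (hAB : A.card = B.card) :
    ((uniformPerms V k).filter fun τ => IsInv τ A).card =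
      ((uniformPerms V k).filter fun τ => IsInv τ B).card := by
  obtain ⟨ρ, hρ⟩ : ∃ ρ : Equiv.Perm V, ∀ v, ρ v ∈ B ↔ v ∈ A := by
    let e : {x // x ∈ A} ≃ {x // x ∈ B} := Finset.equivOfCardEq hAB
    refine ⟨e.extendSubtype, fun v => ⟨fun h => ?_, fun h => e.extendSubtype_mem v h⟩⟩
    by_contra hv
    exact e.extendSubtype_not_mem v hv h
  refine Finset.card_bij' (fun τ _ => ρ * τ * ρ⁻¹) (fun τ _ => ρ⁻¹ * τ * ρ) ?_ ?_ ?_ ?_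
  · intro τ hτ
    simp only [uniformPerms, Finset.mem_filter, Finset.mem_univ, true_and] at hτ ⊢
    refine ⟨hτ.1.conj ρ, fun v => ?_⟩
    have h1 : v ∈ B ↔ ρ⁻¹ v ∈ A := by rw [← hρ]; simp
    rw [Equiv.Perm.mul_apply, Equiv.Perm.mul_apply, hρ, hτ.2, h1]
  · intro τ hτ
    simp only [uniformPerms, Finset.mem_filter, Finset.mem_univ, true_and] at hτ ⊢
    refine ⟨by simpa using hτ.1.conj ρ⁻¹, fun v => ?_⟩
    have h1 : ∀ w, w ∈ B ↔ ρ⁻¹ w ∈ A := fun w => by rw [← hρ]; simp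
    rw [Equiv.Perm.mul_apply, Equiv.Perm.mul_apply, ← h1, hτ.2, hρ]
  · intro τ _; group
  · intro τ _; group

/-- The probability that `A` is invariant is at most `weight`. -/
theorem card_filter_isInv_le (hk : 0 < k) (A : Finset V) :
    (((uniformPerms V k).filter fun τ => IsInv τ A).card : ℝ) ≤
      (uniformPerms V k).card * weight (Fintype.card V) k A.card := by
  unfold weight
  split_ifs with hdvd
  · obtain ⟨m, hm⟩ := hdvd
    have hpos : (0 : ℝ) < (Fintype.card V).choose A.card := by
      exact_mod_cast Nat.choose_pos (Finset.card_le_univ A)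
    rw [mul_div_assoc', le_div_iff₀ hpos, hm, Nat.mul_div_cancel_left _ hk]
    -- double counting of the pairs `(τ, B)` with `B` invariant under `τ` and `#B = #A`
    have h1 : ∑ B ∈ Finset.univ.powersetCard (k * m),
        ((uniformPerms V k).filter fun τ => IsInv τ B).card =
        ((uniformPerms V k).filter fun τ => IsInv τ A).card * (Fintype.card V).choose (k * m) := by
      rw [Finset.sum_congr rfl (g := fun _ =>
        ((uniformPerms V k).filter fun τ => IsInv τ A).card), Finset.sum_const,
        Finset.card_powersetCard, Finset.card_univ, smul_eq_mul, mul_comm]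
      intro B hB
      exact card_filter_isInv_eq ((Finset.mem_powersetCard.1 hB).2.trans hm.symm)
    have h2 : ∑ B ∈ Finset.univ.powersetCard (k * m),
        ((uniformPerms V k).filter fun τ => IsInv τ B).card =
        ∑ τ ∈ uniformPerms V k,
          ((Finset.univ.powersetCard (k * m)).filter fun B : Finset V => IsInv τ B).card := by
      simp only [Finset.card_filter]
      exact Finset.sum_comm
    have h3 : ∑ τ ∈ uniformPerms V k,
        ((Finset.univ.powersetCard (k * m)).filter fun B : Finset V => IsInv τ B).card ≤
        (uniformPerms V k).card * (Fintype.card V / k).choose m := by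
      rw [← smul_eq_mul]
      refine Finset.sum_le_card_nsmul _ _ _ fun τ hτ => ?_
      exact card_isInv_le hk (Finset.mem_filter.1 hτ).2 m
    have h4 := h1.symm.trans_le (h2.trans_le h3)
    exact_mod_cast h4
  · rw [mul_zero]
    refine le_of_eq ?_
    rw [Nat.cast_eq_zero, Finset.card_eq_zero, Finset.filter_eq_empty_iff]
    intro τ hτ hA
    exact hdvd (hA.dvd_card hk (Finset.mem_filter.1 hτ).2)

end Weight

/-! ### Word length in the free product -/

section Group

variable {d k : ℕ}

open Monoid.CoprodI in
/-- The syllable length of the reduced word of `g`. -/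
def sylLen (g : Gam d k) : ℕ := (Word.equiv g).toList.length

theorem gen_pow (i : Fin d) (j : ℕ) :
    (gen i : Gam d k) ^ j = Monoid.CoprodI.of (i := i) (Multiplicative.ofAdd (j : ZMod k)) := by
  rw [gen, ← map_pow, ← ofAdd_nsmul, nsmul_one]

theorem gen_pow_self (i : Fin d) : (gen i : Gam d k) ^ k = 1 := by
  rw [gen_pow, ZMod.natCast_self, ofAdd_zero, map_one]

open Monoid.CoprodI in
theorem wordEquiv_mul (g h : Gam d k) : Word.equiv (g * h) = g • Word.equiv h :=
  mul_smul g h (Word.empty : Word fun _ : Fin d => Multiplicative (ZMod k))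

open Monoid.CoprodI in
theorem length_rcons {i : Fin d} (p : Word.Pair (fun _ : Fin d => Multiplicative (ZMod k)) i) :
    (Word.rcons p).toList.length = p.tail.toList.length + if p.head = 1 then 0 else 1 := by
  unfold Word.rcons
  split_ifs with h <;> simp

open Monoid.CoprodI in
/-- Along a left coset of the cyclic factor `i`, the syllable length takes the value `n` at one
element and the value `n + 1` at all others. -/
theorem exists_sylLen_of_mul (i : Fin d) (g : Gam d k) :
    ∃ (n : ℕ) (c : Multiplicative (ZMod k)), ∀ m : Multiplicative (ZMod k),
      sylLen (Monoid.CoprodI.of (i := i) m * g) = n + if m * c = 1 then 0 else 1 := by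
  refine ⟨(Word.equivPair i (Word.equiv g)).tail.toList.length,
    (Word.equivPair i (Word.equiv g)).head, fun m => ?_⟩
  rw [sylLen, wordEquiv_mul, Word.of_smul_def, length_rcons]

theorem sylLen_of_mul_le (i : Fin d) (m : Multiplicative (ZMod k)) (g : Gam d k) :
    sylLen (Monoid.CoprodI.of (i := i) m * g) ≤ sylLen g + 1 := by
  obtain ⟨n, c, h⟩ := exists_sylLen_of_mul i g
  have h1 := h 1
  rw [map_one, one_mul] at h1
  rw [h, h1]
  split_ifs <;> omega

open Monoid.CoprodI in
theorem sylLen_one : sylLen (1 : Gam d k) = 0 := by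
  have : Word.equiv (1 : Gam d k) = Word.empty :=
    one_smul (Gam d k) (Word.empty : Word fun _ : Fin d => Multiplicative (ZMod k))
  rw [sylLen, this]; rfl

theorem mem_gens_of [NeZero k] (i : Fin d) {m : Multiplicative (ZMod k)} (hm : m ≠ 1) :
    Monoid.CoprodI.of (i := i) m ∈ gens d k := by
  refine ⟨i, (Multiplicative.toAdd m).val, ?_, ZMod.val_lt _, ?_⟩
  · rw [Nat.one_le_iff_ne_zero, Ne, ZMod.val_eq_zero]
    exact hm
  · rw [gen_pow, ZMod.natCast_val, ZMod.cast_id]; rfl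

open Monoid.CoprodI in
theorem wordBall_eq [NeZero k] (r : ℕ) : wordBall (gens d k) r = {g | sylLen g ≤ r} := by
  ext g
  constructor
  · rintro ⟨l, hl, rfl, hr⟩
    refine le_trans ?_ hr
    clear hr
    induction l with
    | nil => simp [sylLen_one]
    | cons e l ih =>
      obtain ⟨i, j, -, -, he⟩ := hl e (by simp)
      rw [List.prod_cons, he, gen_pow, List.length_cons]
      exact (sylLen_of_mul_le _ _ _).trans
        (Nat.succ_le_succ (ih fun x hx => hl x (List.mem_cons_of_mem _ hx)))
  · intro hg
    refine ⟨(Word.equiv g).toList.map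
      fun x => of (M := fun _ => Multiplicative (ZMod k)) (i := x.1) x.2, ?_, ?_, ?_⟩
    · intro x hx
      obtain ⟨⟨i, m⟩, hy, rfl⟩ := List.mem_map.1 hx
      exact mem_gens_of i ((Word.equiv g).ne_one _ hy)
    · exact Word.equiv.symm_apply_apply g
    · rw [List.length_map]; exact hg

/-- A left coset of a cyclic factor with two distinct elements in a ball lies inside that ball. -/
theorem wordBall_convex [NeZero k] {r : ℕ} {i : Fin d} {b : Gam d k} {j : ℕ}
    (hb : b ∈ wordBall (gens d k) r) (hj : gen i ^ j * b ∈ wordBall (gens d k) r)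
    (hne : gen i ^ j * b ≠ b) (t : ℕ) : gen i ^ t * b ∈ wordBall (gens d k) r := by
  rw [wordBall_eq, Set.mem_ofPred_eq] at *
  obtain ⟨n, c, h⟩ := exists_sylLen_of_mul i b
  have h1 := h 1
  rw [map_one, one_mul, one_mul] at h1
  rw [h1] at hb
  rw [gen_pow, h] at hj ⊢
  have hm : Multiplicative.ofAdd (j : ZMod k) ≠ 1 := by
    intro hm
    rw [gen_pow, hm, map_one, one_mul] at hne
    exact hne rfl
  by_cases hc : c = 1
  · rw [hc, mul_one, if_neg hm] at hj
    split_ifs <;> omega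
  · rw [if_neg hc] at hb
    split_ifs <;> omega

section wordBall

variable {E : Set (Gam d k)}

theorem one_mem_wordBall (r : ℕ) : (1 : Gam d k) ∈ wordBall E r := ⟨[], by simp, rfl, by simp⟩

theorem mul_mem_wordBall {g h : Gam d k} {r s : ℕ} (hg : g ∈ wordBall E r)
    (hh : h ∈ wordBall E s) : g * h ∈ wordBall E (r + s) := by
  obtain ⟨l, hl, rfl, hr⟩ := hg
  obtain ⟨l', hl', rfl, hs⟩ := hh
  refine ⟨l ++ l', ?_, by simp, by simp; omega⟩
  intro x hx
  rcases List.mem_append.1 hx with hx | hx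
  exacts [hl x hx, hl' x hx]

theorem wordBall_mono {r s : ℕ} (hrs : r ≤ s) : wordBall E r ⊆ wordBall E s := by
  rintro _ ⟨l, hl, rfl, hr⟩
  exact ⟨l, hl, rfl, hr.trans hrs⟩

end wordBall

theorem gen_pow_mem_wordBall [NeZero k] (i : Fin d) (j : ℕ) :
    (gen i : Gam d k) ^ j ∈ wordBall (gens d k) 1 := by
  rw [wordBall_eq, Set.mem_ofPred_eq, gen_pow]
  simpa [sylLen_one] using sylLen_of_mul_le i (Multiplicative.ofAdd (j : ZMod k)) (1 : Gam d k)

theorem inv_mem_wordBall [NeZero k] {g : Gam d k} {r : ℕ} (hg : g ∈ wordBall (gens d k) r) :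
    g⁻¹ ∈ wordBall (gens d k) r := by
  obtain ⟨l, hl, rfl, hr⟩ := hg
  refine ⟨(l.map fun x => x⁻¹).reverse, ?_, by rw [List.prod_inv_reverse], by simpa using hr⟩
  intro x hx
  rw [List.mem_reverse, List.mem_map] at hx
  obtain ⟨y, hy, rfl⟩ := hx
  obtain ⟨i, j, h1, h2, rfl⟩ := hl y hy
  refine ⟨i, k - j, by omega, by omega, ?_⟩
  rw [inv_eq_iff_mul_eq_one, ← pow_add, Nat.add_sub_cancel' h2.le, gen_pow_self]

theorem finite_gens : (gens d k).Finite := by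
  refine (Set.finite_range fun p : Fin d × Fin k => (gen p.1 : Gam d k) ^ (p.2 : ℕ)).subset ?_
  rintro _ ⟨i, j, -, h, rfl⟩
  exact ⟨(i, ⟨j, h⟩), rfl⟩

theorem finite_wordBall (r : ℕ) : (wordBall (gens d k) r).Finite := by
  have : Finite (gens d k) := finite_gens
  refine ((List.finite_length_le (gens d k) r).image
    fun l => (l.map Subtype.val).prod).subset ?_
  rintro _ ⟨l, hl, rfl, hr⟩
  refine ⟨l.attachWith _ hl, by simpa using hr, by simp⟩

end Group

/-! ### Uniform homomorphisms as tuples of uniform permutations -/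

section Hom

variable {d k : ℕ} {V : Type*}

/-- The homomorphism from the cyclic group of order `k` given by a permutation of order
dividing `k`. -/
def powHom (τ : Equiv.Perm V) (h : τ ^ k = 1) : Multiplicative (ZMod k) →* Equiv.Perm V :=
  AddMonoidHom.toMultiplicativeLeft (ZMod.lift k ⟨zmultiplesHom _ (Additive.ofMul τ), by
    simpa using congrArg Additive.ofMul h⟩)

theorem powHom_ofAdd_one (τ : Equiv.Perm V) (h : τ ^ k = 1) :
    powHom τ h (Multiplicative.ofAdd 1) = τ := by
  have : (1 : ZMod k) = ((1 : ℤ) : ZMod k) := by simp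
  simp only [powHom, AddMonoidHom.toMultiplicativeLeft_apply_apply, toAdd_ofAdd]
  rw [this, ZMod.lift_coe]
  simp

/-- A uniform homomorphism is the same as one uniform permutation for each generator. -/
noncomputable def unifHomEquiv (d k : ℕ) [NeZero k] (V : Type*) :
    UnifHom d k V ≃ (Fin d → {τ : Equiv.Perm V // IsUniformPerm k τ}) :=
  Equiv.ofBijective (fun σ i => ⟨σ.1 (gen i), σ.2 i⟩) <| by
    constructor
    · intro σ σ' h
      have h' : ∀ i, σ.1 (gen i) = σ'.1 (gen i) := fun i => congrArg Subtype.val (congrFun h i)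
      refine Subtype.ext (Monoid.CoprodI.ext_hom _ _ fun i => MonoidHom.ext fun m => ?_)
      have hm : Monoid.CoprodI.of (i := i) m =
          (gen i : Gam d k) ^ (Multiplicative.toAdd m).val := by
        rw [gen_pow, ZMod.natCast_val, ZMod.cast_id]; rfl
      rw [MonoidHom.comp_apply, MonoidHom.comp_apply, hm, map_pow, map_pow, h']
    · intro τ
      have key : ∀ i, Monoid.CoprodI.lift (fun i => powHom (τ i).1 (τ i).2.pow_eq_one) (gen i) =
          (τ i).1 := fun i => by
        rw [gen, Monoid.CoprodI.lift_of, powHom_ofAdd_one]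
      exact ⟨⟨_, fun i => (key i).symm ▸ (τ i).2⟩, funext fun i => Subtype.ext (key i)⟩

instance [Finite V] [NeZero k] : Finite (UnifHom d k V) :=
  Finite.of_equiv _ (unifHomEquiv d k V).symm

theorem exists_isUniformPerm {n : ℕ} (hk : 0 < k) (hn : k ∣ n) :
    ∃ τ : Equiv.Perm (Fin n), IsUniformPerm k τ := by
  obtain ⟨N, rfl⟩ := hn
  have : NeZero k := ⟨hk.ne'⟩
  let ρ : Equiv.Perm (ZMod k × Fin N) := (Equiv.addRight (1 : ZMod k)).prodCongr (Equiv.refl _)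
  have hρ : ∀ (m : ℕ) x, (ρ ^ m) x = (x.1 + m, x.2) := by
    intro m x
    induction m with
    | zero => simp
    | succ m ih =>
      rw [pow_succ', Equiv.Perm.mul_apply, ih]
      simp [ρ, add_assoc]
  let e : ZMod k × Fin N ≃ Fin (k * N) :=
    Fintype.equivFinOfCardEq (by simp [ZMod.card])
  have he : ∀ m : ℕ, (e.permCongr ρ) ^ m = e.permCongr (ρ ^ m) := fun m =>
    (map_pow e.permCongrHom ρ m).symm
  refine ⟨e.permCongr ρ, fun v => Nat.dvd_antisymm ?_ ?_⟩
  · apply Function.IsPeriodicPt.minimalPeriod_dvd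
    rw [Function.IsPeriodicPt, Function.IsFixedPt, Equiv.Perm.iterate_eq_pow, he]
    simp [hρ]
  · have := Function.isPeriodicPt_minimalPeriod (e.permCongr ρ) v
    rw [Function.IsPeriodicPt, Function.IsFixedPt, Equiv.Perm.iterate_eq_pow, he,
      Equiv.permCongr_apply, hρ, ← Equiv.eq_symm_apply, Prod.ext_iff] at this
    rw [← ZMod.natCast_eq_zero_iff]
    simpa using this.1

theorem nonempty_unifHom {n : ℕ} [NeZero k] (hn : k ∣ n) :
    Nonempty (UnifHom d k (Fin n)) := by
  obtain ⟨τ, hτ⟩ := exists_isUniformPerm (NeZero.pos k) hn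
  exact ⟨(unifHomEquiv d k (Fin n)).symm fun _ => ⟨τ, hτ⟩⟩

end Hom

/-! ### First moment bounds over uniform homomorphisms -/

section Prob

variable {d k n : ℕ}

/-- The tuple `A` of sets is invariant under `σ`: `A i` is a union of cycles of `σ (gen i)`. -/
def InvTuple {V : Type*} [DecidableEq V] (σ : Gam d k →* Equiv.Perm V) (A : Fin d → Finset V) :
    Prop := ∀ i, IsInv (σ (gen i)) (A i)

theorem ncard_invTuple_le [NeZero k] (A : Fin d → Finset (Fin n)) :
    (Set.ncard {σ : UnifHom d k (Fin n) | InvTuple σ.1 A} : ℝ) ≤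
      Nat.card (UnifHom d k (Fin n)) * ∏ i, weight n k (A i).card := by
  classical
  have hT : Nat.card {τ : Equiv.Perm (Fin n) // IsUniformPerm k τ} =
      (uniformPerms (Fin n) k).card := by
    rw [Nat.card_eq_fintype_card, Fintype.card_subtype]
    unfold uniformPerms
    congr
  have h1 : Nat.card (UnifHom d k (Fin n)) = ∏ _i : Fin d, (uniformPerms (Fin n) k).card := by
    rw [Nat.card_congr (unifHomEquiv d k (Fin n)), Nat.card_pi]
    simp only [hT]
  have h2 : Set.ncard {σ : UnifHom d k (Fin n) | InvTuple σ.1 (A)} ≤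
      ∏ i, ((uniformPerms (Fin n) k).filter fun τ => IsInv τ (A i)).card := by
    rw [← Fintype.card_piFinset, ← Set.ncard_coe_finset]
    refine Set.ncard_le_ncard_of_injOn (fun σ i => σ.1 (gen i)) ?_ ?_ (Set.toFinite _)
    · intro σ hσ
      rw [Finset.mem_coe, Fintype.mem_piFinset]
      intro i
      simp only [uniformPerms, Finset.mem_filter, Finset.mem_univ, true_and]
      exact ⟨σ.2 i, hσ i⟩
    · intro σ _ σ' _ h
      exact (unifHomEquiv d k (Fin n)).injective (funext fun i => Subtype.ext (congrFun h i))
  rw [h1, Nat.cast_prod, ← Finset.prod_mul_distrib]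
  refine le_trans (Nat.cast_le.2 h2) ?_
  rw [Nat.cast_prod]
  refine Finset.prod_le_prod (fun _ _ => Nat.cast_nonneg _) fun i _ => ?_
  simpa using card_filter_isInv_le (NeZero.pos k) (A i)

theorem unifProb_mono [NeZero k] {S T : Set (UnifHom d k (Fin n))} (h : S ⊆ T) :
    unifProb S ≤ unifProb T := by
  unfold unifProb
  gcongr
  exact Set.toFinite _

theorem unifProb_union_le [NeZero k] (S T : Set (UnifHom d k (Fin n))) :
    unifProb (S ∪ T) ≤ unifProb S + unifProb T := by
  unfold unifProb
  rw [← add_div]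
  gcongr
  exact_mod_cast Set.ncard_union_le S T

theorem unifProb_compl [NeZero k] (hn : k ∣ n) (S : Set (UnifHom d k (Fin n))) :
    unifProb Sᶜ = 1 - unifProb S := by
  have := nonempty_unifHom (d := d) hn
  have h0 : (Nat.card (UnifHom d k (Fin n)) : ℝ) ≠ 0 := by
    exact_mod_cast Nat.card_pos.ne'
  unfold unifProb
  rw [eq_sub_iff_add_eq, ← add_div, div_eq_one_iff_eq h0, add_comm]
  exact_mod_cast Set.ncard_add_ncard_compl S

theorem unifProb_nonneg (S : Set (UnifHom d k (Fin n))) : 0 ≤ unifProb S := by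
  unfold unifProb; positivity

open Classical in
/-- Markov's inequality for the number of invariant tuples in a finite family. -/
theorem mul_unifProb_le [NeZero k] (hn : k ∣ n) {ι : Type*} (F : Finset ι)
    (A : ι → Fin d → Finset (Fin n)) (t : ℝ) :
    t * unifProb {σ : UnifHom d k (Fin n) | t ≤ (F.filter fun x => InvTuple σ.1 (A x)).card} ≤
      ∑ x ∈ F, ∏ i, weight n k (A x i).card := by
  have := nonempty_unifHom (d := d) hn
  have : Fintype (UnifHom d k (Fin n)) := Fintype.ofFinite _
  have h0 : (0 : ℝ) < Nat.card (UnifHom d k (Fin n)) := by exact_mod_cast Nat.card_pos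
  unfold unifProb
  rw [mul_div_assoc', div_le_iff₀ h0, Finset.sum_mul]
  calc t * (Set.ncard {σ : UnifHom d k (Fin n) |
          t ≤ (F.filter fun x => InvTuple σ.1 (A x)).card} : ℝ)
      = ∑ _σ ∈ Finset.univ.filter fun σ : UnifHom d k (Fin n) =>
          t ≤ (F.filter fun x => InvTuple σ.1 (A x)).card, t := by
        rw [Finset.sum_const, nsmul_eq_mul, mul_comm, Set.ncard_eq_toFinset_card']
        simp
    _ ≤ ∑ σ ∈ Finset.univ.filter fun σ : UnifHom d k (Fin n) =>
          t ≤ (F.filter fun x => InvTuple σ.1 (A x)).card,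
          ((F.filter fun x => InvTuple σ.1 (A x)).card : ℝ) :=
        Finset.sum_le_sum fun σ hσ => (Finset.mem_filter.1 hσ).2
    _ ≤ ∑ σ : UnifHom d k (Fin n), ((F.filter fun x => InvTuple σ.1 (A x)).card : ℝ) :=
        Finset.sum_le_sum_of_subset_of_nonneg (Finset.filter_subset _ _)
          fun _ _ _ => Nat.cast_nonneg _
    _ = ∑ x ∈ F, (Set.ncard {σ : UnifHom d k (Fin n) | InvTuple σ.1 (A x)} : ℝ) := by
        simp only [Finset.card_filter, Nat.cast_sum, Set.ncard_eq_toFinset_card']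
        rw [Finset.sum_comm]
        simp
    _ ≤ _ := Finset.sum_le_sum fun x _ => by
        rw [mul_comm]; exact ncard_invTuple_le (A x)

open Classical in
/-- The union bound: the probability that some tuple of a finite family is invariant. -/
theorem unifProb_exists_le [NeZero k] (hn : k ∣ n) {ι : Type*} (F : Finset ι)
    (A : ι → Fin d → Finset (Fin n)) :
    unifProb {σ : UnifHom d k (Fin n) | ∃ x ∈ F, InvTuple σ.1 (A x)} ≤
      ∑ x ∈ F, ∏ i, weight n k (A x i).card := by
  refine le_trans ?_ (mul_unifProb_le hn F A 1)
  rw [one_mul]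
  refine unifProb_mono ?_
  rintro σ ⟨x, hx, hA⟩
  have : 0 < (F.filter fun x => InvTuple σ.1 (A x)).card :=
    Finset.card_pos.2 ⟨x, Finset.mem_filter.2 ⟨hx, hA⟩⟩
  exact_mod_cast this

end Prob

/-! ### Weighted sums over sets -/

section Sums

variable {d k n N : ℕ}

/-- The number of cycles in an invariant tuple. As every cycle has `k` points, the divisions are
exact for such tuples. -/
def numCycles (k : ℕ) {V : Type*} (A : Fin d → Finset V) : ℕ := ∑ i, (A i).card / k

/-- `C(z, a) / C(n, a) ≤ (z / n) ^ a`. -/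
theorem choose_mul_pow_le {z n : ℕ} (hz : z ≤ n) (a : ℕ) :
    z.choose a * n ^ a ≤ n.choose a * z ^ a := by
  have h : z.descFactorial a * n ^ a ≤ n.descFactorial a * z ^ a := by
    induction a with
    | zero => simp
    | succ a ih =>
      rw [Nat.descFactorial_succ, Nat.descFactorial_succ, pow_succ, pow_succ]
      have h1 : (z - a) * n ≤ (n - a) * z := by
        rw [Nat.sub_mul, Nat.sub_mul, mul_comm n z]
        exact Nat.sub_le_sub_left (Nat.mul_le_mul_left a hz) _
      calc (z - a) * z.descFactorial a * (n ^ a * n)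
          = (z.descFactorial a * n ^ a) * ((z - a) * n) := by ring
        _ ≤ (n.descFactorial a * z ^ a) * ((n - a) * z) := Nat.mul_le_mul ih h1
        _ = _ := by ring
  rw [Nat.descFactorial_eq_factorial_mul_choose, Nat.descFactorial_eq_factorial_mul_choose,
    mul_assoc, mul_assoc] at h
  exact Nat.le_of_mul_le_mul_left h (Nat.factorial_pos a)

/-- Among the sets of `a` points, the proportion of those containing `W` is at most
`(a / n) ^ |W|`. -/
theorem card_filter_superset_le (W : Finset (Fin n)) (hn : 0 < n) (a : ℕ) :
    (((Finset.univ.powersetCard a).filter fun A => W ⊆ A).card : ℝ) ≤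
      ((a : ℝ) / n) ^ W.card * n.choose a := by
  by_cases ha : n < a
  · have : (Finset.univ.powersetCard a : Finset (Finset (Fin n))) = ∅ :=
      Finset.powersetCard_eq_empty.2 (by simpa using ha)
    rw [this]
    simp only [Finset.filter_empty, Finset.card_empty, Nat.cast_zero]
    positivity
  push Not at ha
  rcases lt_or_ge a W.card with hw | hw
  · rw [Finset.filter_false_of_mem]
    · simp only [Finset.card_empty, Nat.cast_zero]
      positivity
    · intro A hA hWA
      have := Finset.card_le_card hWA
      rw [(Finset.mem_powersetCard.1 hA).2] at this
      omega
  have h1 : ((Finset.univ.powersetCard a).filter fun A => W ⊆ A).card ≤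
      (n - W.card).choose (a - W.card) := by
    have : (n - W.card) = (Wᶜ).card := by rw [Finset.card_compl, Fintype.card_fin]
    rw [this, ← Finset.card_powersetCard]
    refine Finset.card_le_card_of_injOn (fun A => A \ W) ?_ ?_
    · intro A hA
      simp only [Finset.coe_filter, Finset.mem_powersetCard, Set.mem_ofPred_eq] at hA
      rw [Finset.mem_coe, Finset.mem_powersetCard, Finset.card_sdiff_of_subset hA.2, hA.1.2]
      refine ⟨fun v hv => ?_, rfl⟩
      rw [Finset.mem_compl]
      exact (Finset.mem_sdiff.1 hv).2
    · intro A hA B hB hAB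
      simp only [Finset.coe_filter, Finset.mem_powersetCard, Set.mem_ofPred_eq] at hA hB
      rw [← Finset.sdiff_union_of_subset hA.2, ← Finset.sdiff_union_of_subset hB.2]
      exact congrArg (· ∪ W) hAB
  have h2 := Nat.choose_mul (n := n) hw
  have h3 := choose_mul_pow_le ha W.card
  have h4 : (n - W.card).choose (a - W.card) * n ^ W.card ≤ n.choose a * a ^ W.card := by
    have hpos : 0 < n.choose W.card := Nat.choose_pos (hw.trans ha)
    refine Nat.le_of_mul_le_mul_left ?_ hpos
    calc n.choose W.card * ((n - W.card).choose (a - W.card) * n ^ W.card)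
        = n.choose a * (a.choose W.card * n ^ W.card) := by rw [← mul_assoc, ← h2, mul_assoc]
      _ ≤ n.choose a * (n.choose W.card * a ^ W.card) := Nat.mul_le_mul_left _ h3
      _ = _ := by ring
  have hn' : (0 : ℝ) < n := by exact_mod_cast hn
  rw [div_pow, div_mul_eq_mul_div, le_div_iff₀ (by positivity)]
  calc (((Finset.univ.powersetCard a).filter fun A => W ⊆ A).card : ℝ) * n ^ W.card
      ≤ ((n - W.card).choose (a - W.card) : ℝ) * n ^ W.card := by gcongr
    _ ≤ n.choose a * a ^ W.card := by exact_mod_cast h4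
    _ = _ := by ring

/-- A weighted sum over a family of sets, organised by size: if the family contains at most the
proportion `c * ρ ^ m` of the sets of `k * m` points, the binomial theorem bounds the sum. -/
theorem sum_weight_le (hk : 0 < k) (hn : n = k * N) (F : Finset (Finset (Fin n))) {u : ℝ}
    (hu : 0 ≤ u) {c ρ : ℝ}
    (h : ∀ m, ((F.filter fun A => A.card = k * m).card : ℝ) ≤ c * ρ ^ m * n.choose (k * m)) :
    ∑ A ∈ F, weight n k A.card * u ^ (A.card / k) ≤ c * (1 + u * ρ) ^ N := by
  calc ∑ A ∈ F, weight n k A.card * u ^ (A.card / k)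
      ≤ ∑ A ∈ F, ∑ m ∈ Finset.range (N + 1),
          if A.card = k * m then (N.choose m : ℝ) / n.choose (k * m) * u ^ m else 0 := by
        refine Finset.sum_le_sum fun A _ => ?_
        have hnonneg : ∀ m ∈ Finset.range (N + 1),
            0 ≤ if A.card = k * m then (N.choose m : ℝ) / n.choose (k * m) * u ^ m else 0 := by
          intro m _
          split_ifs <;> positivity
        by_cases hA : k ∣ A.card
        · obtain ⟨m, hm⟩ := hA
          have hmN : m ∈ Finset.range (N + 1) := by
            have h1 := Finset.card_le_univ A
            rw [Fintype.card_fin, hm, hn] at h1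
            have := Nat.le_of_mul_le_mul_left h1 hk
            exact Finset.mem_range.2 (by omega)
          refine le_trans (le_of_eq ?_) (Finset.single_le_sum hnonneg hmN)
          rw [if_pos hm, weight, if_pos ⟨m, hm⟩, hm, Nat.mul_div_cancel_left _ hk]
          conv_lhs => rw [show n / k = N by rw [hn, Nat.mul_div_cancel_left _ hk]]
        · rw [weight, if_neg hA, zero_mul]
          exact Finset.sum_nonneg hnonneg
    _ = ∑ m ∈ Finset.range (N + 1), (F.filter fun A => A.card = k * m).card *
          ((N.choose m : ℝ) / n.choose (k * m) * u ^ m) := by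
        rw [Finset.sum_comm]
        refine Finset.sum_congr rfl fun m _ => ?_
        rw [← Finset.sum_filter, Finset.sum_const, nsmul_eq_mul]
    _ ≤ ∑ m ∈ Finset.range (N + 1), c * ((u * ρ) ^ m * 1 ^ (N - m) * N.choose m) := by
        refine Finset.sum_le_sum fun m hm => ?_
        have hpos : (0 : ℝ) < n.choose (k * m) := by
          rw [hn]
          have := Finset.mem_range.1 hm
          exact_mod_cast Nat.choose_pos (Nat.mul_le_mul_left k (by omega))
        calc _ ≤ (c * ρ ^ m * n.choose (k * m)) *
              ((N.choose m : ℝ) / n.choose (k * m) * u ^ m) := by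
              gcongr
              exact h m
          _ = _ := by rw [mul_pow]; field_simp; simp
    _ = c * (1 + u * ρ) ^ N := by rw [add_comm 1, add_pow, Finset.mul_sum]

theorem sum_weight_subset_le (hk : 0 < k) (hn : n = k * N) (hn0 : 0 < n) (Z : Finset (Fin n))
    {u : ℝ} (hu : 0 ≤ u) :
    ∑ A ∈ Z.powerset, weight n k A.card * u ^ (A.card / k) ≤
      (1 + u * ((Z.card : ℝ) / n) ^ k) ^ N := by
  rw [← one_mul ((1 + _) ^ N)]
  refine sum_weight_le hk hn _ hu fun m => ?_
  have h1 : ((Z.powerset).filter fun A => A.card = k * m) = Z.powersetCard (k * m) := by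
    ext A; simp [Finset.mem_powersetCard]
  have hZ : Z.card ≤ n := by simpa using Finset.card_le_univ Z
  have hn' : (0 : ℝ) < n := by exact_mod_cast hn0
  rw [h1, Finset.card_powersetCard, one_mul, ← pow_mul, div_pow, div_mul_eq_mul_div,
    le_div_iff₀ (by positivity), mul_comm ((Z.card : ℝ) ^ _)]
  exact_mod_cast choose_mul_pow_le hZ (k * m)

theorem sum_weight_superset_le (hk : 0 < k) (hn : n = k * N) (hn0 : 0 < n) (W : Finset (Fin n))
    (t : ℕ) {u : ℝ} (hu : 0 ≤ u) :
    ∑ A ∈ Finset.univ.filter (fun A => W ⊆ A ∧ A.card / k ≤ t),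
        weight n k A.card * u ^ (A.card / k) ≤
      ((k * t : ℝ) / n) ^ W.card * (1 + u) ^ N := by
  have hn' : (0 : ℝ) < n := by exact_mod_cast hn0
  rw [show 1 + u = 1 + u * 1 by rw [mul_one]]
  refine sum_weight_le hk hn _ hu fun m => ?_
  rw [one_pow, mul_one]
  by_cases hm : m ≤ t
  · calc _ ≤ (((Finset.univ.powersetCard (k * m)).filter fun A => W ⊆ A).card : ℝ) := by
          refine Nat.cast_le.2 (Finset.card_le_card fun A hA => ?_)
          simp only [Finset.mem_filter, Finset.mem_univ, true_and] at hA
          simp [hA.1.1, hA.2]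
      _ ≤ (((k * m : ℕ) : ℝ) / n) ^ W.card * n.choose (k * m) := card_filter_superset_le W hn0 _
      _ ≤ _ := by
          push_cast
          gcongr
  · rw [Finset.filter_false_of_mem, Finset.card_empty, Nat.cast_zero]
    · positivity
    · intro A hA hc
      simp only [Finset.mem_filter, Finset.mem_univ, true_and] at hA
      rw [hc, Nat.mul_div_cancel_left _ hk] at hA
      exact hm hA.2

/-- A product bound for the total weight of the tuples with members in given families, the
total number of cycles being controlled by the parameter `u`. -/
theorem sum_prod_weight_le (F : Fin d → Finset (Finset (Fin n))) (t : ℕ) {u : ℝ} (hu : 0 < u)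
    (G : Finset (Fin d → Finset (Fin n))) (hGF : ∀ A ∈ G, ∀ i, A i ∈ F i)
    (hG : ∀ A ∈ G, u ^ t ≤ u ^ numCycles k A) :
    ∑ A ∈ G, ∏ i, weight n k (A i).card ≤
      (u ^ t)⁻¹ * ∏ i, ∑ A ∈ F i, weight n k A.card * u ^ (A.card / k) := by
  classical
  rw [Finset.prod_univ_sum, Finset.mul_sum]
  calc ∑ A ∈ G, ∏ i, weight n k (A i).card
      ≤ ∑ A ∈ G, (u ^ t)⁻¹ * ∏ i, (weight n k (A i).card * u ^ ((A i).card / k)) := by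
        refine Finset.sum_le_sum fun A hA => ?_
        rw [Finset.prod_mul_distrib, Finset.prod_pow_eq_pow_sum]
        have h1 : 0 ≤ ∏ i, weight n k (A i).card :=
          Finset.prod_nonneg fun i _ => weight_nonneg _ _ _
        have h2 := hG A hA
        rw [inv_mul_eq_div, le_div_iff₀ (by positivity)]
        exact mul_le_mul_of_nonneg_left h2 h1
    _ ≤ _ := by
        refine Finset.sum_le_sum_of_subset_of_nonneg (fun A hA => ?_) fun A _ _ => ?_
        · exact Fintype.mem_piFinset.2 (hGF A hA)
        · have : 0 ≤ ∏ i, (weight n k (A i).card * u ^ ((A i).card / k)) :=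
            Finset.prod_nonneg fun i _ => mul_nonneg (weight_nonneg _ _ _) (by positivity)
          positivity

theorem one_add_pow_le_exp {y : ℝ} (hy : 0 ≤ y) (n : ℕ) : (1 + y) ^ n ≤ Real.exp (y * n) := by
  rw [mul_comm, Real.exp_nat_mul]
  gcongr
  rw [add_comm]
  exact Real.add_one_le_exp y

theorem choose_le_inv_pow_mul_exp {y : ℝ} (hy : 0 < y) (n a : ℕ) :
    (n.choose a : ℝ) ≤ (y ^ a)⁻¹ * Real.exp (y * n) := by
  rw [inv_mul_eq_div, le_div_iff₀ (by positivity)]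
  refine le_trans ?_ (one_add_pow_le_exp hy.le n)
  rcases le_or_gt a n with ha | ha
  · rw [add_comm, add_pow, mul_comm]
    refine le_trans (le_of_eq ?_) (Finset.single_le_sum (f := fun m =>
      y ^ m * 1 ^ (n - m) * (n.choose m : ℝ)) (fun m _ => by positivity)
      (Finset.mem_range.2 (Nat.lt_succ_of_le ha)))
    simp
  · rw [Nat.choose_eq_zero_of_lt ha, Nat.cast_zero, zero_mul]
    positivity

/-- The number of sets of at most `x` elements. -/
theorem card_filter_card_le_le {y : ℝ} (hy : 0 < y) (hy1 : y ≤ 1) (n x : ℕ) :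
    (((Finset.univ : Finset (Finset (Fin n))).filter fun D => D.card ≤ x).card : ℝ) ≤
      (y ^ x)⁻¹ * Real.exp (y * n) := by
  rw [inv_mul_eq_div, le_div_iff₀ (by positivity)]
  refine le_trans ?_ (one_add_pow_le_exp hy.le n)
  have h := Finset.sum_powerset_apply_card (fun a => y ^ a) (x := (Finset.univ : Finset (Fin n)))
  have h2 : (1 + y) ^ n = ∑ D : Finset (Fin n), y ^ D.card := by
    rw [← Finset.powerset_univ, h, add_comm, add_pow]
    simp [mul_comm]
  rw [h2, ← nsmul_eq_mul, ← Finset.sum_const]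
  refine le_trans (Finset.sum_le_sum (g := fun D : Finset (Fin n) => y ^ D.card) fun D hD => ?_)
    (Finset.sum_le_sum_of_subset_of_nonneg (Finset.filter_subset _ _) fun _ _ _ => by positivity)
  exact pow_le_pow_of_le_one hy.le hy1 (Finset.mem_filter.1 hD).2

end Sums

/-! ### Expansion of small families of cycles -/

section Expansion

variable {d k n N : ℕ}

theorem numCycles_mul_le (hdk : d ≤ k) (hn : n = k * N) {y : ℝ} (hy : 0 ≤ y) :
    ((1 + y) ^ N) ^ d ≤ Real.exp (y * n) := by
  rw [← pow_mul]
  refine (one_add_pow_le_exp hy _).trans (Real.exp_le_exp.2 ?_)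
  have : N * d ≤ n := by rw [hn, mul_comm]; exact Nat.mul_le_mul_right N hdk
  gcongr

/-- With high probability few cycles cannot cover too small a set of points. The bound is stated
in terms of the fourth root `q` of `m / n`. -/
theorem unifProb_small_union_le (hk : 4 ≤ k) (hdk : d ≤ k) (hn : n = k * N) {m : ℕ} {q : ℝ}
    (hm : 0 < m) (hq : 0 < q) (hq1 : q ≤ 1) (hqm : q ^ 4 * n = m) :
    unifProb {σ : UnifHom d k (Fin n) | ∃ A, InvTuple σ.1 A ∧ numCycles k A = m ∧
      2 * (Finset.univ.biUnion A).card ≤ (k + 1) * m} ≤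
      (Real.exp 2 * k ^ k * q) ^ m := by
  have : NeZero k := ⟨by omega⟩
  set z := (k + 1) * m / 2 with hz
  set y := q ^ 4 with hy
  have hy0 : 0 < y := by positivity
  have hy1 : y ≤ 1 := pow_le_one₀ hq.le hq1
  have hn0 : 0 < n := by
    rcases Nat.eq_zero_or_pos n with h | h
    · rw [h, Nat.cast_zero, mul_zero] at hqm
      exact absurd (Nat.cast_eq_zero.1 hqm.symm) hm.ne'
    · exact h
  have hn' : (0 : ℝ) < n := by exact_mod_cast hn0
  have hz0 : 0 < z := by
    have : 5 * 1 ≤ (k + 1) * m := Nat.mul_le_mul (by omega) hm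
    omega
  have hz2 : 2 * z ≤ (k + 1) * m := by omega
  have hzk : (z : ℝ) / n ≤ k * y := by
    rw [div_le_iff₀ hn', mul_assoc, hqm]
    have : z ≤ k * m := by
      have : 2 * 1 * m ≤ 2 * k * m := Nat.mul_le_mul_right m (by omega)
      nlinarith
    exact_mod_cast this
  have hρ : 0 < (z : ℝ) / n := by positivity
  -- with this parameter the sum over the subsets of a set of `z` points is at most `(1 + y) ^ N`
  set u := y / ((z : ℝ) / n) ^ k with hu
  have hu0 : 0 < u := by positivity
  -- the union bound runs over all sets `Z` of at most `z` points and all tuples inside `Z`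
  let F : Finset (Σ _ : Finset (Fin n), Fin d → Finset (Fin n)) :=
    (Finset.univ.filter fun Z => Z.card ≤ z).sigma fun Z =>
      (Fintype.piFinset fun _ => Z.powerset).filter fun A => numCycles k A = m
  refine (unifProb_mono ?_).trans
    ((unifProb_exists_le (d := d) ⟨N, hn⟩ F fun x => x.2).trans ?_)
  · rintro σ ⟨A, hA, hAm, hAz⟩
    refine ⟨⟨Finset.univ.biUnion A, A⟩, ?_, hA⟩
    simp only [F, Finset.mem_sigma, Finset.mem_filter, Finset.mem_univ, true_and,
      Fintype.mem_piFinset, Finset.mem_powerset]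
    exact ⟨by omega, fun i => Finset.subset_biUnion_of_mem A (Finset.mem_univ i), hAm⟩
  · rw [Finset.sum_sigma]
    have key : ∀ Z ∈ Finset.univ.filter fun Z : Finset (Fin n) => Z.card ≤ z,
        ∑ A ∈ (Fintype.piFinset fun _ => Z.powerset).filter fun A => numCycles k A = m,
          ∏ i : Fin d, weight n k (A i).card ≤ (u ^ m)⁻¹ * Real.exp m := by
      intro Z hZ
      refine (sum_prod_weight_le (k := k) (fun _ => Z.powerset) m hu0 _ ?_ ?_).trans ?_
      · intro A hA i
        exact Fintype.mem_piFinset.1 (Finset.mem_filter.1 hA).1 i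
      · intro A hA
        rw [(Finset.mem_filter.1 hA).2]
      · gcongr
        rw [Finset.prod_const, Finset.card_univ, Fintype.card_fin]
        refine le_trans ?_ ((numCycles_mul_le hdk hn hy0.le).trans (by rw [hqm]))
        have hZ' : (Z.card : ℝ) ≤ z := by exact_mod_cast (Finset.mem_filter.1 hZ).2
        have h0 : 0 ≤ ∑ A ∈ Z.powerset, weight n k A.card * u ^ (A.card / k) :=
          Finset.sum_nonneg fun A _ => mul_nonneg (weight_nonneg _ _ _) (by positivity)
        refine pow_le_pow_left₀ h0 ?_ d
        refine (sum_weight_subset_le (by omega) hn hn0 Z hu0.le).trans ?_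
        refine pow_le_pow_left₀ (by positivity) ?_ N
        have : ((Z.card : ℝ) / n) ^ k ≤ ((z : ℝ) / n) ^ k := by gcongr
        calc 1 + u * ((Z.card : ℝ) / n) ^ k ≤ 1 + u * ((z : ℝ) / n) ^ k := by gcongr
          _ = 1 + y := by rw [hu, div_mul_cancel₀]; positivity
    refine (Finset.sum_le_sum key).trans ?_
    rw [Finset.sum_const, nsmul_eq_mul]
    have hcard := card_filter_card_le_le hy0 hy1 n z
    rw [hqm] at hcard
    calc _ ≤ ((y ^ z)⁻¹ * Real.exp m) * ((u ^ m)⁻¹ * Real.exp m) := by gcongr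
      _ = Real.exp 2 ^ m * ((((z : ℝ) / n) ^ (k * m)) * ((y ^ z)⁻¹ * (y ^ m)⁻¹)) := by
          have : Real.exp 2 ^ m = Real.exp m * Real.exp m := by
            rw [← Real.exp_nat_mul, ← Real.exp_add]; ring_nf
          rw [this, hu, div_pow, ← pow_mul, inv_div]
          ring
      _ ≤ Real.exp 2 ^ m * ((k ^ k * q) ^ m) := by
          gcongr
          rw [← mul_inv, ← div_eq_mul_inv, div_le_iff₀ (by positivity)]
          calc ((z : ℝ) / n) ^ (k * m) ≤ (k * y) ^ (k * m) := by gcongr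
            _ = (k ^ k) ^ m * q ^ (4 * (k * m)) := by
                rw [mul_pow, hy, ← pow_mul, ← pow_mul]
            _ ≤ (k ^ k) ^ m * q ^ (m + 4 * z + 4 * m) := by
                refine mul_le_mul_of_nonneg_left ?_ (by positivity)
                refine pow_le_pow_of_le_one hq.le hq1 ?_
                -- `m + 4 z + 4 m ≤ (2 k + 7) m ≤ 4 k m` since `k ≥ 4`
                have : 4 * m ≤ k * m := Nat.mul_le_mul_right m hk
                have h2 : (k + 1) * m = k * m + m := by ring
                omega
            _ = _ := by rw [hy, ← pow_mul, ← pow_mul, mul_pow]; ring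
      _ = _ := by rw [← mul_pow, ← mul_assoc]

/-- With high probability a small set of points cannot be covered, in every type, by few
cycles. The bound is stated in terms of the fourth root `q` of `m / n`. -/
theorem unifProb_few_cycles_le (hd : 3 ≤ d) (hdk : d ≤ k) (hn : n = k * N) {m : ℕ} {q : ℝ}
    (hm : 0 < m) (hq : 0 < q) (hq1 : q ≤ 1) (hqm : q ^ 4 * n = m) :
    unifProb {σ : UnifHom d k (Fin n) | ∃ A, InvTuple σ.1 A ∧ ∃ W : Finset (Fin n), W.card = m ∧
      (∀ i, W ⊆ A i) ∧ 4 * numCycles k A ≤ (2 * d + 1) * m} ≤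
      (Real.exp 2 * (k * d) ^ d * q) ^ m := by
  have : NeZero k := ⟨by omega⟩
  set t := (2 * d + 1) * m / 4 with ht
  set y := q ^ 4 with hy
  have hy0 : 0 < y := by positivity
  have hy1 : y ≤ 1 := pow_le_one₀ hq.le hq1
  have hn0 : 0 < n := by
    rcases Nat.eq_zero_or_pos n with h | h
    · rw [h, Nat.cast_zero, mul_zero] at hqm
      exact absurd (Nat.cast_eq_zero.1 hqm.symm) hm.ne'
    · exact h
  have hn' : (0 : ℝ) < n := by exact_mod_cast hn0
  have ht4 : 4 * t ≤ (2 * d + 1) * m := by omega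
  have htd : (k * t : ℝ) / n ≤ k * d * y := by
    rw [div_le_iff₀ hn', mul_assoc, hqm, mul_assoc]
    have : t ≤ d * m := by nlinarith
    gcongr
    exact_mod_cast this
  let F : Finset (Σ _ : Finset (Fin n), Fin d → Finset (Fin n)) :=
    (Finset.univ.powersetCard m).sigma fun W =>
      (Fintype.piFinset fun _ => Finset.univ.filter (fun A => W ⊆ A ∧ A.card / k ≤ t)).filter
        fun A => numCycles k A ≤ t
  refine (unifProb_mono ?_).trans
    ((unifProb_exists_le (d := d) ⟨N, hn⟩ F fun x => x.2).trans ?_)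
  · rintro σ ⟨A, hA, W, hW, hWA, hAt⟩
    refine ⟨⟨W, A⟩, ?_, hA⟩
    simp only [F, Finset.mem_sigma, Finset.mem_filter, Finset.mem_univ, true_and,
      Fintype.mem_piFinset, Finset.mem_powersetCard, Finset.subset_univ]
    have : numCycles k A ≤ t := by omega
    exact ⟨hW, fun i => ⟨hWA i, (Finset.single_le_sum (f := fun i => (A i).card / k)
      (fun _ _ => Nat.zero_le _) (Finset.mem_univ i)).trans this⟩, this⟩
  · rw [Finset.sum_sigma]
    have key : ∀ W ∈ Finset.univ.powersetCard m,
        ∑ A ∈ (Fintype.piFinset fun _ => Finset.univ.filter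
            (fun A : Finset (Fin n) => W ⊆ A ∧ A.card / k ≤ t)).filter
            fun A => numCycles k A ≤ t,
          ∏ i : Fin d, weight n k (A i).card ≤
          (y ^ t)⁻¹ * ((k * d * y) ^ (m * d) * Real.exp m) := by
      intro W hW
      refine (sum_prod_weight_le (k := k) (fun _ => Finset.univ.filter
            (fun A : Finset (Fin n) => W ⊆ A ∧ A.card / k ≤ t)) t hy0 _ ?_ ?_).trans ?_
      · intro A hA i
        exact Fintype.mem_piFinset.1 (Finset.mem_filter.1 hA).1 i
      · intro A hA
        exact pow_le_pow_of_le_one hy0.le hy1 (Finset.mem_filter.1 hA).2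
      · gcongr
        rw [Finset.prod_const, Finset.card_univ, Fintype.card_fin]
        have h0 : 0 ≤ ∑ A ∈ Finset.univ.filter
            (fun A : Finset (Fin n) => W ⊆ A ∧ A.card / k ≤ t),
            weight n k A.card * y ^ (A.card / k) :=
          Finset.sum_nonneg fun A _ => mul_nonneg (weight_nonneg _ _ _) (by positivity)
        refine (pow_le_pow_left₀ h0
          (sum_weight_superset_le (by omega) hn hn0 W t hy0.le) d).trans ?_
        rw [mul_pow, ← pow_mul, (Finset.mem_powersetCard.1 hW).2]
        gcongr
        exact (numCycles_mul_le hdk hn hy0.le).trans (by rw [hqm])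
    refine (Finset.sum_le_sum key).trans ?_
    rw [Finset.sum_const, nsmul_eq_mul, Finset.card_powersetCard, Finset.card_univ,
      Fintype.card_fin]
    have hcard := choose_le_inv_pow_mul_exp hy0 n m
    rw [hqm] at hcard
    calc _ ≤ ((y ^ m)⁻¹ * Real.exp m) *
          ((y ^ t)⁻¹ * ((k * d * y) ^ (m * d) * Real.exp m)) := by gcongr
      _ = Real.exp 2 ^ m * ((k * d * y) ^ (m * d) * ((y ^ t)⁻¹ * (y ^ m)⁻¹)) := by
          have : Real.exp 2 ^ m = Real.exp m * Real.exp m := by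
            rw [← Real.exp_nat_mul, ← Real.exp_add]; ring_nf
          rw [this]
          ring
      _ ≤ Real.exp 2 ^ m * (((k * d) ^ d * q) ^ m) := by
          gcongr
          rw [← mul_inv, ← div_eq_mul_inv, div_le_iff₀ (by positivity)]
          calc (k * d * y) ^ (m * d) = (((k * d : ℝ)) ^ d) ^ m * q ^ (4 * (m * d)) := by
                rw [mul_pow, hy, ← pow_mul, ← pow_mul, mul_comm m d]
            _ ≤ ((k * d : ℝ) ^ d) ^ m * q ^ (m + 4 * t + 4 * m) := by
                refine mul_le_mul_of_nonneg_left ?_ (by positivity)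
                refine pow_le_pow_of_le_one hq.le hq1 ?_
                -- `m + 4 t + 4 m ≤ (2 d + 6) m ≤ 4 d m` since `d ≥ 3`
                nlinarith
            _ = _ := by rw [hy, ← pow_mul, ← pow_mul, mul_pow]; ring
      _ = _ := by rw [← mul_pow, ← mul_assoc]

/-- The sum of the bounds `(C (m / n)^(1/4))^m` over the small sizes `m` tends to `0`. -/
theorem exists_tendsto_sum_pow (C : ℝ) (hC : 0 ≤ C) : ∃ δ : ℝ, 0 < δ ∧ δ ≤ 1 ∧
    Tendsto (fun n : ℕ => ∑ m ∈ Finset.Icc 1 ⌊δ * n⌋₊, (C * ((m : ℝ) / n) ^ (1 / 4 : ℝ)) ^ m)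
      atTop (𝓝 0) := by
  set ε : ℝ := 1 / (2 * (C + 1)) with hε
  have hε0 : 0 < ε := by positivity
  have hε1 : ε ≤ 1 := by
    rw [hε, div_le_one (by positivity)]; linarith
  have hCε : C * ε ≤ 1 / 2 := by
    rw [hε, mul_one_div, div_le_div_iff₀ (by positivity) (by positivity)]; linarith
  refine ⟨ε ^ 4, by positivity, pow_le_one₀ hε0.le hε1, ?_⟩
  have hroot : (ε ^ 4) ^ (1 / 4 : ℝ) = ε := by
    rw [← Real.rpow_natCast, ← Real.rpow_mul hε0.le]; norm_num
  let f : ℕ → ℕ → ℝ := fun n m =>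
    if m ∈ Finset.Icc 1 ⌊ε ^ 4 * n⌋₊ then (C * ((m : ℝ) / n) ^ (1 / 4 : ℝ)) ^ m else 0
  have hf : ∀ n, ∑' m, f n m =
      ∑ m ∈ Finset.Icc 1 ⌊ε ^ 4 * n⌋₊, (C * ((m : ℝ) / n) ^ (1 / 4 : ℝ)) ^ m := by
    intro n
    rw [tsum_eq_sum (s := Finset.Icc 1 ⌊ε ^ 4 * n⌋₊)]
    · exact Finset.sum_congr rfl fun m hm => if_pos hm
    · exact fun m hm => if_neg hm
  have h := tendsto_tsum_of_dominated_convergence (𝓕 := atTop) (f := f) (g := fun _ : ℕ => (0 : ℝ))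
    (bound := fun m : ℕ => (1 / 2 : ℝ) ^ m) summable_geometric_two ?_ ?_
  · simpa [hf] using h
  · intro m
    rcases Nat.eq_zero_or_pos m with rfl | hm
    · simp [f]
    have h1 : Tendsto (fun n : ℕ => (C * ((m : ℝ) / n) ^ (1 / 4 : ℝ)) ^ m) atTop (𝓝 0) := by
      have h2 : Tendsto (fun n : ℕ => (m : ℝ) / n) atTop (𝓝 0) :=
        tendsto_const_div_atTop_nhds_zero_nat _
      have h3 := ((h2.rpow_const (p := (1 / 4 : ℝ)) (Or.inr (by norm_num))).const_mul C).pow m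
      simpa [Real.zero_rpow, hm.ne'] using h3
    refine squeeze_zero (fun n => ?_) (fun n => ?_) h1
    · simp only [f]; split_ifs <;> positivity
    · simp only [f]; split_ifs
      · exact le_rfl
      · positivity
  · refine Eventually.of_forall fun n m => ?_
    simp only [f]
    split_ifs with hm
    · have hm1 : 1 ≤ m := (Finset.mem_Icc.1 hm).1
      have hm2 : (m : ℝ) ≤ ε ^ 4 * n :=
        (Nat.le_floor_iff (by positivity)).1 (Finset.mem_Icc.1 hm).2
      have hn : (0 : ℝ) < n := by
        by_contra hn
        have : (n : ℝ) = 0 := le_antisymm (not_lt.1 hn) (Nat.cast_nonneg _)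
        rw [this, mul_zero] at hm2
        have : (1 : ℝ) ≤ m := by exact_mod_cast hm1
        linarith
      have h4 : ((m : ℝ) / n) ^ (1 / 4 : ℝ) ≤ ε := by
        rw [← hroot]
        refine Real.rpow_le_rpow (by positivity) ?_ (by norm_num)
        rwa [div_le_iff₀ hn]
      rw [Real.norm_of_nonneg (by positivity)]
      refine pow_le_pow_left₀ (by positivity) ?_ m
      exact (mul_le_mul_of_nonneg_left h4 hC).trans hCε
    · simp

end Expansion

/-! ### Invariant tuples of intermediate size -/

section Mid

variable {d k n N : ℕ}

/-- The indicator function of `A` with values in `ℤ/2`. -/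
def chi {V : Type*} [DecidableEq V] (A : Finset V) (v : V) : ZMod 2 := if v ∈ A then 1 else 0

theorem chi_injective {V : Type*} [DecidableEq V] : Function.Injective (chi (V := V)) := by
  intro A B h
  ext v
  have := congrFun h v
  unfold chi at this
  by_cases h1 : v ∈ A <;> by_cases h2 : v ∈ B <;> simp_all

/-- The set of points that lie in an odd number of members of the tuple: the support of the sum
modulo `2` of the indicator functions. -/
def oddSet {V : Type*} [Fintype V] [DecidableEq V] (A : Fin d → Finset V) : Finset V :=
  Finset.univ.filter fun v => ∑ i, chi (A i) v ≠ 0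

theorem mem_oddSet {V : Type*} [Fintype V] [DecidableEq V] {A : Fin d → Finset V} {v : V} :
    v ∈ oddSet A ↔ ∑ i, chi (A i) v ≠ 0 := by simp [oddSet]

theorem chi_oddSet {V : Type*} [Fintype V] [DecidableEq V] (A : Fin d → Finset V) (v : V) :
    chi (oddSet A) v = ∑ i, chi (A i) v := by
  have h : ∀ a : ZMod 2, (if a ≠ 0 then 1 else 0) = a := by decide
  rw [chi]
  simp only [mem_oddSet]
  exact h _

/-- A tuple is determined by its odd set and all but one of its members. -/
theorem eq_of_oddSet_eq {V : Type*} [Fintype V] [DecidableEq V] {A B : Fin d → Finset V}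
    (h : oddSet A = oddSet B) {i : Fin d} (hi : ∀ j, j ≠ i → A j = B j) : A = B := by
  funext j
  by_cases hj : j = i
  · subst hj
    apply chi_injective
    funext v
    have h1 := chi_oddSet A v
    rw [h, chi_oddSet, ← Finset.add_sum_erase _ _ (Finset.mem_univ j),
      ← Finset.add_sum_erase _ _ (Finset.mem_univ j)] at h1
    rw [Finset.sum_congr rfl (g := fun l => chi (A l) v)
      (fun l hl => by rw [hi l (Finset.ne_of_mem_erase hl)])] at h1
    exact (add_right_cancel h1).symm
  · exact hi j hj

theorem choose_pow_le (N m k : ℕ) : N.choose m ^ k ≤ (k * N).choose (k * m) := by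
  induction k with
  | zero => simp
  | succ k ih =>
    rw [pow_succ, Nat.succ_mul, Nat.succ_mul, Nat.add_choose_eq]
    refine (Nat.mul_le_mul_right _ ih).trans ?_
    exact Finset.single_le_sum (a := (k * m, m))
      (f := fun ij : ℕ × ℕ => (k * N).choose ij.1 * N.choose ij.2) (fun _ _ => Nat.zero_le _)
      (by simp)

theorem two_pow_le_choose {m N : ℕ} (h : 2 * m ≤ N) : 2 ^ m ≤ N.choose m := by
  induction m generalizing N with
  | zero => simp
  | succ m ih =>
    obtain ⟨N, rfl⟩ : ∃ M, N = M + 1 := ⟨N - 1, by omega⟩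
    have h1 := ih (N := N) (by omega)
    have h2 := Nat.add_one_mul_choose_eq N m
    have h3 : 2 * N.choose m * (m + 1) ≤ (N + 1).choose (m + 1) * (m + 1) := by
      rw [← h2]
      nlinarith [Nat.zero_le (N.choose m)]
    have h4 := Nat.le_of_mul_le_mul_right h3 (Nat.succ_pos m)
    rw [pow_succ]
    omega

theorem two_pow_min_le_choose {m N : ℕ} (h : m ≤ N) : 2 ^ min m (N - m) ≤ N.choose m := by
  rcases le_total m (N - m) with h1 | h1
  · rw [min_eq_left h1]
    exact two_pow_le_choose (by omega)
  · rw [min_eq_right h1, ← Nat.choose_symm h]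
    exact two_pow_le_choose (by omega)

/-- The total weight of the tuples with given member sizes and given odd set. The member for
which the number `C(N, s i)` of choices is largest is determined by the others; leaving it out is
what makes `d < k` sufficient. -/
theorem sum_prod_weight_oddSet_le (hdk : d < k) (hn : n = k * N) (D : Finset (Fin n))
    (s : Fin d → ℕ) (hs : ∀ i, s i ≤ N) {K : ℝ} (hK : 0 < K) (hKs : ∃ i, K ≤ N.choose (s i))
    (G : Finset (Fin d → Finset (Fin n)))
    (hG : ∀ A ∈ G, oddSet A = D ∧ ∀ i, (A i).card = k * s i) :
    (G.card : ℝ) * ∏ i, ((N.choose (s i) : ℝ) / n.choose (k * s i)) ≤ K⁻¹ := by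
  obtain ⟨i₁, hi₁⟩ := hKs
  have hne : (Finset.univ : Finset (Fin d)).Nonempty := ⟨i₁, Finset.mem_univ _⟩
  -- the member with the largest weight in the numerator is recovered from the others
  obtain ⟨i₀, -, hi₀⟩ := Finset.exists_max_image _ (fun i => N.choose (s i)) hne
  have hM : K ≤ N.choose (s i₀) := hi₁.trans (by exact_mod_cast hi₀ i₁ (Finset.mem_univ _))
  have hcard : G.card ≤ ∏ j ∈ Finset.univ.erase i₀, n.choose (k * s j) := by
    calc G.card ≤ (Fintype.piFinset fun j =>
          if j = i₀ then {∅} else Finset.univ.powersetCard (k * s j)).card := by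
          refine Finset.card_le_card_of_injOn (fun A => Function.update A i₀ ∅) ?_ ?_
          · intro A hA
            rw [Finset.mem_coe, Fintype.mem_piFinset]
            intro j
            by_cases hj : j = i₀
            · subst hj; simp
            · simp [hj, (hG A hA).2 j]
          · intro A hA B hB hAB
            refine eq_of_oddSet_eq ((hG A hA).1.trans (hG B hB).1.symm) (i := i₀) fun j hj => ?_
            have := congrFun hAB j
            simpa [hj] using this
      _ = _ := by
          rw [Fintype.card_piFinset, ← Finset.mul_prod_erase _ _ (Finset.mem_univ i₀)]
          simp only [if_true, Finset.card_singleton, one_mul]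
          refine Finset.prod_congr rfl fun j hj => ?_
          rw [if_neg (Finset.ne_of_mem_erase hj), Finset.card_powersetCard, Finset.card_univ,
            Fintype.card_fin]
  set M : ℝ := ((N.choose (s i₀) : ℕ) : ℝ) with hMdef
  have hM0 : 0 < M := hK.trans_le hM
  have hM1 : 1 ≤ M := by
    have : 0 < N.choose (s i₀) := Nat.choose_pos (hs i₀)
    rw [hMdef]
    exact_mod_cast this
  have hpos : ∀ j, (0 : ℝ) < n.choose (k * s j) := fun j => by
    rw [hn]
    exact_mod_cast Nat.choose_pos (Nat.mul_le_mul_left k (hs j))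
  rw [← Finset.mul_prod_erase _ _ (Finset.mem_univ i₀)]
  calc (G.card : ℝ) * ((N.choose (s i₀) : ℝ) / n.choose (k * s i₀) *
        ∏ j ∈ Finset.univ.erase i₀, ((N.choose (s j) : ℝ) / n.choose (k * s j)))
      ≤ (∏ j ∈ Finset.univ.erase i₀, (n.choose (k * s j) : ℝ)) *
        ((N.choose (s i₀) : ℝ) / n.choose (k * s i₀) *
        ∏ j ∈ Finset.univ.erase i₀, ((N.choose (s j) : ℝ) / n.choose (k * s j))) := by
        gcongr
        exact_mod_cast hcard
    _ = M / n.choose (k * s i₀) * ∏ j ∈ Finset.univ.erase i₀, (N.choose (s j) : ℝ) := by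
        rw [mul_left_comm, ← Finset.prod_mul_distrib]
        congr 1
        refine Finset.prod_congr rfl fun j _ => ?_
        rw [mul_div_cancel₀]
        exact (hpos j).ne'
    _ ≤ M / M ^ k * ∏ j ∈ Finset.univ.erase i₀, M := by
        gcongr with j hj
        · rw [hn, hMdef]; exact_mod_cast choose_pow_le N (s i₀) k
        · rw [hMdef]; exact_mod_cast hi₀ j (Finset.mem_univ _)
    _ = M ^ d / M ^ k := by
        rw [Finset.prod_const, Finset.card_erase_of_mem (Finset.mem_univ _), Finset.card_univ,
          Fintype.card_fin, div_mul_eq_mul_div, mul_pow_sub_one]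
        rintro rfl
        exact i₀.elim0
    _ ≤ M⁻¹ := by
        rw [div_le_iff₀ (by positivity), inv_mul_eq_div, le_div_iff₀ hM0, ← pow_succ]
        exact pow_le_pow_right₀ hM1 hdk
    _ ≤ K⁻¹ := by gcongr

/-- The expected number of invariant tuples with given odd set, one of whose members has
intermediate size. -/
theorem sum_weight_oddSet_le (hdk : d < k) (hn : n = k * N) (D : Finset (Fin n)) {K : ℝ}
    (hK : 0 < K) (G : Finset (Fin d → Finset (Fin n)))
    (hG : ∀ A ∈ G, oddSet A = D ∧ ∃ i, K ≤ N.choose ((A i).card / k)) :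
    ∑ A ∈ G, ∏ i, weight n k (A i).card ≤ ((N : ℝ) + 1) ^ d * K⁻¹ := by
  have hk : 0 < k := by omega
  let S : Finset (Fin d → ℕ) := Fintype.piFinset fun _ => Finset.range (N + 1)
  have hS : (S.card : ℝ) = ((N : ℝ) + 1) ^ d := by
    simp [S, Fintype.card_piFinset]
  calc ∑ A ∈ G, ∏ i, weight n k (A i).card
      ≤ ∑ A ∈ G, ∑ s ∈ S, if ∀ i, (A i).card = k * s i then
          ∏ i, ((N.choose (s i) : ℝ) / n.choose (k * s i)) else 0 := by
        refine Finset.sum_le_sum fun A _ => ?_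
        have hnonneg : ∀ s ∈ S, 0 ≤ if ∀ i, (A i).card = k * s i then
            ∏ i, ((N.choose (s i) : ℝ) / n.choose (k * s i)) else 0 := by
          intro s _
          split_ifs <;> positivity
        by_cases hA : ∀ i, k ∣ (A i).card
        · choose s hs using hA
          have hsS : s ∈ S := by
            refine Fintype.mem_piFinset.2 fun i => Finset.mem_range.2 ?_
            have h1 := Finset.card_le_univ (A i)
            rw [Fintype.card_fin, hs, hn] at h1
            have := Nat.le_of_mul_le_mul_left h1 hk
            omega
          refine le_trans (le_of_eq ?_) (Finset.single_le_sum hnonneg hsS)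
          rw [if_pos hs]
          refine Finset.prod_congr rfl fun i _ => ?_
          rw [weight, if_pos ⟨s i, hs i⟩, hs i, Nat.mul_div_cancel_left _ hk]
          conv_lhs => rw [show n / k = N by rw [hn, Nat.mul_div_cancel_left _ hk]]
        · push Not at hA
          obtain ⟨i, hi⟩ := hA
          rw [Finset.prod_eq_zero (Finset.mem_univ i) (by rw [weight, if_neg hi])]
          exact Finset.sum_nonneg hnonneg
    _ = ∑ s ∈ S, ((G.filter fun A => ∀ i, (A i).card = k * s i).card : ℝ) *
          ∏ i, ((N.choose (s i) : ℝ) / n.choose (k * s i)) := by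
        rw [Finset.sum_comm]
        refine Finset.sum_congr rfl fun s _ => ?_
        rw [← Finset.sum_filter, Finset.sum_const, nsmul_eq_mul]
    _ ≤ ∑ s ∈ S, K⁻¹ := by
        refine Finset.sum_le_sum fun s hs => ?_
        rcases Finset.eq_empty_or_nonempty (G.filter fun A => ∀ i, (A i).card = k * s i)
          with h | ⟨A, hA⟩
        · rw [h, Finset.card_empty, Nat.cast_zero, zero_mul]
          positivity
        · refine sum_prod_weight_oddSet_le hdk hn D s (fun i => ?_) hK ?_ _ ?_
          · have := Finset.mem_range.1 (Fintype.mem_piFinset.1 hs i)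
            omega
          · obtain ⟨hA1, hA2⟩ := Finset.mem_filter.1 hA
            obtain ⟨i, hi⟩ := (hG A hA1).2
            rw [hA2 i, Nat.mul_div_cancel_left _ hk] at hi
            exact ⟨i, hi⟩
          · intro B hB
            obtain ⟨hB1, hB2⟩ := Finset.mem_filter.1 hB
            exact ⟨(hG B hB1).1, hB2⟩
    _ = _ := by rw [Finset.sum_const, nsmul_eq_mul, hS]

/-- With high probability, an invariant tuple with a small odd set has no member of intermediate
size. -/
theorem exists_unifProb_mid_le (hdk : d < k) {η' : ℝ} (hη' : 0 < η') (hη1 : η' ≤ 1) :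
    ∃ η c : ℝ, 0 < η ∧ η < 1 / 2 ∧ 0 < c ∧ ∀ n : ℕ, 0 < n → k ∣ n →
      unifProb {σ : UnifHom d k (Fin n) | ∃ A, InvTuple σ.1 A ∧ (oddSet A).card ≤ η * n ∧
        ∃ i, η' * n < (A i).card ∧ (A i).card < (1 - η') * n} ≤
      ((n : ℝ) + 1) ^ d * Real.exp (-(c * n)) := by
  have hk : 0 < k := by omega
  have : NeZero k := ⟨by omega⟩
  have hk' : (1 : ℝ) ≤ k := by exact_mod_cast hk
  -- a member of intermediate size has at least `exp (c n)` competitors, and `y`, `η` are chosen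
  -- such that the number of odd sets of at most `η n` points is at most `exp (c n / 2)`
  set c : ℝ := Real.log 2 * η' / k with hc
  have hlog : 0 < Real.log 2 := Real.log_pos (by norm_num)
  have hc0 : 0 < c := by positivity
  have hc1 : c ≤ 1 := by
    rw [hc, div_le_one (by positivity)]
    have : Real.log 2 ≤ 1 := by
      have := Real.log_two_lt_d9
      linarith
    nlinarith
  set y : ℝ := c / 4 with hy
  have hy0 : 0 < y := by positivity
  have hy1 : y ≤ 1 := by linarith
  set b : ℝ := - Real.log y with hb
  have hb0 : 0 ≤ b := by
    have := Real.log_nonpos hy0.le hy1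
    linarith
  refine ⟨min (1 / 4) (c / (4 * (b + 1))), c / 2, by positivity,
    (min_le_left _ _).trans_lt (by norm_num), by positivity, ?_⟩
  rintro n hn0 ⟨N, hn⟩
  set η := min (1 / 4) (c / (4 * (b + 1))) with hη
  have hηb : η * b ≤ c / 4 := by
    calc η * b ≤ c / (4 * (b + 1)) * b := by gcongr; exact min_le_right _ _
      _ ≤ c / 4 := by
        rw [div_mul_eq_mul_div, div_le_div_iff₀ (by positivity) (by positivity)]
        nlinarith
  have hn' : (0 : ℝ) < n := by exact_mod_cast hn0
  have hnk : (n : ℝ) = k * N := by exact_mod_cast hn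
  set K : ℝ := Real.exp (c * n) with hK
  classical
  let F : Finset (Σ _ : Finset (Fin n), Fin d → Finset (Fin n)) :=
    (Finset.univ.filter fun D => D.card ≤ ⌊η * n⌋₊).sigma fun D =>
      Finset.univ.filter fun A => oddSet A = D ∧ ∃ i, K ≤ N.choose ((A i).card / k)
  refine (unifProb_mono ?_).trans
    ((unifProb_exists_le (d := d) ⟨N, hn⟩ F fun x => x.2).trans ?_)
  · rintro σ ⟨A, hA, hAD, i, hi1, hi2⟩
    refine ⟨⟨oddSet A, A⟩, ?_, hA⟩
    simp only [F, Finset.mem_sigma, Finset.mem_filter, Finset.mem_univ, true_and]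
    refine ⟨Nat.le_floor hAD, i, ?_⟩
    obtain ⟨m, hm⟩ := (hA i).dvd_card hk (σ.2 i)
    rw [hm, Nat.mul_div_cancel_left _ hk]
    rw [hm, hnk] at hi1 hi2
    push_cast at hi1 hi2
    have hkpos : (0 : ℝ) < k := by positivity
    have h1 : η' * N < m := by nlinarith
    have h2 : η' * N < (N : ℝ) - m := by nlinarith
    have hmN : m ≤ N := by
      have : (m : ℝ) ≤ N := by
        have : 0 ≤ η' * N := by positivity
        linarith
      exact_mod_cast this
    refine le_trans ?_ (Nat.cast_le.2 (two_pow_min_le_choose hmN))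
    rw [Nat.cast_pow, Nat.cast_ofNat, ← Real.exp_log (show (0 : ℝ) < 2 by norm_num),
      ← Real.exp_nat_mul]
    refine Real.exp_le_exp.2 ?_
    have h3 : η' * N ≤ ((min m (N - m) : ℕ) : ℝ) := by
      rw [Nat.cast_min, Nat.cast_sub hmN]
      exact le_min h1.le h2.le
    calc c * n = (η' * N) * Real.log 2 := by rw [hc, hnk]; field_simp
      _ ≤ _ := by gcongr
  · rw [Finset.sum_sigma]
    have key : ∀ D ∈ Finset.univ.filter fun D : Finset (Fin n) => D.card ≤ ⌊η * n⌋₊,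
        ∑ A ∈ Finset.univ.filter fun A : Fin d → Finset (Fin n) =>
          oddSet A = D ∧ ∃ i, K ≤ N.choose ((A i).card / k),
          ∏ i, weight n k (A i).card ≤ ((N : ℝ) + 1) ^ d * K⁻¹ := fun D _ =>
      sum_weight_oddSet_le hdk hn D (Real.exp_pos _) _ fun A hA => (Finset.mem_filter.1 hA).2
    refine (Finset.sum_le_sum key).trans ?_
    rw [Finset.sum_const, nsmul_eq_mul]
    have hcard := card_filter_card_le_le hy0 hy1 n ⌊η * n⌋₊
    have hpow : (y ^ ⌊η * n⌋₊)⁻¹ ≤ Real.exp (c / 4 * n) := by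
      rw [← Real.exp_log hy0, ← Real.exp_nat_mul, ← Real.exp_neg]
      refine Real.exp_le_exp.2 ?_
      have h1 : (⌊η * n⌋₊ : ℝ) ≤ η * n := Nat.floor_le (by positivity)
      calc -((⌊η * n⌋₊ : ℝ) * Real.log y) = ⌊η * n⌋₊ * b := by rw [hb]; ring
        _ ≤ η * n * b := by gcongr
        _ = η * b * n := by ring
        _ ≤ _ := by gcongr
    have hNn : (N : ℝ) ≤ n := by rw [hnk]; nlinarith [Nat.cast_nonneg (α := ℝ) N]
    calc _ ≤ (Real.exp (c / 4 * n) * Real.exp (y * n)) * (((n : ℝ) + 1) ^ d * K⁻¹) := by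
          gcongr
          exact hcard.trans (by gcongr)
      _ = ((n : ℝ) + 1) ^ d * (Real.exp (c / 4 * n) * Real.exp (y * n) * K⁻¹) := by ring
      _ = _ := by
          rw [hK, ← Real.exp_neg, ← Real.exp_add, ← Real.exp_add, hy]
          ring_nf

end Mid

/-! ### Short cycles -/

section ShortCycles

variable {d k n N : ℕ}

/-- The triples `(W, Ws, A)` such that `A` covers each point of the set `W`, of at most `L`
elements, by members of at least two types (on average), as recorded by `Ws`, and `A` has at most
as many cycles as `W` has points. -/
def shortFam (d k n L : ℕ) :
    Finset (Σ _ : (Σ _ : Finset (Fin n), Fin d → Finset (Fin n)), Fin d → Finset (Fin n)) :=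
  ((Finset.univ.filter fun W => W.card ≤ L ∧ 0 < W.card).sigma fun W =>
    (Fintype.piFinset fun _ => W.powerset).filter fun Ws => 2 * W.card ≤ ∑ i, (Ws i).card).sigma
    fun x => (Fintype.piFinset fun i => Finset.univ.filter
      fun A => x.2 i ⊆ A ∧ A.card / k ≤ x.1.card).filter fun A => numCycles k A ≤ x.1.card

/-- The expected number of short cyclic configurations is bounded independently of `n`. -/
theorem sum_shortFam_le (hdk : d ≤ k) (hk : 0 < k) (hn : n = k * N) (hn0 : 0 < n) (L : ℕ) :
    ∑ x ∈ shortFam d k n L, ∏ i, weight n k (x.2 i).card ≤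
      Real.exp 2 * (2 * (k * L)) ^ (d * L) := by
  have hn' : (0 : ℝ) < n := by exact_mod_cast hn0
  set u : ℝ := (n : ℝ)⁻¹ with hu
  have hu0 : 0 < u := by positivity
  have hu1 : u ≤ 1 := inv_le_one_of_one_le₀ (by exact_mod_cast hn0)
  have hun : u * n = 1 := inv_mul_cancel₀ hn'.ne'
  unfold shortFam
  rw [Finset.sum_sigma, Finset.sum_sigma]
  have key : ∀ W ∈ Finset.univ.filter fun W : Finset (Fin n) => W.card ≤ L ∧ 0 < W.card,
      ∀ Ws ∈ (Fintype.piFinset fun _ => W.powerset).filter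
        fun Ws : Fin d → Finset (Fin n) => 2 * W.card ≤ ∑ i, (Ws i).card,
      ∑ A ∈ (Fintype.piFinset fun i => Finset.univ.filter
        fun A : Finset (Fin n) => Ws i ⊆ A ∧ A.card / k ≤ W.card).filter
          fun A => numCycles k A ≤ W.card, ∏ i, weight n k (A i).card ≤
        ((k * L) ^ (d * L) * Real.exp 1) * u ^ W.card := by
    intro W hW Ws hWs
    obtain ⟨hWL, hW0⟩ := (Finset.mem_filter.1 hW).2
    obtain ⟨hWs1, hWs2⟩ := Finset.mem_filter.1 hWs
    refine (sum_prod_weight_le (k := k) (fun i => Finset.univ.filter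
        fun A : Finset (Fin n) => Ws i ⊆ A ∧ A.card / k ≤ W.card) W.card hu0 _ ?_ ?_).trans ?_
    · intro A hA i
      exact Fintype.mem_piFinset.1 (Finset.mem_filter.1 hA).1 i
    · intro A hA
      exact pow_le_pow_of_le_one hu0.le hu1 (Finset.mem_filter.1 hA).2
    have h1 : ∏ i, ∑ A ∈ Finset.univ.filter
        fun A : Finset (Fin n) => Ws i ⊆ A ∧ A.card / k ≤ W.card,
          weight n k A.card * u ^ (A.card / k) ≤
        ∏ i : Fin d, (((k * W.card : ℝ) * u) ^ (Ws i).card * (1 + u) ^ N) := by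
      refine Finset.prod_le_prod (fun i _ => Finset.sum_nonneg fun A _ =>
        mul_nonneg (weight_nonneg _ _ _) (by positivity)) fun i _ => ?_
      exact sum_weight_superset_le hk hn hn0 (Ws i) W.card hu0.le
    have h2 : ∏ i : Fin d, (((k * W.card : ℝ) * u) ^ (Ws i).card * (1 + u) ^ N) ≤
        ((k * L) ^ (d * L) * u ^ (2 * W.card)) * Real.exp 1 := by
      rw [Finset.prod_mul_distrib, Finset.prod_const, Finset.card_univ, Fintype.card_fin,
        Finset.prod_pow_eq_pow_sum, mul_pow]
      have h3 : ∑ i, (Ws i).card ≤ d * L := by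
        calc ∑ i, (Ws i).card ≤ ∑ _i : Fin d, L := Finset.sum_le_sum fun i _ =>
              (Finset.card_le_card (Finset.mem_powerset.1 (Fintype.mem_piFinset.1 hWs1 i))).trans
                hWL
          _ = _ := by simp
      have h4 : (1 : ℝ) ≤ k * W.card := by exact_mod_cast Nat.mul_pos hk hW0
      have hkL : (k * W.card : ℝ) ≤ k * L := by gcongr
      refine mul_le_mul (mul_le_mul ?_ ?_ (by positivity) (by positivity)) ?_ (by positivity)
        (by positivity)
      · calc (k * W.card : ℝ) ^ (∑ i, (Ws i).card) ≤ (k * W.card : ℝ) ^ (d * L) :=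
              pow_le_pow_right₀ h4 h3
          _ ≤ _ := by gcongr
      · exact pow_le_pow_of_le_one hu0.le hu1 hWs2
      · exact (numCycles_mul_le hdk hn hu0.le).trans (by rw [hun])
    calc _ ≤ (u ^ W.card)⁻¹ * (((k * L) ^ (d * L) * u ^ (2 * W.card)) * Real.exp 1) := by
          gcongr
          exact h1.trans h2
      _ = _ := by
          rw [two_mul, pow_add]
          field_simp
  calc _ ≤ ∑ W ∈ Finset.univ.filter fun W : Finset (Fin n) => W.card ≤ L ∧ 0 < W.card,
        ∑ Ws ∈ (Fintype.piFinset fun _ => W.powerset).filter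
        fun Ws : Fin d → Finset (Fin n) => 2 * W.card ≤ ∑ i, (Ws i).card,
        ((k * L) ^ (d * L) * Real.exp 1) * u ^ W.card :=
        Finset.sum_le_sum fun W hW => Finset.sum_le_sum fun Ws hWs => key W hW Ws hWs
    _ ≤ ∑ W ∈ Finset.univ.filter fun W : Finset (Fin n) => W.card ≤ L ∧ 0 < W.card,
        2 ^ (d * L) * (((k * L) ^ (d * L) * Real.exp 1) * u ^ W.card) := by
        refine Finset.sum_le_sum fun W hW => ?_
        rw [Finset.sum_const, nsmul_eq_mul]
        gcongr
        have h5 : ((Fintype.piFinset fun _ : Fin d => W.powerset).filter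
            fun Ws : Fin d → Finset (Fin n) => 2 * W.card ≤ ∑ i, (Ws i).card).card ≤
            2 ^ (d * L) := by
          refine (Finset.card_filter_le _ _).trans ?_
          rw [Fintype.card_piFinset, Finset.prod_const, Finset.card_univ, Fintype.card_fin,
            Finset.card_powerset, ← pow_mul]
          refine Nat.pow_le_pow_right (by norm_num) ?_
          rw [mul_comm]
          exact Nat.mul_le_mul_left d (Finset.mem_filter.1 hW).2.1
        exact_mod_cast h5
    _ ≤ ∑ W : Finset (Fin n), 2 ^ (d * L) * (((k * L) ^ (d * L) * Real.exp 1) * u ^ W.card) :=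
        Finset.sum_le_sum_of_subset_of_nonneg (Finset.filter_subset _ _)
          fun _ _ _ => by positivity
    _ = 2 ^ (d * L) * ((k * L) ^ (d * L) * Real.exp 1) * (1 + u) ^ n := by
        have h := Finset.sum_powerset_apply_card (fun a => u ^ a)
          (x := (Finset.univ : Finset (Fin n)))
        rw [Finset.powerset_univ] at h
        rw [← Finset.mul_sum, ← Finset.mul_sum, h, add_comm 1, add_pow]
        simp [mul_comm, mul_assoc]
    _ ≤ 2 ^ (d * L) * ((k * L) ^ (d * L) * Real.exp 1) * Real.exp 1 := by
        gcongr
        exact (one_add_pow_le_exp hu0.le n).trans (by rw [hun])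
    _ = _ := by
        rw [mul_pow, show (2 : ℝ) = 1 + 1 by norm_num, Real.exp_add]
        ring

end ShortCycles

/-! ### Typical homomorphisms -/

section Typical

variable {d k n : ℕ}

/-- The bound on the expected number of short cyclic configurations of size at most `L`. -/
noncomputable def shortBound (d k L : ℕ) : ℝ := Real.exp 2 * (2 * (k * L)) ^ (d * L)

open Classical in
/-- The pseudorandomness properties of a uniform homomorphism that the theorem rests on. -/
structure IsTypical (δ η η' : ℝ) (σ : UnifHom d k (Fin n)) : Prop where
  /-- Invariant tuples with a small odd set have only very small or very large members. -/
  mid : ∀ A, InvTuple σ.1 A → (oddSet A).card ≤ η * n →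
    ∀ i, (A i).card ≤ η' * n ∨ (1 - η') * n ≤ (A i).card
  /-- Few cycles cover many points. -/
  union : ∀ A, InvTuple σ.1 A → 0 < numCycles k A → numCycles k A ≤ δ * n →
    (k + 1) * numCycles k A < 2 * (Finset.univ.biUnion A).card
  /-- A small set of points meets many cycles. -/
  cover : ∀ A, InvTuple σ.1 A → ∀ W : Finset (Fin n), 0 < W.card → W.card ≤ δ * n →
    (∀ i, W ⊆ A i) → (2 * d + 1) * W.card < 4 * numCycles k A
  /-- There are few short cyclic configurations. -/
  short : ∀ L ≤ n, ((shortFam d k n L).filter fun x => InvTuple σ.1 x.2).card <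
    2 ^ L * shortBound d k L * √n

theorem unifProb_biUnion_le [NeZero k] {ι : Type*} (s : Finset ι)
    (S : ι → Set (UnifHom d k (Fin n))) :
    unifProb (⋃ i ∈ s, S i) ≤ ∑ i ∈ s, unifProb (S i) := by
  classical
  induction s using Finset.induction_on with
  | empty => simp [unifProb]
  | insert a s ha ih =>
    rw [Finset.set_biUnion_insert, Finset.sum_insert ha]
    exact (unifProb_union_le _ _).trans (by gcongr)

theorem tendsto_size (hk : 0 < k) : Tendsto (fun n : Size k => n.1) atTop atTop := by
  refine tendsto_atTop.2 fun b => ?_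
  filter_upwards [eventually_ge_atTop
    (⟨k * (b + 1), by positivity, dvd_mul_right _ _⟩ : Size k)] with n hn
  have h1 : k * (b + 1) ≤ n.1 := hn
  have h2 : 1 * (b + 1) ≤ k * (b + 1) := Nat.mul_le_mul_right _ hk
  omega

theorem quarter_root_spec {m n : ℕ} (hm : 0 < m) (hmn : m ≤ n) :
    0 < ((m : ℝ) / n) ^ (1 / 4 : ℝ) ∧ ((m : ℝ) / n) ^ (1 / 4 : ℝ) ≤ 1 ∧
      (((m : ℝ) / n) ^ (1 / 4 : ℝ)) ^ 4 * n = m := by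
  have hn' : (0 : ℝ) < n := by exact_mod_cast hm.trans_le hmn
  have hm' : (0 : ℝ) < m := by exact_mod_cast hm
  refine ⟨by positivity, Real.rpow_le_one (by positivity) ?_ (by norm_num), ?_⟩
  · rw [div_le_one hn']; exact_mod_cast hmn
  · rw [← Real.rpow_natCast, ← Real.rpow_mul (by positivity)]
    norm_num
    field_simp

/-- A sequence of random uniform homomorphisms is typical with probability tending to one. -/
theorem exists_tendsto_unifProb_isTypical (hd : 3 ≤ d) (hdk : d < k) :
    ∃ δ η η' : ℝ, 0 < δ ∧ δ ≤ 1 ∧ 0 < η ∧ η < 1 / 2 ∧ 0 < η' ∧ η' ≤ δ ∧ d * η' ≤ 1 / 2 ∧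
      Tendsto (fun n : Size k => unifProb {σ : UnifHom d k (Fin n.1) | IsTypical δ η η' σ})
        atTop (𝓝 1) := by
  have : NeZero k := ⟨by omega⟩
  have hd' : (3 : ℝ) ≤ d := by exact_mod_cast hd
  set C : ℝ := Real.exp 2 * k ^ k + Real.exp 2 * (k * d) ^ d with hC
  obtain ⟨δ, hδ0, hδ1, hδ⟩ := exists_tendsto_sum_pow C (by positivity)
  set η' : ℝ := min δ (1 / (2 * d)) with hη'
  have hη'0 : 0 < η' := by positivity
  obtain ⟨η, c, hη0, hη1, hc0, hmid⟩ :=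
    exists_unifProb_mid_le hdk hη'0 ((min_le_left _ _).trans hδ1)
  refine ⟨δ, η, η', hδ0, hδ1, hη0, hη1, hη'0, min_le_left _ _, ?_, ?_⟩
  · calc d * η' ≤ d * (1 / (2 * d)) := by gcongr; exact min_le_right _ _
      _ = 1 / 2 := by field_simp
  let E : ℕ → ℝ := fun n => ((n : ℝ) + 1) ^ d * Real.exp (-(c * n)) +
    ((∑ m ∈ Finset.Icc 1 ⌊δ * n⌋₊, (C * ((m : ℝ) / n) ^ (1 / 4 : ℝ)) ^ m) +
      (∑ m ∈ Finset.Icc 1 ⌊δ * n⌋₊, (C * ((m : ℝ) / n) ^ (1 / 4 : ℝ)) ^ m) + 2 * (√n)⁻¹)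
  have hE : Tendsto E atTop (𝓝 0) := by
    have h1 : Tendsto (fun n : ℕ => ((n : ℝ) + 1) ^ d * Real.exp (-(c * n))) atTop (𝓝 0) := by
      have h2 := (Real.tendsto_pow_mul_exp_neg_atTop_nhds_zero d).comp
        ((tendsto_id.const_mul_atTop hc0).comp
          (tendsto_natCast_atTop_atTop (R := ℝ)))
      have h3 := h2.const_mul ((2 / c) ^ d)
      rw [mul_zero] at h3
      refine squeeze_zero' (Eventually.of_forall fun n => by positivity) ?_ h3
      filter_upwards [eventually_ge_atTop 1] with n hn
      simp only [Function.comp, id]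
      rw [← mul_assoc, ← mul_pow]
      gcongr
      have : (1 : ℝ) ≤ n := by exact_mod_cast hn
      calc (n : ℝ) + 1 ≤ 2 * n := by linarith
        _ = 2 / c * (c * n) := by field_simp
    have h2 : Tendsto (fun n : ℕ => 2 * (√(n : ℝ))⁻¹) atTop (𝓝 0) := by
      have := (tendsto_inv_atTop_zero.comp
        (Real.tendsto_sqrt_atTop.comp (tendsto_natCast_atTop_atTop (R := ℝ)))).const_mul 2
      simpa using this
    simpa [E] using h1.add ((hδ.add hδ).add h2)
  have hbound : ∀ n : Size k, 1 - E n.1 ≤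
      unifProb {σ : UnifHom d k (Fin n.1) | IsTypical δ η η' σ} := by
    rintro ⟨n, hn0, hkn⟩
    obtain ⟨N, hN⟩ := id hkn
    have hn' : (0 : ℝ) < n := by exact_mod_cast hn0
    have hcompl := unifProb_compl (d := d) hkn {σ : UnifHom d k (Fin n) | IsTypical δ η η' σ}
    suffices h : unifProb {σ : UnifHom d k (Fin n) | IsTypical δ η η' σ}ᶜ ≤ E n by
      rw [hcompl] at h
      simpa using sub_le_comm.1 h
    classical
    let S0 : Set (UnifHom d k (Fin n)) := {σ | ∃ A, InvTuple σ.1 A ∧ (oddSet A).card ≤ η * n ∧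
        ∃ i, η' * n < (A i).card ∧ (A i).card < (1 - η') * n}
    let S1 : ℕ → Set (UnifHom d k (Fin n)) := fun m => {σ | ∃ A, InvTuple σ.1 A ∧
      numCycles k A = m ∧ 2 * (Finset.univ.biUnion A).card ≤ (k + 1) * m}
    let S2 : ℕ → Set (UnifHom d k (Fin n)) := fun m => {σ | ∃ A, InvTuple σ.1 A ∧
      ∃ W : Finset (Fin n), W.card = m ∧ (∀ i, W ⊆ A i) ∧ 4 * numCycles k A ≤ (2 * d + 1) * m}
    let S3 : ℕ → Set (UnifHom d k (Fin n)) := fun L => {σ | 2 ^ L * shortBound d k L * √n ≤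
      ((shortFam d k n L).filter fun x => InvTuple σ.1 x.2).card}
    have hsub : {σ : UnifHom d k (Fin n) | IsTypical δ η η' σ}ᶜ ⊆
        S0 ∪ (((⋃ m ∈ Finset.Icc 1 ⌊δ * n⌋₊, S1 m) ∪ (⋃ m ∈ Finset.Icc 1 ⌊δ * n⌋₊, S2 m)) ∪
          ⋃ L ∈ Finset.range (n + 1), S3 L) := by
      intro σ hσ
      by_contra hcon
      simp only [Set.mem_union, Set.mem_iUnion, not_or, not_exists, Finset.mem_Icc,
        Finset.mem_range] at hcon
      obtain ⟨h0, ⟨h1, h2⟩, h3⟩ := hcon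
      refine hσ ⟨?_, ?_, ?_, ?_⟩
      · intro A hA hAD i
        by_contra! hi
        exact h0 ⟨A, hA, hAD, i, hi⟩
      · intro A hA hA0 hAδ
        by_contra! hc
        exact h1 _ ⟨hA0, Nat.le_floor hAδ⟩ ⟨A, hA, rfl, hc⟩
      · intro A hA W hW0 hWδ hWA
        by_contra! hc
        exact h2 _ ⟨hW0, Nat.le_floor hWδ⟩ ⟨A, hA, W, rfl, hWA, hc⟩
      · intro L hL
        by_contra! hc
        exact h3 L (by omega) hc
    have hfl : ∀ m ∈ Finset.Icc 1 ⌊δ * n⌋₊, 0 < m ∧ m ≤ n := by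
      intro m hm
      obtain ⟨hm1, hm2⟩ := Finset.mem_Icc.1 hm
      refine ⟨hm1, ?_⟩
      have : (m : ℝ) ≤ δ * n := (Nat.le_floor_iff (by positivity)).1 hm2
      have : (m : ℝ) ≤ n := by nlinarith
      exact_mod_cast this
    refine (unifProb_mono hsub).trans ((unifProb_union_le _ _).trans ?_)
    refine add_le_add (hmid n hn0 hkn) ((unifProb_union_le _ _).trans (add_le_add
      ((unifProb_union_le _ _).trans (add_le_add ?_ ?_)) ?_))
    · refine (unifProb_biUnion_le _ _).trans (Finset.sum_le_sum fun m hm => ?_)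
      obtain ⟨hm0, hmn⟩ := hfl m hm
      obtain ⟨hq0, hq1, hqm⟩ := quarter_root_spec hm0 hmn
      refine (unifProb_small_union_le (by omega) hdk.le hN hm0 hq0 hq1 hqm).trans ?_
      gcongr
      rw [hC]
      exact le_add_of_nonneg_right (by positivity)
    · refine (unifProb_biUnion_le _ _).trans (Finset.sum_le_sum fun m hm => ?_)
      obtain ⟨hm0, hmn⟩ := hfl m hm
      obtain ⟨hq0, hq1, hqm⟩ := quarter_root_spec hm0 hmn
      refine (unifProb_few_cycles_le hd hdk.le hN hm0 hq0 hq1 hqm).trans ?_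
      gcongr
      rw [hC]
      exact le_add_of_nonneg_left (by positivity)
    · refine (unifProb_biUnion_le _ _).trans ?_
      have h3 : ∀ L ∈ Finset.range (n + 1), unifProb (S3 L) ≤ (1 / 2) ^ L * (√n)⁻¹ := by
        intro L _
        have hk' : (0 : ℝ) < k := by exact_mod_cast NeZero.pos k
        have hsb : 0 < shortBound d k L := by
          unfold shortBound
          rcases Nat.eq_zero_or_pos L with rfl | hL
          · simp [Real.exp_pos]
          · have : (0 : ℝ) < L := by exact_mod_cast hL
            positivity
        have hs : 0 < √(n : ℝ) := Real.sqrt_pos.2 hn'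
        have h4 := mul_unifProb_le (d := d) hkn (shortFam d k n L) (fun x => x.2)
          (2 ^ L * shortBound d k L * √n)
        have h5 := h4.trans (sum_shortFam_le hdk.le (by omega) hN hn0 L)
        change 2 ^ L * shortBound d k L * √n * unifProb (S3 L) ≤ shortBound d k L at h5
        rw [div_pow, one_pow, one_div, ← mul_inv, ← one_div, le_div_iff₀ (by positivity)]
        refine le_of_mul_le_mul_left ?_ hsb
        calc _ = 2 ^ L * shortBound d k L * √n * unifProb (S3 L) := by ring
          _ ≤ _ := by rwa [mul_one]
      refine (Finset.sum_le_sum h3).trans ?_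
      rw [← Finset.sum_mul]
      gcongr
      exact sum_geometric_two_le _
  have hle : ∀ n : Size k, unifProb {σ : UnifHom d k (Fin n.1) | IsTypical δ η η' σ} ≤ 1 := by
    intro n
    have h := unifProb_compl (d := d) n.2.2 {σ : UnifHom d k (Fin n.1) | IsTypical δ η η' σ}
    have h' := unifProb_nonneg {σ : UnifHom d k (Fin n.1) | IsTypical δ η η' σ}ᶜ
    linarith
  have hlim : Tendsto (fun n : Size k => 1 - E n.1) atTop (𝓝 1) := by
    simpa using (hE.comp (tendsto_size (k := k) (by omega))).const_sub 1
  exact tendsto_of_tendsto_of_tendsto_of_le_of_le hlim tendsto_const_nhds hbound hle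

end Typical

/-! ### Patterns on separated balls extend to codewords -/

section Key

variable {d k n : ℕ}

theorem chi_compl {V : Type*} [Fintype V] [DecidableEq V] (A : Finset V) (v : V) :
    chi Aᶜ v = chi A v + 1 := by
  unfold chi
  by_cases h : v ∈ A
  · simp only [Finset.mem_compl, h, not_true, if_true, if_false]; decide
  · simp [h]

theorem chi_eq_iff {V : Type*} [DecidableEq V] {A : Finset V} {v : V} : chi A v ≠ 0 ↔ v ∈ A := by
  unfold chi
  split_ifs with h <;> simp [h]

theorem oddSet_subset_biUnion {V : Type*} [Fintype V] [DecidableEq V] (A : Fin d → Finset V) :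
    oddSet A ⊆ Finset.univ.biUnion A := by
  intro v hv
  obtain ⟨i, -, hi⟩ := Finset.exists_ne_zero_of_sum_ne_zero (mem_oddSet.1 hv)
  exact Finset.mem_biUnion.2 ⟨i, Finset.mem_univ i, chi_eq_iff.1 hi⟩

theorem mul_numCycles [NeZero k] {V : Type*} [Fintype V] [DecidableEq V] (σ : UnifHom d k V)
    {A : Fin d → Finset V} (hA : InvTuple σ.1 A) : k * numCycles k A = ∑ i, (A i).card := by
  rw [numCycles, Finset.mul_sum]
  exact Finset.sum_congr rfl fun i _ =>
    Nat.mul_div_cancel' ((hA i).dvd_card (NeZero.pos k) (σ.2 i))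

/-- A small odd set of an invariant tuple is the odd set of an invariant tuple with few cycles:
complement the large members. -/
theorem IsTypical.exists_small {δ η η' : ℝ} {σ : UnifHom d k (Fin n)} (hσ : IsTypical δ η η' σ)
    (hn : 0 < n) (hdk : d ≤ k) (hk : 0 < k) (hη : η < 1 / 2) (hη'0 : 0 ≤ η') (hη' : η' ≤ δ)
    (hdη : d * η' ≤ 1 / 2) {A : Fin d → Finset (Fin n)} (hA : InvTuple σ.1 A)
    (hAη : (oddSet A).card ≤ η * n) :
    ∃ B, InvTuple σ.1 B ∧ oddSet B = oddSet A ∧ numCycles k B ≤ δ * n := by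
  classical
  have : NeZero k := ⟨by omega⟩
  have hn' : (0 : ℝ) < n := by exact_mod_cast hn
  let B : Fin d → Finset (Fin n) := fun i => if (A i).card ≤ η' * n then A i else (A i)ᶜ
  let c : ZMod 2 := ∑ i, if (A i).card ≤ η' * n then 0 else 1
  have hB : InvTuple σ.1 B := by
    intro i
    simp only [B]
    split_ifs
    exacts [hA i, (hA i).compl]
  have hBcard : ∀ i, ((B i).card : ℝ) ≤ η' * n := by
    intro i
    simp only [B]
    split_ifs with h
    · exact h
    · have h1 := (hσ.mid A hA hAη i).resolve_left h
      have h2 := Finset.card_add_card_compl (A i)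
      rw [Fintype.card_fin] at h2
      have h3 : ((A i).card : ℝ) + ((A i)ᶜ.card : ℝ) = n := by exact_mod_cast h2
      linarith
  have hBsum : ((∑ i, (B i).card : ℕ) : ℝ) ≤ d * η' * n := by
    push_cast
    calc ∑ i, ((B i).card : ℝ) ≤ ∑ _i : Fin d, η' * n := Finset.sum_le_sum fun i _ => hBcard i
      _ = _ := by rw [Finset.sum_const, Finset.card_univ, Fintype.card_fin, nsmul_eq_mul, mul_assoc]
  have hchi : ∀ v, ∑ i, chi (B i) v = ∑ i, chi (A i) v + c := by
    intro v
    rw [← Finset.sum_add_distrib]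
    refine Finset.sum_congr rfl fun i _ => ?_
    simp only [B]
    split_ifs
    · rw [add_zero]
    · rw [chi_compl]
  -- an odd number of complements would make the odd set of `B` contain almost all points
  have hc : c = 0 := by
    by_contra hc
    have hc1 : c = 1 := by
      have : ∀ a : ZMod 2, a ≠ 0 → a = 1 := by decide
      exact this c hc
    have hodd : (oddSet A)ᶜ ⊆ oddSet B := by
      intro v hv
      rw [Finset.mem_compl, mem_oddSet, not_not] at hv
      rw [mem_oddSet, hchi, hv, hc1]
      decide
    have h1 : (oddSet A)ᶜ.card ≤ ∑ i, (B i).card :=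
      (Finset.card_le_card (hodd.trans (oddSet_subset_biUnion B))).trans Finset.card_biUnion_le
    have h2 := Finset.card_add_card_compl (oddSet A)
    rw [Fintype.card_fin] at h2
    have h3 : ((oddSet A).card : ℝ) + ((oddSet A)ᶜ.card : ℝ) = n := by exact_mod_cast h2
    have h4 : ((oddSet A)ᶜ.card : ℝ) ≤ ((∑ i, (B i).card : ℕ) : ℝ) := by exact_mod_cast h1
    nlinarith
  refine ⟨B, hB, ?_, ?_⟩
  · ext v
    rw [mem_oddSet, mem_oddSet, hchi, hc, add_zero]
  · have h1 : ((k * numCycles k B : ℕ) : ℝ) ≤ d * η' * n := by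
      rw [mul_numCycles σ hB]; exact hBsum
    have hk' : (0 : ℝ) < k := by exact_mod_cast hk
    have hdk' : (d : ℝ) ≤ k := by exact_mod_cast hdk
    refine le_of_mul_le_mul_left ?_ hk'
    push_cast at h1
    calc (k : ℝ) * numCycles k B ≤ d * η' * n := h1
      _ ≤ k * δ * n := by gcongr
      _ = _ := by ring

/-- If the cycles of an invariant tuple meet a set containing the odd set in at most one point
each, then the tuple covers few points: every point outside that set is covered twice. -/
theorem two_mul_card_biUnion_le [NeZero k] {V : Type*} [Fintype V] [DecidableEq V]
    (σ : UnifHom d k V) {A : Fin d → Finset V} (hA : InvTuple σ.1 A) {Y : Finset V}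
    (hY : oddSet A ⊆ Y)
    (hmeet : ∀ i, ∀ v ∈ A i ∩ Y, ∀ w ∈ Y, w ∈ orb k (σ.1 (gen i)) v → w = v) :
    2 * (Finset.univ.biUnion A).card ≤ (k + 1) * numCycles k A := by
  have hk := NeZero.pos k
  set U := Finset.univ.biUnion A with hU
  let c : V → ℕ := fun v => (Finset.univ.filter fun i => v ∈ A i).card
  have hsum : ∑ i, (A i).card = ∑ v ∈ U, c v := by
    simp only [c, Finset.card_filter]
    rw [Finset.sum_comm]
    refine Finset.sum_congr rfl fun i _ => ?_
    rw [← Finset.card_filter]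
    congr 1
    ext v
    simp only [hU, Finset.mem_filter, Finset.mem_biUnion, Finset.mem_univ, true_and]
    exact ⟨fun h => ⟨⟨i, h⟩, h⟩, fun h => h.2⟩
  have hc1 : ∀ v ∈ U, 2 ≤ c v + if v ∈ Y then 1 else 0 := by
    intro v hv
    obtain ⟨i, -, hi⟩ := Finset.mem_biUnion.1 hv
    have hpos : 0 < c v := Finset.card_pos.2 ⟨i, by simpa using hi⟩
    split_ifs with hvY
    · omega
    · have h0 : ∑ i, chi (A i) v = 0 := by
        by_contra h
        exact hvY (hY (mem_oddSet.2 h))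
      have h1 : ((c v : ℕ) : ZMod 2) = 0 := by
        rw [← h0]
        simp only [c, chi, Finset.sum_boole]
      rw [ZMod.natCast_eq_zero_iff] at h1
      have := Nat.le_of_dvd hpos h1
      omega
  have hUY : (U.filter fun v => v ∈ Y).card ≤ numCycles k A := by
    have h1 : (U.filter fun v => v ∈ Y) ⊆ Finset.univ.biUnion fun i => A i ∩ Y := by
      intro v hv
      obtain ⟨hvU, hvY⟩ := Finset.mem_filter.1 hv
      obtain ⟨i, hi, hvi⟩ := Finset.mem_biUnion.1 hvU
      exact Finset.mem_biUnion.2 ⟨i, hi, Finset.mem_inter.2 ⟨hvi, hvY⟩⟩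
    refine (Finset.card_le_card h1).trans (Finset.card_biUnion_le.trans ?_)
    refine Finset.sum_le_sum fun i _ => ?_
    have h2 := card_eq_mul_card_cycles hk (σ.2 i) (hA i)
    rw [h2, Nat.mul_div_cancel_left _ hk]
    refine Finset.card_le_card_of_injOn (orb k (σ.1 (gen i))) ?_ ?_
    · intro v hv
      exact Finset.mem_image_of_mem _ (Finset.mem_inter.1 hv).1
    · intro v hv w hw hvw
      refine (hmeet i v hv w (Finset.mem_inter.1 hw).2 ?_).symm
      rw [hvw]
      exact self_mem_orb hk w
  have h3 : 2 * U.card ≤ ∑ v ∈ U, c v + (U.filter fun v => v ∈ Y).card := by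
    rw [Finset.card_filter, ← Finset.sum_add_distrib, mul_comm, ← smul_eq_mul]
    exact Finset.card_nsmul_le_sum _ _ _ hc1
  rw [← hsum, ← mul_numCycles σ hA] at h3
  calc 2 * U.card ≤ k * numCycles k A + numCycles k A := h3.trans (by omega)
    _ = _ := by ring

/-- The points of `S` have disjoint, injective and mutually non-adjacent balls of radius `r`. -/
def IsSeparated {V : Type*} (σ : Gam d k →* Equiv.Perm V) (r : ℕ) (S : Finset V) : Prop :=
  ∀ s ∈ S, ∀ s' ∈ S, ∀ g ∈ wordBall (gens d k) (2 * r + 1), σ g s = s' → s = s' ∧ g = 1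

theorem IsSeparated.eq_of_pow_mul [NeZero k] {V : Type*} {σ : Gam d k →* Equiv.Perm V} {r : ℕ}
    {S : Finset V} (hS : IsSeparated σ r S) {s s' : V} (hs : s ∈ S) (hs' : s' ∈ S)
    {b b' : Gam d k} (hb : b ∈ wordBall (gens d k) r) (hb' : b' ∈ wordBall (gens d k) r)
    (i : Fin d) (j : ℕ) (h : σ (gen i ^ j * b) s = σ b' s') : s = s' ∧ gen i ^ j * b = b' := by
  have h1 : b'⁻¹ * (gen i ^ j * b) ∈ wordBall (gens d k) (2 * r + 1) := by
    have := mul_mem_wordBall (inv_mem_wordBall hb')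
      (mul_mem_wordBall (gen_pow_mem_wordBall i j) hb)
    rwa [show r + (1 + r) = 2 * r + 1 by ring] at this
  have h2 := hS s hs s' hs' _ h1 (by
    rw [map_mul, Equiv.Perm.mul_apply, h, ← Equiv.Perm.mul_apply, ← map_mul, inv_mul_cancel,
      map_one, Equiv.Perm.one_apply])
  exact ⟨h2.1, (inv_mul_eq_one.1 h2.2).symm⟩

theorem IsSeparated.eq [NeZero k] (hd : 0 < d) {V : Type*} {σ : Gam d k →* Equiv.Perm V} {r : ℕ}
    {S : Finset V} (hS : IsSeparated σ r S) {s s' : V} (hs : s ∈ S) (hs' : s' ∈ S)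
    {b b' : Gam d k} (hb : b ∈ wordBall (gens d k) r) (hb' : b' ∈ wordBall (gens d k) r)
    (h : σ b s = σ b' s') : s = s' ∧ b = b' := by
  simpa using hS.eq_of_pow_mul hs hs' hb hb' ⟨0, hd⟩ 0 (by simpa using h)

/-- The parity checks in terms of inverse powers of the generator. -/
theorem sum_pow_neg_eq_zero {x : Gam d k → ZMod 2} (hx : x ∈ X d k) (g : Gam d k) (i : Fin d) :
    ∑ j ∈ Finset.range k, x (g * (gen i ^ j)⁻¹) = 0 := by
  have h := hx (g * (gen i ^ (k - 1))⁻¹) i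
  rw [← Finset.sum_range_reflect] at h
  rw [← h]
  refine Finset.sum_congr rfl fun j hj => ?_
  have hj := Finset.mem_range.1 hj
  have h1 : (gen i : Gam d k) ^ (k - 1) = gen i ^ (k - 1 - j) * gen i ^ j := by
    rw [← pow_add]; congr 1; omega
  rw [h1]
  group

/-- Pulling back a codeword gives a point of the parity check subshift. -/
theorem pullback_mem_X {V : Type*} {σ : Gam d k →* Equiv.Perm V} {z : V → ZMod 2}
    (hz : z ∈ code σ) (v : V) : pullback (fun g => σ g) v z ∈ X d k := by
  intro g i
  have h := hz (σ ((gen i ^ (k - 1))⁻¹ * g⁻¹) v) i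
  rw [← Finset.sum_range_reflect] at h
  rw [← h]
  refine Finset.sum_congr rfl fun j hj => ?_
  have hj := Finset.mem_range.1 hj
  have h1 : (gen i : Gam d k) ^ (k - 1) = gen i ^ j * gen i ^ (k - 1 - j) := by
    rw [← pow_add]; congr 1; omega
  rw [pullback, ← map_pow, ← Equiv.Perm.mul_apply, ← map_mul, h1]
  congr 3
  group

/-- A linear functional vanishing on the code is the pairing with the odd set of an invariant
tuple. -/
theorem exists_invTuple_of_code_le_ker [NeZero k] {V : Type*} [Fintype V] [DecidableEq V]
    (σ : UnifHom d k V) (φ : (V → ZMod 2) →ₗ[ZMod 2] ZMod 2)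
    (hφ : code σ.1 ≤ LinearMap.ker φ) :
    ∃ A, InvTuple σ.1 A ∧ ∀ f, φ f = ∑ v, f v * ∑ i, chi (A i) v := by
  let L : V × Fin d → (V → ZMod 2) →ₗ[ZMod 2] ZMod 2 := fun p =>
    ∑ j ∈ Finset.range k, LinearMap.proj ((σ.1 (gen p.2) ^ j) p.1)
  have hL : ∀ p f, L p f = ∑ j ∈ Finset.range k, f ((σ.1 (gen p.2) ^ j) p.1) := by
    intro p f; simp [L]
  have hspan : φ ∈ Submodule.span (ZMod 2) (Set.range L) := by
    refine mem_span_of_iInf_ker_le_ker fun f hf => hφ fun v i => ?_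
    rw [← hL (v, i)]
    exact (Submodule.mem_iInf _).1 hf (v, i)
  have key : ∃ a : Fin d → V → ZMod 2, (∀ i v, a i (σ.1 (gen i) v) = a i v) ∧
      ∀ f, φ f = ∑ v, f v * ∑ i, a i v := by
    clear hφ
    induction hspan using Submodule.span_induction with
    | mem φ h =>
      obtain ⟨⟨w, i⟩, rfl⟩ := h
      refine ⟨fun i' => if i' = i then chi (orb k (σ.1 (gen i)) w) else 0, ?_, ?_⟩
      · intro i' v
        by_cases h : i' = i
        · subst h
          simp only [if_true, chi, isInv_orb (NeZero.pos k) (σ.2 i') w v]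
        · simp [h]
      · intro f
        have : ∀ v, (∑ i', (if i' = i then chi (orb k (σ.1 (gen i)) w) else 0 : V → ZMod 2) v) =
            chi (orb k (σ.1 (gen i)) w) v := by
          intro v
          rw [Finset.sum_eq_single i]
          · simp
          · intro b _ hb; simp [hb]
          · simp
        simp only [this, chi, mul_ite, mul_one, mul_zero]
        rw [Finset.sum_ite_mem, Finset.univ_inter, sum_orb (σ.2 i), hL]
    | zero => exact ⟨0, fun _ _ => rfl, fun f => by simp⟩
    | add φ ψ _ _ h1 h2 =>
      obtain ⟨a, ha, ha'⟩ := h1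
      obtain ⟨b, hb, hb'⟩ := h2
      refine ⟨a + b, fun i v => by simp [ha, hb], fun f => ?_⟩
      simp [ha', hb', Finset.sum_add_distrib, mul_add]
    | smul c φ _ h =>
      obtain ⟨a, ha, ha'⟩ := h
      refine ⟨c • a, fun i v => by simp [ha], fun f => ?_⟩
      simp only [LinearMap.smul_apply, ha', Pi.smul_apply, smul_eq_mul, Finset.mul_sum]
      exact Finset.sum_congr rfl fun v _ => Finset.sum_congr rfl fun i _ => by ring
  obtain ⟨a, ha, ha'⟩ := key
  have hchi : ∀ i v, chi (Finset.univ.filter fun v => a i v ≠ 0) v = a i v := by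
    intro i v
    have h : ∀ c : ZMod 2, (if c ≠ 0 then 1 else 0) = c := by decide
    rw [chi]
    simp only [Finset.mem_filter, Finset.mem_univ, true_and]
    exact h _
  refine ⟨fun i => Finset.univ.filter fun v => a i v ≠ 0, fun i v => by simp [ha], fun f => ?_⟩
  simp only [hchi, ha']

/-- Locally legal patterns on the balls around the points of a separated set of moderate size are
induced by a common codeword. -/
theorem IsTypical.exists_codeword {δ η η' : ℝ} {σ : UnifHom d k (Fin n)}
    (hσ : IsTypical δ η η' σ) (hn : 0 < n) (hd : 0 < d) (hdk : d ≤ k) (hη : η < 1 / 2)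
    (hη'0 : 0 ≤ η') (hη' : η' ≤ δ) (hdη : d * η' ≤ 1 / 2) {r : ℕ} {S : Finset (Fin n)}
    (hS : IsSeparated σ.1 r S) (hSη : (S.card * (wordBall (gens d k) r).ncard : ℝ) ≤ η * n)
    (x : Fin n → Gam d k → ZMod 2) (hx : ∀ s, x s ∈ X d k) :
    ∃ z ∈ code σ.1, ∀ s ∈ S, ∀ b ∈ wordBall (gens d k) r, z (σ.1 b s) = x s b⁻¹ := by
  classical
  have hk : 0 < k := by omega
  have : NeZero k := ⟨by omega⟩
  let B : Finset (Gam d k) := (finite_wordBall (d := d) (k := k) r).toFinset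
  have hB : ∀ b, b ∈ B ↔ b ∈ wordBall (gens d k) r := fun b => Set.Finite.mem_toFinset _
  let Y : Finset (Fin n) := (S ×ˢ B).image fun p => σ.1 p.2 p.1
  have hY : ∀ v, v ∈ Y ↔ ∃ s ∈ S, ∃ b ∈ wordBall (gens d k) r, σ.1 b s = v := by
    intro v
    simp only [Y, Finset.mem_image, Finset.mem_product, Prod.exists, hB]
    exact ⟨fun ⟨s, b, ⟨h1, h2⟩, h3⟩ => ⟨s, h1, b, h2, h3⟩,
      fun ⟨s, h1, b, h2, h3⟩ => ⟨s, b, ⟨h1, h2⟩, h3⟩⟩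
  have hYcard : (Y.card : ℝ) ≤ η * n := by
    refine le_trans ?_ hSη
    have h1 : Y.card ≤ S.card * B.card := Finset.card_image_le.trans (Finset.card_product _ _).le
    have h2 : B.card = (wordBall (gens d k) r).ncard :=
      (Set.ncard_eq_toFinset_card _ (finite_wordBall r)).symm
    rw [h2] at h1
    exact_mod_cast h1
  obtain ⟨p, hp⟩ : ∃ p : Fin n → ZMod 2,
      ∀ s ∈ S, ∀ b ∈ wordBall (gens d k) r, p (σ.1 b s) = x s b⁻¹ := by
    refine ⟨fun v => if h : ∃ q : Fin n × Gam d k, (q.1 ∈ S ∧ q.2 ∈ wordBall (gens d k) r) ∧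
      σ.1 q.2 q.1 = v then x h.choose.1 h.choose.2⁻¹ else 0, fun s hs b hb => ?_⟩
    have h : ∃ q : Fin n × Gam d k, (q.1 ∈ S ∧ q.2 ∈ wordBall (gens d k) r) ∧
      σ.1 q.2 q.1 = σ.1 b s := ⟨(s, b), ⟨hs, hb⟩, rfl⟩
    beta_reduce
    rw [dif_pos h]
    obtain ⟨h1, h2⟩ := hS.eq hd h.choose_spec.1.1 hs h.choose_spec.1.2 hb h.choose_spec.2
    rw [h1, h2]
  let NY : Submodule (ZMod 2) (Fin n → ZMod 2) :=
    { carrier := {f | ∀ v ∈ Y, f v = 0}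
      zero_mem' := fun _ _ => rfl
      add_mem' := fun hf hg v hv => by simp [hf v hv, hg v hv]
      smul_mem' := fun c f hf v hv => by simp [hf v hv] }
  -- codewords are only prescribed on `Y`, so `p` matters modulo the functions vanishing on `Y`
  suffices hmem : p ∈ code σ.1 ⊔ NY by
    obtain ⟨z, hz, f, hf, hzf⟩ := Submodule.mem_sup.1 hmem
    refine ⟨z, hz, fun s hs b hb => ?_⟩
    have := hf (σ.1 b s) ((hY _).2 ⟨s, hs, b, hb, rfl⟩)
    rw [← hp s hs b hb, ← hzf, Pi.add_apply, this, add_zero]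
  by_contra hmem
  obtain ⟨φ, hφp, hφ⟩ := Submodule.exists_le_ker_of_notMem hmem
  obtain ⟨A, hA, hAφ⟩ := exists_invTuple_of_code_le_ker σ φ (le_sup_left.trans hφ)
  have hAY : oddSet A ⊆ Y := by
    intro v hv
    by_contra hvY
    refine mem_oddSet.1 hv ?_
    have h1 : φ (Pi.single v 1) = 0 := by
      refine hφ (le_sup_right (a := code σ.1) (b := NY) ?_)
      intro w hw
      have : w ≠ v := fun h => hvY (h ▸ hw)
      simp [this]
    rw [hAφ, Finset.sum_eq_single v] at h1
    · simpa using h1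
    · intro w _ hw; simp [hw]
    · simp
  have hAη : ((oddSet A).card : ℝ) ≤ η * n :=
    le_trans (by exact_mod_cast Finset.card_le_card hAY) hYcard
  obtain ⟨A', hA', hAA', hA'δ⟩ := hσ.exists_small hn hdk hk hη hη'0 hη' hdη hA hAη
  -- the cycles of `A'` that are not contained in `Y`
  let A'' : Fin d → Finset (Fin n) := fun i =>
    (A' i).filter fun v => ¬ orb k (σ.1 (gen i)) v ⊆ Y
  have horb : ∀ i v, orb k (σ.1 (gen i)) (σ.1 (gen i) v) = orb k (σ.1 (gen i)) v := by
    intro i v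
    refine orb_eq_of_mem hk (σ.2 i) ?_
    simpa using pow_mem_orb hk (σ.2 i) v 1
  have hA'' : InvTuple σ.1 A'' := by
    intro i v
    simp only [A'', Finset.mem_filter, horb]
    rw [hA' i v]
  have hA''Y : oddSet A'' ⊆ Y := by
    intro v hv
    by_contra hvY
    refine hvY (hAY (hAA' ▸ mem_oddSet.2 ?_))
    have h1 : ∀ i, chi (A'' i) v = chi (A' i) v := by
      intro i
      have : v ∈ A'' i ↔ v ∈ A' i := by
        simp only [A'', Finset.mem_filter, and_iff_left_iff_imp]
        exact fun _ h => hvY (h (self_mem_orb hk v))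
      simp only [chi, this]
    simpa only [h1] using mem_oddSet.1 hv
  have hmeet : ∀ i, ∀ v ∈ A'' i ∩ Y, ∀ w ∈ Y, w ∈ orb k (σ.1 (gen i)) v → w = v := by
    intro i v hv w hw hwv
    obtain ⟨hvA, hvY⟩ := Finset.mem_inter.1 hv
    by_contra hne
    refine (Finset.mem_filter.1 hvA).2 ?_
    obtain ⟨s, hs, b, hb, rfl⟩ := (hY v).1 hvY
    obtain ⟨s', hs', b', hb', rfl⟩ := (hY w).1 hw
    obtain ⟨j, -, hj⟩ := Finset.mem_image.1 hwv
    rw [← map_pow, ← Equiv.Perm.mul_apply, ← map_mul] at hj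
    obtain ⟨hss, hbb⟩ := hS.eq_of_pow_mul hs hs' hb hb' i j hj
    intro u hu
    obtain ⟨t, -, rfl⟩ := Finset.mem_image.1 hu
    rw [hY]
    refine ⟨s, hs, gen i ^ t * b, wordBall_convex hb (j := j) (hbb ▸ hb') ?_ t, by simp⟩
    rintro h
    exact hne (by rw [← hbb, ← hss, h])
  have hle : numCycles k A'' ≤ numCycles k A' :=
    Finset.sum_le_sum fun i _ => Nat.div_le_div_right (Finset.card_le_card
      (Finset.filter_subset _ _))
  -- `hmeet` bounds the covered set from above, typicality bounds it from below
  have hzero : numCycles k A'' = 0 := by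
    by_contra h
    have h1 := hσ.union A'' hA'' (Nat.pos_of_ne_zero h)
      (le_trans (by exact_mod_cast hle) hA'δ)
    have h2 := two_mul_card_biUnion_le σ hA'' hA''Y hmeet
    omega
  have hsub : ∀ i, ∀ v ∈ A' i, orb k (σ.1 (gen i)) v ⊆ Y := by
    intro i v hv
    by_contra h
    have h1 : v ∈ A'' i := Finset.mem_filter.2 ⟨hv, h⟩
    have h2 := mul_numCycles σ hA''
    rw [hzero, mul_zero, eq_comm, Finset.sum_eq_zero_iff] at h2
    have h3 := h2 i (Finset.mem_univ i)
    rw [Finset.card_eq_zero] at h3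
    rw [h3] at h1
    simp at h1
  refine hφp ?_
  rw [hAφ]
  simp only [← chi_oddSet, ← hAA']
  simp only [chi_oddSet, Finset.mul_sum]
  rw [Finset.sum_comm]
  refine Finset.sum_eq_zero fun i _ => ?_
  simp only [chi, mul_ite, mul_one, mul_zero]
  rw [Finset.sum_ite_mem, Finset.univ_inter]
  refine sum_eq_zero_of_sum_orb_eq_zero hk (σ.2 i) (hA' i) p fun v hv => ?_
  have hvY := hsub i v hv
  obtain ⟨s, hs, b, hb, rfl⟩ := (hY v).1 (hvY (self_mem_orb hk v))
  rw [sum_orb (σ.2 i), ← sum_pow_neg_eq_zero (hx s) b⁻¹ i]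
  refine Finset.sum_congr rfl fun j _ => ?_
  obtain ⟨s', hs', b', hb', h⟩ := (hY _).1 (hvY (pow_mem_orb hk (σ.2 i) (σ.1 b s) j))
  have h' : σ.1 (gen i ^ j * b) s = σ.1 b' s' := by rw [h]; simp
  obtain ⟨rfl, rfl⟩ := hS.eq_of_pow_mul hs hs' hb hb' i j h'
  rw [← h, hp s hs _ hb', mul_inv_rev]

end Key

/-! ### Fixed points and short cycles -/

section Sofic

variable {d k n : ℕ}

/-- The suffix products of a reduced word, read from the right. -/
theorem exists_path [NeZero k] (i₀ : Fin d) (w : List (Σ _ : Fin d, Multiplicative (ZMod k)))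
    (h1 : ∀ l ∈ w, l.2 ≠ 1) (hc : List.IsChain (fun l l' => l.1 ≠ l'.1) w) :
    ∃ (h : ℕ → Gam d k) (i : ℕ → Fin d) (m : ℕ → ℕ), h 0 = 1 ∧
      h w.length = (w.map fun l => Monoid.CoprodI.of
        (M := fun _ => Multiplicative (ZMod k)) (i := l.1) l.2).prod ∧
      (∀ t < w.length, 0 < m t ∧ m t < k ∧ h (t + 1) = gen (i t) ^ m t * h t) ∧
      (∀ t, t + 1 < w.length → i t ≠ i (t + 1)) ∧
      ∀ x, w.head? = some x → i (w.length - 1) = x.1 := by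
  induction w with
  | nil => exact ⟨1, fun _ => i₀, fun _ => 0, rfl, by simp, by simp, by simp, by simp⟩
  | cons x w ih =>
    obtain ⟨h, i, m, ha, hb, hm, hi, hhead⟩ :=
      ih (fun l hl => h1 l (List.mem_cons_of_mem _ hl)) hc.tail
    have hx1 : x.2 ≠ 1 := h1 x (by simp)
    refine ⟨fun t => if t ≤ w.length then h t else Monoid.CoprodI.of
        (M := fun _ => Multiplicative (ZMod k)) (i := x.1) x.2 * h w.length,
      fun t => if t < w.length then i t else x.1,
      fun t => if t < w.length then m t else (Multiplicative.toAdd x.2).val, ?_, ?_, ?_, ?_, ?_⟩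
    · simp [ha]
    · simp [hb]
    · intro t ht
      rw [List.length_cons] at ht
      rcases Nat.lt_succ_iff_lt_or_eq.1 ht with ht | rfl
      · simp only [ht, if_true, ht.le, show t + 1 ≤ w.length from ht]
        exact hm t ht
      · simp only [lt_irrefl, if_false, le_refl, if_true,
          show ¬ (w.length + 1 ≤ w.length) by omega]
        refine ⟨?_, ZMod.val_lt _, ?_⟩
        · rw [Nat.pos_iff_ne_zero, Ne, ZMod.val_eq_zero]
          exact hx1
        · rw [gen_pow, ZMod.natCast_val, ZMod.cast_id]; rfl
    · intro t ht
      rw [List.length_cons] at ht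
      have ht' : t < w.length := by omega
      simp only [ht', if_true]
      split_ifs with ht2
      · exact hi t ht2
      · have hw : w ≠ [] := by rintro rfl; simp at ht'
        obtain ⟨y, w', rfl⟩ := List.exists_cons_of_ne_nil hw
        have h3 := hhead y rfl
        have h4 : t = (y :: w').length - 1 := by omega
        rw [h4, h3]
        exact (List.isChain_cons_cons.1 hc).1.symm
    · intro y hy
      simp at hy
      simp [hy]

/-- A closed walk in which consecutive steps have different types contains a short cyclic
configuration. -/
theorem exists_short_of_closed_walk [NeZero k] (σ : UnifHom d k (Fin n)) {p L : ℕ}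
    (hp : 2 ≤ p) (hpL : p ≤ L) (u : ℕ → Fin n) (j : ℕ → Fin d)
    (hinj : Set.InjOn u (Finset.range p)) (hclosed : u p = u 0)
    (hstep : ∀ t < p, u (t + 1) ∈ orb k (σ.1 (gen (j t))) (u t))
    (hne : ∀ t, t + 1 < p → j t ≠ j (t + 1)) :
    ∃ x ∈ shortFam d k n L, InvTuple σ.1 x.2 ∧ u 1 ∈ x.1.1 := by
  have hk := NeZero.pos k
  suffices h : ∃ T E : Finset ℕ, T ⊆ Finset.range p ∧ 1 ∈ T ∧ T.card = E.card ∧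
      ∀ t ∈ T, ∃ e ∈ E, ∃ e' ∈ E, j e ≠ j e' ∧ u t ∈ orb k (σ.1 (gen (j e))) (u e) ∧
        u t ∈ orb k (σ.1 (gen (j e'))) (u e') by
    obtain ⟨T, E, hT, h1T, hTE, hcov⟩ := h
    set W : Finset (Fin n) := T.image u with hW
    let A : Fin d → Finset (Fin n) := fun i =>
      (E.filter fun e => j e = i).biUnion fun e => orb k (σ.1 (gen i)) (u e)
    have hA : InvTuple σ.1 A := fun i => isInv_biUnion fun e _ => isInv_orb hk (σ.2 i) (u e)
    have hWcard : W.card = T.card := Finset.card_image_of_injOn (hinj.mono (by exact_mod_cast hT))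
    have hTp : T.card ≤ p := (Finset.card_le_card hT).trans (Finset.card_range p).le
    have hcyc : numCycles k A ≤ W.card := by
      rw [hWcard, hTE, Finset.card_eq_sum_card_fiberwise (f := j) (t := Finset.univ)
        (fun _ _ => Finset.mem_coe.2 (Finset.mem_univ _))]
      refine Finset.sum_le_sum fun i _ => ?_
      refine Nat.div_le_of_le_mul (Finset.card_biUnion_le.trans ?_)
      rw [Finset.sum_congr rfl fun e _ => (σ.2 i).card_orb (u e), Finset.sum_const, smul_eq_mul,
        mul_comm]
    refine ⟨⟨⟨W, fun i => W ∩ A i⟩, A⟩, ?_, hA, Finset.mem_image_of_mem u h1T⟩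
    simp only [shortFam, Finset.mem_sigma, Finset.mem_filter, Finset.mem_univ, true_and,
      Fintype.mem_piFinset, Finset.mem_powerset]
    refine ⟨⟨⟨by omega, Finset.card_pos.2 ⟨_, Finset.mem_image_of_mem u h1T⟩⟩,
      fun i => Finset.inter_subset_left, ?_⟩, fun i => ⟨Finset.inter_subset_right, ?_⟩, hcyc⟩
    · have h1 : ∑ i, (W ∩ A i).card = ∑ w ∈ W, (Finset.univ.filter fun i => w ∈ A i).card := by
        simp only [← Finset.filter_mem_eq_inter, Finset.card_filter]
        exact Finset.sum_comm
      rw [h1, mul_comm, ← smul_eq_mul]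
      refine Finset.card_nsmul_le_sum _ _ _ fun w hw => ?_
      obtain ⟨t, ht, rfl⟩ := Finset.mem_image.1 hw
      obtain ⟨e, he, e', he', hee, h2, h3⟩ := hcov t ht
      rw [Nat.succ_le_iff, Finset.one_lt_card]
      refine ⟨j e, ?_, j e', ?_, hee⟩
      · simp only [A, Finset.mem_filter, Finset.mem_univ, true_and, Finset.mem_biUnion]
        exact ⟨e, ⟨he, rfl⟩, h2⟩
      · simp only [A, Finset.mem_filter, Finset.mem_univ, true_and, Finset.mem_biUnion]
        exact ⟨e', ⟨he', rfl⟩, h3⟩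
    · exact (Finset.single_le_sum (f := fun i => (A i).card / k) (fun _ _ => Nat.zero_le _)
        (Finset.mem_univ i)).trans hcyc
  have hcov : ∀ t, 0 < t → t < p → j (t - 1) ≠ j t ∧
      u t ∈ orb k (σ.1 (gen (j (t - 1)))) (u (t - 1)) ∧ u t ∈ orb k (σ.1 (gen (j t))) (u t) := by
    intro t h0 ht
    have h1 := hne (t - 1)
    have h2 := hstep (t - 1) (by omega)
    rw [Nat.sub_add_cancel h0] at h1 h2
    exact ⟨h1 ht, h2, self_mem_orb hk _⟩
  have hlast := hstep (p - 1) (by omega)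
  rw [Nat.sub_add_cancel (by omega), hclosed] at hlast
  by_cases hj : j 0 = j (p - 1)
  · -- the first and the last step lie in a common cycle, which is counted once
    refine ⟨Finset.Ico 1 p, Finset.range (p - 1), ?_, ?_, by simp, ?_⟩
    · intro t ht
      simp only [Finset.mem_Ico, Finset.mem_range] at ht ⊢
      omega
    · simp only [Finset.mem_Ico]; omega
    · intro t ht
      obtain ⟨ht1, ht2⟩ := Finset.mem_Ico.1 ht
      obtain ⟨h1, h2, h3⟩ := hcov t ht1 ht2
      refine ⟨t - 1, Finset.mem_range.2 (by omega), ?_⟩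
      by_cases htp : t = p - 1
      · refine ⟨0, Finset.mem_range.2 (by omega), ?_, h2, ?_⟩
        · rw [hj, ← htp]; exact h1
        · rw [htp, hj, orb_eq_of_mem hk (σ.2 _) hlast]
          exact self_mem_orb hk _
      · exact ⟨t, Finset.mem_range.2 (by omega), h1, h2, h3⟩
  · refine ⟨Finset.range p, Finset.range p, subset_rfl, Finset.mem_range.2 (by omega), rfl, ?_⟩
    intro t ht
    rw [Finset.mem_range] at ht
    rcases Nat.eq_zero_or_pos t with rfl | h0
    · exact ⟨0, Finset.mem_range.2 ht, p - 1, Finset.mem_range.2 (by omega), hj,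
        self_mem_orb hk _, hlast⟩
    · obtain ⟨h1, h2, h3⟩ := hcov t h0 ht
      exact ⟨t - 1, Finset.mem_range.2 (by omega), t, Finset.mem_range.2 ht, h1, h2, h3⟩

open Classical in
/-- Every fixed point of a nontrivial element lies near a short cyclic configuration. -/
theorem card_fixed_le [NeZero k] (σ : UnifHom d k (Fin n)) {g : Gam d k} (hg : g ≠ 1) :
    Set.ncard {v | σ.1 g v = v} ≤ (sylLen g + 1) * (sylLen g *
      ((shortFam d k n (sylLen g)).filter fun x => InvTuple σ.1 x.2).card) := by
  have hk := NeZero.pos k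
  set w := Monoid.CoprodI.Word.equiv g with hw
  have hL : sylLen g = w.toList.length := rfl
  have hwne : w.toList ≠ [] := by
    intro h
    have h1 := (Monoid.CoprodI.Word.equiv.symm_apply_apply g).symm
    apply hg
    rw [h1]
    change (List.map _ w.toList).prod = 1
    rw [h]; rfl
  have i₀ : Fin d := (w.toList.head hwne).1
  obtain ⟨h, i, m, h0, hlen, hm, hi, -⟩ := exists_path i₀ w.toList w.ne_one w.chain_ne
  rw [← hL] at hlen hm hi
  have hgL : h (sylLen g) = g := hlen.trans (Monoid.CoprodI.Word.equiv.symm_apply_apply g)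
  have hLpos : 0 < sylLen g := by rw [hL]; exact List.length_pos_iff.2 hwne
  set L := sylLen g with hLdef
  set F := (shortFam d k n L).filter fun x => InvTuple σ.1 x.2 with hF
  have hsub : {v | σ.1 g v = v} ⊆ ((Finset.range (L + 1)).biUnion fun t =>
      F.biUnion fun x => x.1.1.image (σ.1 (h t)⁻¹) : Finset (Fin n)) := by
    intro v hv
    have hv : σ.1 g v = v := hv
    let y : ℕ → Fin n := fun t => σ.1 (h t) v
    have hex : ∃ p, 0 < p ∧ ∃ a, a + p ≤ L ∧ y (a + p) = y a :=
      ⟨L, hLpos, 0, by omega, by simp [y, h0, hgL, hv]⟩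
    obtain ⟨hp0, a, haL, hya⟩ := Nat.find_spec hex
    have hmin := fun q => Nat.find_min hex (m := q)
    set p := Nat.find hex with hp
    have hstep : ∀ t < L, y (t + 1) = (σ.1 (gen (i t)) ^ m t) (y t) := by
      intro t ht
      simp [y, (hm t ht).2.2]
    have hp2 : 2 ≤ p := by
      by_contra hlt
      have hp1 : p = 1 := by omega
      rw [hp1] at hya haL
      have hs := hstep a (by omega)
      rw [hya] at hs
      have h3 := ((σ.2 (i a)).pow_apply_inj (y a) hk (hm a (by omega)).2.1).1 (by simpa using hs)
      have := (hm a (by omega)).1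
      omega
    -- minimality of the closed walk
    have key : ∀ s t, s < t → t < p → y (a + s) ≠ y (a + t) := by
      intro s t hst htp he
      refine hmin (t - s) (by omega) ⟨by omega, a + s, by omega, ?_⟩
      rw [he]; congr 1; omega
    have hinj : Set.InjOn (fun t => y (a + t)) (Finset.range p) := by
      intro s hs t ht he
      rw [Finset.mem_coe, Finset.mem_range] at hs ht
      rcases lt_trichotomy s t with hst | hst | hst
      · exact absurd he (key s t hst ht)
      · exact hst
      · exact absurd he.symm (key t s hst hs)
    have horb : ∀ t < p, y (a + (t + 1)) ∈ orb k (σ.1 (gen (i (a + t)))) (y (a + t)) := by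
      intro t ht
      have := hstep (a + t) (by omega)
      rw [← add_assoc, this]
      exact pow_mem_orb hk (σ.2 _) _ _
    have hne : ∀ t, t + 1 < p → i (a + t) ≠ i (a + (t + 1)) := by
      intro t ht
      rw [← add_assoc]
      exact hi (a + t) (by omega)
    obtain ⟨x, hx, hxA, hxW⟩ := exists_short_of_closed_walk σ hp2 (by omega : p ≤ L)
      (fun t => y (a + t)) (fun t => i (a + t)) hinj hya horb hne
    rw [Finset.mem_coe, Finset.mem_biUnion]
    refine ⟨a + 1, Finset.mem_range.2 (by omega), Finset.mem_biUnion.2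
      ⟨x, Finset.mem_filter.2 ⟨hx, hxA⟩, Finset.mem_image.2 ⟨_, hxW, ?_⟩⟩⟩
    simp [y]
  refine (Set.ncard_le_ncard hsub (Set.toFinite _)).trans ?_
  rw [Set.ncard_coe_finset]
  refine Finset.card_biUnion_le.trans ?_
  have h6 := Finset.card_range (L + 1)
  refine (Finset.sum_le_card_nsmul _ _ (L * F.card) fun t _ => ?_).trans_eq
    (by rw [h6, smul_eq_mul])
  refine Finset.card_biUnion_le.trans ?_
  rw [mul_comm, ← smul_eq_mul]
  refine Finset.sum_le_card_nsmul _ _ _ fun x hx => ?_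
  refine Finset.card_image_le.trans ?_
  have h5 := (Finset.mem_filter.1 hx).1
  simp only [shortFam, Finset.mem_sigma, Finset.mem_filter] at h5
  exact h5.1.1.2.1

/-- Eventually typical homomorphisms have asymptotically few fixed points. -/
theorem tendsto_fixed (hk : 0 < k) {δ η η' : ℝ} {σ : ∀ n : Size k, UnifHom d k (Fin n.1)}
    (hσ : ∀ᶠ n in atTop, IsTypical δ η η' (σ n)) {g : Gam d k} (hg : g ≠ 1) :
    Tendsto (fun n : Size k => (Set.ncard {v | (σ n).1 g v = v} : ℝ) / n.1) atTop (𝓝 0) := by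
  have : NeZero k := ⟨hk.ne'⟩
  set L := sylLen g
  set C : ℝ := (L + 1) * (L * (2 ^ L * shortBound d k L)) with hC
  have h1 : Tendsto (fun n : Size k => C * (√(n.1 : ℝ))⁻¹) atTop (𝓝 0) := by
    have h2 := (tendsto_inv_atTop_zero.comp
      (Real.tendsto_sqrt_atTop.comp (tendsto_natCast_atTop_atTop (R := ℝ)))).const_mul C
    rw [mul_zero] at h2
    exact h2.comp (tendsto_size (k := k) hk)
  refine squeeze_zero' (Eventually.of_forall fun n => by positivity) ?_ h1
  filter_upwards [hσ, (tendsto_size (k := k) hk).eventually_ge_atTop L] with n hn hnL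
  have hn0 : (0 : ℝ) < n.1 := by exact_mod_cast n.2.1
  have h2 := card_fixed_le (σ n) hg
  have h3 := (hn.short L hnL).le
  rw [div_le_iff₀ hn0]
  calc (Set.ncard {v | (σ n).1 g v = v} : ℝ)
      ≤ (L + 1) * (L * (2 ^ L * shortBound d k L * √(n.1 : ℝ))) := by
        refine le_trans (Nat.cast_le.2 h2) ?_
        push_cast
        gcongr
    _ = C * (√(n.1 : ℝ))⁻¹ * n.1 := by
        have h4 : (n.1 : ℝ) = √(n.1 : ℝ) * √(n.1 : ℝ) := (Real.mul_self_sqrt hn0.le).symm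
        have h5 : √(n.1 : ℝ) ≠ 0 := (Real.sqrt_pos.2 hn0).ne'
        rw [hC]
        conv_rhs => rw [h4]
        simp only [Real.sqrt_mul_self (Real.sqrt_nonneg _)]
        field_simp

theorem isSoficApprox_of_isTypical (hk : 0 < k) {δ η η' : ℝ}
    {σ : ∀ n : Size k, UnifHom d k (Fin n.1)} (hσ : ∀ᶠ n in atTop, IsTypical δ η η' (σ n)) :
    IsSoficApprox (fun n g => (σ n).1 g) := by
  refine ⟨fun g h => ?_, fun g hg => ?_⟩
  · refine tendsto_const_nhds.congr fun n => ?_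
    have h1 : {v : Fin n.1 | (σ n).1 (g * h) v = (σ n).1 g ((σ n).1 h v)} = Set.univ := by
      ext v; simp
    have hn0 : (n.1 : ℝ) ≠ 0 := by exact_mod_cast n.2.1.ne'
    rw [h1, Set.ncard_univ, Nat.card_eq_fintype_card, Fintype.card_fin, div_self hn0]
  · simpa using tendsto_fixed hk hσ hg

end Sofic

/-! ### Invariant measures and their finite quotients -/

section Invariant

/-- A probability measure that is carried by a subgroup `H` and invariant under translations by
`H` pushes forward to the uniform distribution on the image of `H` in a finite group. -/
theorem measureReal_preimage_singleton {E Q : Type*} [AddCommGroup E] [MeasurableSpace E]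
    [AddCommGroup Q] [Finite Q] (m : Measure E) [IsProbabilityMeasure m] (H : AddSubgroup E)
    (hinv : ∀ h ∈ H, ∀ s, MeasurableSet s → m ((fun x => x + h) ⁻¹' s) = m s)
    (hH : ∀ s, MeasurableSet s → (H : Set E) ⊆ s → m s = 1) (φ : E →+ Q)
    (hφ : ∀ q, MeasurableSet (φ ⁻¹' {q})) :
    (∀ q ∈ H.map φ, m.real (φ ⁻¹' {q}) = (Nat.card (H.map φ) : ℝ)⁻¹) ∧
      ∀ q ∉ H.map φ, m.real (φ ⁻¹' {q}) = 0 := by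
  classical
  have : Fintype Q := Fintype.ofFinite Q
  have h0 : ∀ q ∉ H.map φ, m.real (φ ⁻¹' {q}) = 0 := by
    intro q hq
    have h1 : m (φ ⁻¹' {q})ᶜ = 1 := by
      refine hH _ (hφ q).compl fun h hh hc => hq ?_
      exact ⟨h, hh, hc⟩
    rw [measureReal_def, (prob_compl_eq_one_iff (hφ q)).1 h1, ENNReal.toReal_zero]
  have hconst : ∀ q ∈ H.map φ, m.real (φ ⁻¹' {q}) = m.real (φ ⁻¹' {0}) := by
    rintro _ ⟨h, hh, rfl⟩
    rw [measureReal_def, measureReal_def, ← hinv h hh _ (hφ _)]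
    congr 2
    ext x
    simp
  have hsum : ∑ q : Q, m.real (φ ⁻¹' {q}) = 1 := by
    rw [← measureReal_biUnion_finset (fun q _ q' _ hne => Set.disjoint_left.2 fun x hx hx' =>
      hne (hx.symm.trans hx')) (fun q _ => hφ q)]
    have : (⋃ q ∈ Finset.univ, φ ⁻¹' {q}) = Set.univ := by ext x; simp
    rw [this, probReal_univ]
  have hcard : (Nat.card (H.map φ) : ℝ) * m.real (φ ⁻¹' {0}) = 1 := by
    rw [← hsum, ← Finset.sum_filter_add_sum_filter_not _ (fun q => q ∈ H.map φ),
      Finset.sum_congr rfl (g := fun _ => m.real (φ ⁻¹' {0}))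
        (fun q hq => hconst q (Finset.mem_filter.1 hq).2), Finset.sum_const, nsmul_eq_mul,
      Finset.sum_eq_zero (fun q hq => h0 q (Finset.mem_filter.1 hq).2), add_zero]
    congr 2
    rw [Nat.card_eq_fintype_card, Fintype.card_subtype]
  refine ⟨fun q hq => ?_, h0⟩
  rw [hconst q hq]
  exact eq_inv_of_mul_eq_one_right hcard

/-- Restriction of configurations to a set of coordinates. -/
def restr {I : Type*} (B : Set I) : (I → ZMod 2) →+ (B → ZMod 2) where
  toFun x := fun i => x i
  map_zero' := rfl
  map_add' _ _ := rfl

theorem measurable_restr {I : Type*} (B : Set I) : Measurable (restr B) :=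
  measurable_pi_lambda _ fun _ => measurable_pi_apply _

theorem measurableSet_restr {I : Type*} (B : Set I) [Finite B] (q : B → ZMod 2) :
    MeasurableSet (restr B ⁻¹' {q}) :=
  measurable_restr B (measurableSet_singleton q)

/-- The marginal entropy of a Haar measure is the logarithm of the number of patterns. -/
theorem marginalEntropy_eq {I : Type*} (κ : ProbabilityMeasure (I → ZMod 2))
    (H : AddSubgroup (I → ZMod 2))
    (hinv : ∀ h ∈ H, ∀ s, MeasurableSet s →
      (κ : Measure (I → ZMod 2)) ((fun x => x + h) ⁻¹' s) = (κ : Measure (I → ZMod 2)) s)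
    (hH : ∀ s, MeasurableSet s → (H : Set (I → ZMod 2)) ⊆ s →
      (κ : Measure (I → ZMod 2)) s = 1) (B : Set I) [Finite B] :
    marginalEntropy κ B = Real.log (Nat.card (H.map (restr B))) := by
  classical
  have : Fintype B := Fintype.ofFinite B
  obtain ⟨h1, h0⟩ := measureReal_preimage_singleton (κ : Measure (I → ZMod 2)) H hinv hH (restr B)
    (measurableSet_restr B)
  have hterm : ∀ a : B → ZMod 2, Real.negMulLog (((κ : Measure (I → ZMod 2)).map
      (fun x (i : B) => x i)).real {a}) = if a ∈ H.map (restr B) then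
        (Nat.card (H.map (restr B)) : ℝ)⁻¹ * Real.log (Nat.card (H.map (restr B))) else 0 := by
    intro a
    change Real.negMulLog (((κ : Measure (I → ZMod 2)).map (restr B)).real {a}) = _
    rw [map_measureReal_apply (measurable_restr B) (measurableSet_singleton a)]
    split_ifs with ha
    · rw [h1 a ha, Real.negMulLog, Real.log_inv]; ring
    · rw [h0 a ha, Real.negMulLog_zero]
  rw [marginalEntropy, tsum_fintype, Finset.sum_congr rfl fun a _ => hterm a, ← Finset.sum_filter,
    Finset.sum_const, nsmul_eq_mul, ← mul_assoc]
  have hc : (Finset.univ.filter fun a => a ∈ H.map (restr B)).card =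
      Nat.card (H.map (restr B)) := by
    rw [Nat.card_eq_fintype_card, Fintype.card_subtype]
  have hpos : (Nat.card (H.map (restr B)) : ℝ) ≠ 0 := by
    exact_mod_cast Nat.card_pos.ne'
  rw [hc, mul_inv_cancel₀ hpos, one_mul]

theorem marginalEntropy_nonneg {I : Type*} (κ : ProbabilityMeasure (I → ZMod 2)) (B : Set I) :
    0 ≤ marginalEntropy κ B := by
  refine tsum_nonneg fun a => Real.negMulLog_nonneg measureReal_nonneg ?_
  have : IsProbabilityMeasure ((κ : Measure (I → ZMod 2)).map (fun x (i : B) => x i)) :=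
    Measure.isProbabilityMeasure_map (measurable_restr B).aemeasurable
  exact measureReal_le_one

variable {d k : ℕ}

theorem haarX_apply (s : Set (Gam d k → ZMod 2)) (hs : MeasurableSet s) :
    (haarX d k : Measure (Gam d k → ZMod 2)) s =
      Measure.addHaarMeasure (⊤ : TopologicalSpace.PositiveCompacts (X d k))
        (Subtype.val ⁻¹' s) :=
  Measure.map_apply measurable_subtype_coe hs

theorem haarX_invariant (h : Gam d k → ZMod 2) (hh : h ∈ X d k) (s : Set (Gam d k → ZMod 2))
    (hs : MeasurableSet s) :
    (haarX d k : Measure (Gam d k → ZMod 2)) ((fun x => x + h) ⁻¹' s) =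
      (haarX d k : Measure (Gam d k → ZMod 2)) s := by
  have hm : Measurable fun x : Gam d k → ZMod 2 => x + h :=
    measurable_pi_lambda _ fun g => (measurable_of_countable fun a => a + h g).comp
      (measurable_pi_apply g)
  rw [haarX_apply _ (hm hs), haarX_apply _ hs]
  exact measure_preimage_add_right (Measure.addHaarMeasure
    (⊤ : TopologicalSpace.PositiveCompacts (X d k))) ⟨h, hh⟩ (Subtype.val ⁻¹' s)

theorem haarX_eq_one (s : Set (Gam d k → ZMod 2)) (hs : MeasurableSet s)
    (hX : (X d k : Set (Gam d k → ZMod 2)) ⊆ s) :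
    (haarX d k : Measure (Gam d k → ZMod 2)) s = 1 := by
  rw [haarX_apply _ hs]
  have : (Subtype.val ⁻¹' s : Set (X d k)) = Set.univ := by
    ext x; simpa using hX x.2
  rw [this]
  exact Measure.addHaarMeasure_self (K₀ := (⊤ : TopologicalSpace.PositiveCompacts (X d k)))

theorem codeMeasure_apply {V : Type*} [Finite V] (σ : Gam d k →* Equiv.Perm V)
    (s : Set (V → ZMod 2)) : (codeMeasure σ : Measure (V → ZMod 2)) s =
      (Measure.count (code σ : Set (V → ZMod 2)))⁻¹ *
        Measure.count ((code σ : Set (V → ZMod 2)) ∩ s) := by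
  change ProbabilityTheory.uniformOn _ s = _
  rw [ProbabilityTheory.uniformOn, ProbabilityTheory.cond_apply (Set.toFinite _).measurableSet]

theorem codeMeasure_invariant {V : Type*} [Finite V] (σ : Gam d k →* Equiv.Perm V)
    (h : V → ZMod 2) (hh : h ∈ (code σ).toAddSubgroup) (s : Set (V → ZMod 2))
    (_ : MeasurableSet s) :
    (codeMeasure σ : Measure (V → ZMod 2)) ((fun x => x + h) ⁻¹' s) =
      (codeMeasure σ : Measure (V → ZMod 2)) s := by
  rw [codeMeasure_apply, codeMeasure_apply]
  congr 1
  have h1 : (code σ : Set (V → ZMod 2)) ∩ (fun x => x + h) ⁻¹' s =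
      (fun x => x + h) ⁻¹' ((code σ : Set (V → ZMod 2)) ∩ s) := by
    ext x
    have : x + h ∈ code σ ↔ x ∈ code σ := (code σ).add_mem_iff_left hh
    simp [this]
  rw [h1]
  have h2 := Measure.count_apply_finite ((fun x => x + h) ⁻¹' ((code σ : Set (V → ZMod 2)) ∩ s))
    (Set.toFinite _)
  rw [h2, Measure.count_apply_finite _ (Set.toFinite _)]
  congr 1
  rw [← Set.ncard_eq_toFinset_card, ← Set.ncard_eq_toFinset_card]
  refine Set.ncard_preimage_of_injective_subset_range (add_left_injective h) fun y _ => ?_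
  exact ⟨y - h, by simp⟩

theorem codeMeasure_eq_one {V : Type*} [Finite V] (σ : Gam d k →* Equiv.Perm V)
    (s : Set (V → ZMod 2)) (_ : MeasurableSet s)
    (hs : ((code σ).toAddSubgroup : Set (V → ZMod 2)) ⊆ s) :
    (codeMeasure σ : Measure (V → ZMod 2)) s = 1 := by
  have hs' : (code σ : Set (V → ZMod 2)) ⊆ s := hs
  rw [codeMeasure_apply, Set.inter_eq_left.2 hs', ENNReal.inv_mul_cancel]
  · rw [Ne, Measure.count_eq_zero_iff]
    exact (Set.nonempty_iff_ne_empty.1 ⟨0, (code σ).zero_mem⟩)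
  · exact (Measure.count_apply_lt_top.2 (Set.toFinite _)).ne

end Invariant

/-! ### Cylinder neighbourhoods in the weak topology -/

section Weak

variable {d k : ℕ}

theorem mem_wordBall_sylLen [NeZero k] (g : Gam d k) : g ∈ wordBall (gens d k) (sylLen g) := by
  rw [wordBall_eq]; exact le_refl (sylLen g)

instance finite_wordBall' (r : ℕ) : Finite (wordBall (gens d k) r) := finite_wordBall r

theorem measureReal_restr_preimage {I : Type*} (B : Set I) [Finite B]
    (ν : ProbabilityMeasure (I → ZMod 2)) (T : Finset (B → ZMod 2)) :
    (ν : Measure (I → ZMod 2)).real (restr B ⁻¹' T) =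
      ∑ q ∈ T, (ν : Measure (I → ZMod 2)).real (restr B ⁻¹' {q}) := by
  rw [← measureReal_biUnion_finset (fun q _ q' _ hne => Set.disjoint_left.2 fun x hx hx' =>
      hne (hx.symm.trans hx')) (fun q _ => measurableSet_restr B q)]
  congr 1
  ext x
  simp

/-- A weak neighbourhood of `μ` contains all measures whose marginal on some ball is close to
that of `μ`. -/
theorem exists_cylinder_nhds [NeZero k] (μ : ProbabilityMeasure (Gam d k → ZMod 2))
    {O : Set (ProbabilityMeasure (Gam d k → ZMod 2))} (hO : IsOpen O) (hμ : μ ∈ O) :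
    ∃ (r : ℕ) (ε : ℝ), 0 < ε ∧ ∀ ν : ProbabilityMeasure (Gam d k → ZMod 2),
      (∀ p : wordBall (gens d k) r → ZMod 2,
        |(ν : Measure (Gam d k → ZMod 2)).real (restr _ ⁻¹' {p}) -
          (μ : Measure (Gam d k → ZMod 2)).real (restr _ ⁻¹' {p})| < ε) → ν ∈ O := by
  classical
  by_contra hcon
  push Not at hcon
  let M : ℕ → ℝ := fun r => Nat.card (wordBall (gens d k) r → ZMod 2)
  have hM : ∀ r, 0 < M r := fun r => by
    simp only [M]; exact_mod_cast Nat.card_pos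
  -- measures outside `O` whose marginals on all balls converge to those of `μ`; the factor `M r`
  -- allows for summing over all patterns
  choose ν hν hνO using fun r : ℕ => hcon r (1 / ((r + 1) * M r)) (by have := hM r; positivity)
  let cyl : ∀ r : ℕ, (wordBall (gens d k) r → ZMod 2) → Set (Gam d k → ZMod 2) :=
    fun r p => restr _ ⁻¹' {p}
  let S : Set (Set (Gam d k → ZMod 2)) := {s | ∃ r p, s = cyl r p}
  have hmem : ∀ r p x, x ∈ cyl r p ↔ ∀ g : wordBall (gens d k) r, x g = p g := by
    intro r p x
    exact funext_iff
  have hsub : ∀ r r' p p', r ≤ r' → (cyl r p ∩ cyl r' p').Nonempty → cyl r' p' ⊆ cyl r p := by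
    rintro r r' p p' hr ⟨y, hy, hy'⟩ x hx
    rw [hmem] at *
    intro g
    have hg : g.1 ∈ wordBall (gens d k) r' := wordBall_mono hr g.2
    rw [← hy g, hx ⟨g, hg⟩, ← hy' ⟨g, hg⟩]
  have hpi : IsPiSystem S := by
    rintro _ ⟨r, p, rfl⟩ _ ⟨r', p', rfl⟩ hne
    rcases le_total r r' with h | h
    · exact ⟨r', p', Set.inter_eq_right.2 (hsub r r' p p' h hne)⟩
    · rw [Set.inter_comm] at hne ⊢
      exact ⟨r, p, Set.inter_eq_right.2 (hsub r' r p' p h hne)⟩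
  have hopen : ∀ r p, IsOpen (cyl r p) := by
    intro r p
    have : Continuous (restr (wordBall (gens d k) r)) :=
      continuous_pi fun g => continuous_apply _
    exact (isOpen_discrete {p}).preimage this
  have htend : Tendsto ν atTop (𝓝 μ) := by
    refine hpi.tendsto_probabilityMeasure_of_tendsto_of_mem ?_ ?_ ?_
    · rintro _ ⟨r, p, rfl⟩
      exact (hopen r p).measurableSet
    · intro u hu x hx
      obtain ⟨I, w, hw, hIw⟩ := isOpen_pi_iff.1 hu x hx
      refine ⟨cyl (I.sup sylLen) (restr _ x), ⟨_, _, rfl⟩, (hopen _ _).mem_nhds rfl, ?_⟩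
      intro y hy
      refine hIw fun g hg => ?_
      have hg' : g ∈ wordBall (gens d k) (I.sup sylLen) :=
        wordBall_mono (Finset.le_sup (f := sylLen) hg) (mem_wordBall_sylLen g)
      rw [(hmem _ _ _).1 hy ⟨g, hg'⟩]
      exact (hw g hg).2
    · rintro _ ⟨r, p, rfl⟩
      have hreal : Tendsto (fun r' => (ν r' : Measure (Gam d k → ZMod 2)).real (cyl r p)) atTop
          (𝓝 ((μ : Measure (Gam d k → ZMod 2)).real (cyl r p))) := by
        rw [tendsto_iff_dist_tendsto_zero]
        refine squeeze_zero' (Eventually.of_forall fun _ => dist_nonneg) ?_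
          tendsto_one_div_add_atTop_nhds_zero_nat
        filter_upwards [eventually_ge_atTop r] with r' hr'
        have : Fintype (wordBall (gens d k) r') := Fintype.ofFinite _
        let T : Finset (wordBall (gens d k) r' → ZMod 2) :=
          Finset.univ.filter fun q => ∀ g : wordBall (gens d k) r,
            q ⟨g, wordBall_mono hr' g.2⟩ = p g
        have hT : cyl r p = restr (wordBall (gens d k) r') ⁻¹' T := by
          ext x
          rw [hmem]
          simp only [T, Set.mem_preimage, Finset.mem_coe, Finset.mem_filter, Finset.mem_univ,
            true_and]
          rfl
        rw [hT, measureReal_restr_preimage, measureReal_restr_preimage, Real.dist_eq,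
          ← Finset.sum_sub_distrib]
        have hM' := hM r'
        calc _ ≤ ∑ q ∈ T, |(ν r' : Measure (Gam d k → ZMod 2)).real (restr _ ⁻¹' {q}) -
              (μ : Measure (Gam d k → ZMod 2)).real (restr _ ⁻¹' {q})| :=
              Finset.abs_sum_le_sum_abs _ _
          _ ≤ ∑ q ∈ T, 1 / (((r' : ℝ) + 1) * M r') := Finset.sum_le_sum fun q _ => (hν r' q).le
          _ ≤ M r' * (1 / (((r' : ℝ) + 1) * M r')) := by
              rw [Finset.sum_const, nsmul_eq_mul]
              have h1 : (T.card : ℝ) ≤ M r' := by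
                simp only [M]
                rw [Nat.card_eq_fintype_card]
                exact_mod_cast Finset.card_le_univ T
              gcongr
          _ = 1 / ((r' : ℝ) + 1) := by field_simp
      rw [← NNReal.tendsto_coe]
      exact hreal
  have := htend.eventually (hO.mem_nhds hμ)
  obtain ⟨r, hr⟩ := this.exists
  exact hνO r hr

end Weak

/-! ### Marginals of the code measure on separated balls -/

section Marginals

variable {d k n : ℕ}

/-- The constants of the typicality conditions satisfy the inequalities used throughout. -/
structure AdmissibleConstants (d : ℕ) (δ η η' : ℝ) : Prop where
  δ_pos : 0 < δ
  η_pos : 0 < η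
  η_lt : η < 1 / 2
  η'_pos : 0 < η'
  η'_le : η' ≤ δ
  d_mul_le : d * η' ≤ 1 / 2

/-- The patterns of the parity check subshift on the ball of radius `r`. -/
def patterns (d k r : ℕ) : AddSubgroup (wordBall (gens d k) r → ZMod 2) :=
  (X d k).map (restr (wordBall (gens d k) r))

/-- The pattern of `z` on the ball of radius `r` around `v`. -/
def ballHom {V : Type*} (σ : Gam d k →* Equiv.Perm V) (r : ℕ) (v : V) :
    (V → ZMod 2) →+ (wordBall (gens d k) r → ZMod 2) where
  toFun z := restr _ (pullback (fun g => σ g) v z)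
  map_zero' := rfl
  map_add' _ _ := rfl

theorem ballHom_mem_patterns {V : Type*} {σ : Gam d k →* Equiv.Perm V} (r : ℕ) (v : V)
    {z : V → ZMod 2} (hz : z ∈ code σ) : ballHom σ r v z ∈ patterns d k r :=
  ⟨_, pullback_mem_X hz v, rfl⟩

/-- The patterns on the balls around the points of a separated set can be prescribed
independently. -/
theorem IsTypical.exists_ballHom_eq {δ η η' : ℝ} (hc : AdmissibleConstants d δ η η') (hd : 0 < d)
    (hdk : d ≤ k) (hn : 0 < n) {σ : UnifHom d k (Fin n)} (hσ : IsTypical δ η η' σ) {r : ℕ}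
    {S : Finset (Fin n)} (hS : IsSeparated σ.1 r S)
    (hSη : (S.card * (wordBall (gens d k) r).ncard : ℝ) ≤ η * n)
    (p : Fin n → patterns d k r) :
    ∃ z ∈ code σ.1, ∀ s ∈ S, ballHom σ.1 r s z = p s := by
  have : NeZero k := ⟨by omega⟩
  choose x hx hxp using fun s => (p s).2
  obtain ⟨z, hz, hzx⟩ := hσ.exists_codeword hn hd hdk hc.η_lt hc.η'_pos.le hc.η'_le hc.d_mul_le
    hS hSη x hx
  refine ⟨z, hz, fun s hs => ?_⟩
  rw [← hxp s]
  funext g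
  change z (σ.1 (g : Gam d k)⁻¹ s) = x s g
  rw [hzx s hs _ (inv_mem_wordBall g.2), inv_inv]

theorem haarX_real_restr (r : ℕ) :
    (∀ p ∈ patterns d k r, (haarX d k : Measure (Gam d k → ZMod 2)).real (restr _ ⁻¹' {p}) =
      (Nat.card (patterns d k r) : ℝ)⁻¹) ∧
    ∀ p ∉ patterns d k r,
      (haarX d k : Measure (Gam d k → ZMod 2)).real (restr _ ⁻¹' {p}) = 0 :=
  measureReal_preimage_singleton _ (X d k) haarX_invariant haarX_eq_one
    (restr (wordBall (gens d k) r)) (measurableSet_restr _)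

/-- The marginal of the code measure on one separated ball agrees with that of the Haar measure. -/
theorem IsTypical.codeMeasure_real_ballHom {δ η η' : ℝ} (hc : AdmissibleConstants d δ η η')
    (hd : 0 < d) (hdk : d ≤ k) (hn : 0 < n) {σ : UnifHom d k (Fin n)} (hσ : IsTypical δ η η' σ)
    {r : ℕ} {v : Fin n} (hv : IsSeparated σ.1 r {v})
    (hη : ((wordBall (gens d k) r).ncard : ℝ) ≤ η * n) (p : wordBall (gens d k) r → ZMod 2) :
    (codeMeasure σ.1 : Measure (Fin n → ZMod 2)).real (ballHom σ.1 r v ⁻¹' {p}) =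
      (haarX d k : Measure (Gam d k → ZMod 2)).real (restr _ ⁻¹' {p}) := by
  have himage : (code σ.1).toAddSubgroup.map (ballHom σ.1 r v) = patterns d k r := by
    ext q
    constructor
    · rintro ⟨z, hz, rfl⟩
      exact ballHom_mem_patterns r v hz
    · intro hq
      obtain ⟨z, hz, hzq⟩ := hσ.exists_ballHom_eq hc hd hdk hn hv (by simpa using hη)
        (fun _ => ⟨q, hq⟩)
      exact ⟨z, hz, hzq v (Finset.mem_singleton_self v)⟩
  obtain ⟨h1, h0⟩ := measureReal_preimage_singleton (codeMeasure σ.1 : Measure (Fin n → ZMod 2))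
    (code σ.1).toAddSubgroup (codeMeasure_invariant σ.1) (codeMeasure_eq_one σ.1)
    (ballHom σ.1 r v) (fun q => (Set.toFinite _).measurableSet)
  rw [himage] at h1 h0
  by_cases hp : p ∈ patterns d k r
  · rw [h1 p hp, (haarX_real_restr r).1 p hp]
  · rw [h0 p hp, (haarX_real_restr r).2 p hp]

/-- On two separated balls the patterns of a random codeword are independent. -/
theorem IsTypical.codeMeasure_real_ballHom_inter {δ η η' : ℝ}
    (hc : AdmissibleConstants d δ η η') (hd : 0 < d) (hdk : d ≤ k) (hn : 0 < n)
    {σ : UnifHom d k (Fin n)} (hσ : IsTypical δ η η' σ) {r : ℕ} {v w : Fin n} (hvw : v ≠ w)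
    (hS : IsSeparated σ.1 r {v, w})
    (hη : (2 * (wordBall (gens d k) r).ncard : ℝ) ≤ η * n) (p : wordBall (gens d k) r → ZMod 2) :
    (codeMeasure σ.1 : Measure (Fin n → ZMod 2)).real
      (ballHom σ.1 r v ⁻¹' {p} ∩ ballHom σ.1 r w ⁻¹' {p}) =
      (haarX d k : Measure (Gam d k → ZMod 2)).real (restr _ ⁻¹' {p}) ^ 2 := by
  classical
  set φ := (ballHom σ.1 r v).prod (ballHom σ.1 r w) with hφ
  have himage : (code σ.1).toAddSubgroup.map φ = (patterns d k r).prod (patterns d k r) := by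
    ext q
    constructor
    · rintro ⟨z, hz, rfl⟩
      exact ⟨ballHom_mem_patterns r v hz, ballHom_mem_patterns r w hz⟩
    · rintro ⟨hq1, hq2⟩
      obtain ⟨z, hz, hzq⟩ := hσ.exists_ballHom_eq hc hd hdk hn hS
        (by rw [Finset.card_pair hvw]; exact_mod_cast hη)
        (fun u => if u = v then ⟨q.1, hq1⟩ else ⟨q.2, hq2⟩)
      refine ⟨z, hz, Prod.ext ?_ ?_⟩
      · have := hzq v (by simp)
        rwa [if_pos rfl] at this
      · have := hzq w (by simp)
        rwa [if_neg hvw.symm] at this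
  obtain ⟨h1, h0⟩ := measureReal_preimage_singleton (codeMeasure σ.1 : Measure (Fin n → ZMod 2))
    (code σ.1).toAddSubgroup (codeMeasure_invariant σ.1) (codeMeasure_eq_one σ.1)
    φ (fun q => (Set.toFinite _).measurableSet)
  rw [himage] at h1 h0
  have hset : ballHom σ.1 r v ⁻¹' {p} ∩ ballHom σ.1 r w ⁻¹' {p} = φ ⁻¹' {(p, p)} := by
    ext z
    simp [hφ, Prod.ext_iff]
  rw [hset]
  by_cases hp : p ∈ patterns d k r
  · rw [h1 (p, p) ⟨hp, hp⟩, (haarX_real_restr r).1 p hp]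
    have : Nat.card ((patterns d k r).prod (patterns d k r)) = Nat.card (patterns d k r) ^ 2 := by
      rw [Nat.card_congr (AddSubgroup.prodEquiv _ _).toEquiv, Nat.card_prod, sq]
    rw [this]
    push_cast
    rw [inv_pow]
  · rw [h0 (p, p) (fun h => hp h.1), (haarX_real_restr r).2 p hp]
    norm_num

theorem marginalEntropy_haarX (r : ℕ) :
    marginalEntropy (haarX d k) (wordBall (gens d k) r) =
      Real.log (Nat.card (patterns d k r)) :=
  marginalEntropy_eq _ (X d k) haarX_invariant haarX_eq_one _

/-- The entropy of the code measure on the union of separated balls. -/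
theorem IsTypical.le_marginalEntropy {δ η η' : ℝ} (hc : AdmissibleConstants d δ η η') (hd : 0 < d)
    (hdk : d ≤ k) (hn : 0 < n) {σ : UnifHom d k (Fin n)} (hσ : IsTypical δ η η' σ) {r : ℕ}
    {S : Finset (Fin n)} (hS : IsSeparated σ.1 r S)
    (hSη : (S.card * (wordBall (gens d k) r).ncard : ℝ) ≤ η * n) :
    (S.card : ℝ) * marginalEntropy (haarX d k) (wordBall (gens d k) r) ≤
      marginalEntropy (codeMeasure σ.1)
        (spread (fun g => σ.1 g) (wordBall (gens d k) r) (S : Set (Fin n))) := by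
  classical
  have : NeZero k := ⟨by omega⟩
  set Y := spread (fun g => σ.1 g) (wordBall (gens d k) r) (S : Set (Fin n)) with hY
  rw [marginalEntropy_haarX, marginalEntropy_eq (codeMeasure σ.1) (code σ.1).toAddSubgroup
    (codeMeasure_invariant σ.1) (codeMeasure_eq_one σ.1) Y, ← Real.log_pow]
  have hpos : 0 < Nat.card (patterns d k r) := Nat.card_pos
  refine Real.log_le_log (by positivity) ?_
  have hcard : Nat.card (S → patterns d k r) = Nat.card (patterns d k r) ^ S.card := by
    rw [Nat.card_fun]; simp
  rw [← Nat.cast_pow, ← hcard]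
  refine Nat.cast_le.2 ?_
  choose z hz hzp using fun p : S → patterns d k r =>
    hσ.exists_ballHom_eq hc hd hdk hn hS hSη (fun v => if h : v ∈ S then p ⟨v, h⟩ else 0)
  refine Nat.card_le_card_of_injective (fun p => (⟨restr Y (z p), z p, hz p, rfl⟩ :
    (code σ.1).toAddSubgroup.map (restr Y))) fun p q hpq => ?_
  have hpq' : restr Y (z p) = restr Y (z q) := congrArg Subtype.val hpq
  funext s
  have h1 := hzp p s s.2
  have h2 := hzp q s s.2
  rw [dif_pos s.2] at h1 h2
  apply Subtype.ext
  rw [← h1, ← h2]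
  funext g
  have hg : σ.1 (g : Gam d k)⁻¹ s ∈ Y := ⟨_, inv_mem_wordBall g.2, s, s.2, rfl⟩
  exact congrFun hpq' ⟨_, hg⟩

end Marginals

/-! ### Most points have injective balls -/

section Good

variable {d k n : ℕ}

open Classical in
/-- The points that are not fixed by any nontrivial element of length at most `2 r + 1`. -/
noncomputable def goodPoints (σ : UnifHom d k (Fin n)) (r : ℕ) : Finset (Fin n) :=
  Finset.univ.filter fun v => ∀ g ∈ wordBall (gens d k) (2 * r + 1), σ.1 g v = v → g = 1

theorem mem_goodPoints {σ : UnifHom d k (Fin n)} {r : ℕ} {v : Fin n} : v ∈ goodPoints σ r ↔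
    ∀ g ∈ wordBall (gens d k) (2 * r + 1), σ.1 g v = v → g = 1 := by
  simp [goodPoints]

theorem isSeparated_singleton {σ : UnifHom d k (Fin n)} {r : ℕ} {v : Fin n}
    (hv : v ∈ goodPoints σ r) : IsSeparated σ.1 r {v} := by
  intro s hs s' hs' g hg h
  rw [Finset.mem_singleton] at hs hs'
  subst hs hs'
  exact ⟨rfl, mem_goodPoints.1 hv g hg h⟩

/-- A good point outside the enlarged balls around a separated set can be added to that set. -/
theorem isSeparated_insert [NeZero k] {σ : UnifHom d k (Fin n)} {r : ℕ} {v : Fin n}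
    {S : Finset (Fin n)} (hv : v ∈ goodPoints σ r) (hS : IsSeparated σ.1 r S)
    (hvS : ∀ s ∈ S, ∀ g ∈ wordBall (gens d k) (2 * r + 1), σ.1 g s ≠ v) :
    IsSeparated σ.1 r (insert v S) := by
  intro s hs s' hs' g hg h
  rcases Finset.mem_insert.1 hs with hsv | hsS
  · rcases Finset.mem_insert.1 hs' with hsv' | hsS'
    · rw [hsv, hsv'] at h
      exact ⟨hsv.trans hsv'.symm, mem_goodPoints.1 hv g hg h⟩
    · refine absurd ?_ (hvS s' hsS' g⁻¹ (inv_mem_wordBall hg))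
      rw [← h, hsv, ← Equiv.Perm.mul_apply, ← map_mul, inv_mul_cancel, map_one,
        Equiv.Perm.one_apply]
  · rcases Finset.mem_insert.1 hs' with hsv' | hsS'
    · exact absurd (h.trans hsv') (hvS s hsS g hg)
    · exact hS s hsS s' hsS' g hg h

theorem tendsto_compl_goodPoints (hk : 0 < k) {δ η η' : ℝ}
    {σ : ∀ n : Size k, UnifHom d k (Fin n.1)}
    (hσ : ∀ᶠ n in atTop, IsTypical δ η η' (σ n)) (r : ℕ) :
    Tendsto (fun n : Size k => ((goodPoints (σ n) r)ᶜ.card : ℝ) / n.1) atTop (𝓝 0) := by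
  classical
  have : NeZero k := ⟨hk.ne'⟩
  let B : Finset (Gam d k) := (finite_wordBall (d := d) (k := k) (2 * r + 1)).toFinset.erase 1
  have hsum : Tendsto (fun n : Size k => ∑ g ∈ B,
      (Set.ncard {v | (σ n).1 g v = v} : ℝ) / n.1) atTop (𝓝 0) := by
    simpa using tendsto_finsetSum B fun g hg => tendsto_fixed hk hσ (Finset.ne_of_mem_erase hg)
  refine squeeze_zero (fun n => by positivity) (fun n => ?_) hsum
  rw [← Finset.sum_div]
  gcongr
  have h1 : (goodPoints (σ n) r)ᶜ ⊆ B.biUnion fun g =>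
      Finset.univ.filter fun v => (σ n).1 g v = v := by
    intro v hv
    rw [Finset.mem_compl, mem_goodPoints] at hv
    push Not at hv
    obtain ⟨g, hg, hgv, hg1⟩ := hv
    refine Finset.mem_biUnion.2 ⟨g, Finset.mem_erase.2 ⟨hg1, ?_⟩, by simpa using hgv⟩
    exact (Set.Finite.mem_toFinset _).2 hg
  have h2 := (Finset.card_le_card h1).trans Finset.card_biUnion_le
  refine le_trans (Nat.cast_le.2 h2) ?_
  push_cast
  refine Finset.sum_le_sum fun g _ => ?_
  rw [Set.ncard_eq_toFinset_card']
  simp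

/-- A greedy choice of separated points. -/
theorem exists_isSeparated [NeZero k] (σ : UnifHom d k (Fin n)) (r t : ℕ)
    (ht : t * (wordBall (gens d k) (2 * r + 1)).ncard ≤ (goodPoints σ r).card) :
    ∃ S : Finset (Fin n), S.card = t ∧ IsSeparated σ.1 r S := by
  classical
  induction t with
  | zero => exact ⟨∅, rfl, fun s hs => by simp at hs⟩
  | succ t ih =>
    obtain ⟨S, hSt, hS⟩ := ih (le_trans (Nat.mul_le_mul_right _ t.le_succ) ht)
    let B : Finset (Gam d k) := (finite_wordBall (d := d) (k := k) (2 * r + 1)).toFinset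
    have hB : B.card = (wordBall (gens d k) (2 * r + 1)).ncard :=
      (Set.ncard_eq_toFinset_card _ (finite_wordBall _)).symm
    have hB1 : (1 : Gam d k) ∈ B := (Set.Finite.mem_toFinset _).2 (one_mem_wordBall _)
    let Z : Finset (Fin n) := (S ×ˢ B).image fun p => σ.1 p.2 p.1
    have hZ : Z.card < (goodPoints σ r).card := by
      have h1 : Z.card ≤ t * B.card :=
        Finset.card_image_le.trans (by rw [Finset.card_product, hSt])
      have h2 : 0 < B.card := Finset.card_pos.2 ⟨1, hB1⟩
      rw [← hB, Nat.succ_mul] at ht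
      omega
    obtain ⟨v, hv, hvZ⟩ := Finset.exists_mem_notMem_of_card_lt_card hZ
    have hvS : ∀ s ∈ S, ∀ g ∈ wordBall (gens d k) (2 * r + 1), σ.1 g s ≠ v := by
      rintro s hs g hg rfl
      exact hvZ (Finset.mem_image.2 ⟨(s, g), Finset.mem_product.2
        ⟨hs, (Set.Finite.mem_toFinset _).2 hg⟩, rfl⟩)
    have hvS' : v ∉ S := fun h => hvS v h 1 (one_mem_wordBall _) (by simp)
    exact ⟨insert v S, by rw [Finset.card_insert_of_notMem hvS', hSt],
      isSeparated_insert hv hS hvS⟩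

end Good

/-! ### Local and empirical convergence -/

section Convergence

variable {d k n : ℕ}

theorem empirical_real {Γ V : Type*} [Group Γ] [Fintype V] [Nonempty V] [DecidableEq V]
    (σ : Γ → Equiv.Perm V) (x : V → ZMod 2) {s : Set (Γ → ZMod 2)} (hs : MeasurableSet s)
    [DecidablePred fun v => pullback σ v x ∈ s] :
    (empirical σ x : Measure (Γ → ZMod 2)).real s =
      ((Finset.univ.filter fun v => pullback σ v x ∈ s).card : ℝ) / Fintype.card V := by
  have h : (empirical σ x : Measure (Γ → ZMod 2)) =
      (Fintype.card V : ENNReal)⁻¹ • ∑ v : V, Measure.dirac (pullback σ v x) := rfl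
  rw [h, measureReal_def, Measure.smul_apply, Measure.coe_finsetSum, Finset.sum_apply]
  simp only [Measure.dirac_apply' _ hs, Set.indicator_apply, Pi.one_apply, smul_eq_mul,
    Finset.sum_boole, ENNReal.toReal_mul, ENNReal.toReal_inv, ENNReal.toReal_natCast]
  rw [inv_mul_eq_div]

/-- Chebyshev's inequality for the number of events that occur, when most pairs of events are
independent with a common probability. -/
theorem measureReal_abs_sub_ge_le {E : Type*} [Finite E] [MeasurableSpace E]
    [MeasurableSingletonClass E] (m : Measure E) [IsProbabilityMeasure m] {V : Type*} [Fintype V]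
    [Nonempty V] [DecidableEq V] (S : V → Set E) [∀ v z, Decidable (z ∈ S v)] {c : ℝ}
    (hc0 : 0 ≤ c) (hc1 : c ≤ 1) (bad : Finset (V × V))
    (hgood : ∀ v w, (v, w) ∉ bad → m.real (S v) = c ∧ m.real (S w) = c ∧
      m.real (S v ∩ S w) = c ^ 2) {ε : ℝ} (hε : 0 < ε) :
    m.real {z | ε ≤ |((Finset.univ.filter fun v => z ∈ S v).card : ℝ) / Fintype.card V - c|} ≤
      bad.card / (ε * Fintype.card V) ^ 2 := by
  classical
  have hN : (0 : ℝ) < Fintype.card V := by exact_mod_cast Fintype.card_pos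
  have hm : ∀ s : Set E, MeasurableSet s := fun s => (Set.toFinite s).measurableSet
  have hint : ∀ f : E → ℝ, Integrable f m := fun f => Integrable.of_finite
  let e : V → E → ℝ := fun v z => (S v).indicator 1 z - c
  have hsum : ∀ z, ∑ v, e v z =
      ((Finset.univ.filter fun v => z ∈ S v).card : ℝ) - Fintype.card V * c := by
    intro z
    simp [e, Finset.sum_sub_distrib, Set.indicator_apply, Finset.card_univ]
  have hpair : ∀ v w, ∫ z, e v z * e w z ∂m ≤ if (v, w) ∈ bad then 1 else 0 := by
    intro v w
    split_ifs with h
    · have habs : ∀ v z, |e v z| ≤ 1 := by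
        intro v z
        by_cases hz : z ∈ S v
        · simp only [e, Set.indicator_of_mem hz, Pi.one_apply]
          rw [abs_le]; constructor <;> linarith
        · simp only [e, Set.indicator_of_notMem hz]
          rw [abs_le]; constructor <;> linarith
      calc ∫ z, e v z * e w z ∂m ≤ ∫ _z, (1 : ℝ) ∂m := by
            refine integral_mono (hint _) (hint _) fun z => ?_
            refine (le_abs_self _).trans ?_
            rw [abs_mul]
            exact mul_le_one₀ (habs v z) (abs_nonneg _) (habs w z)
        _ = 1 := by simp
    · obtain ⟨h1, h2, h3⟩ := hgood v w h
      have hexp : ∀ z, e v z * e w z = (S v ∩ S w).indicator 1 z - c * (S v).indicator 1 z -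
          c * (S w).indicator 1 z + c ^ 2 := by
        intro z
        rw [Set.inter_indicator_one]
        simp only [e, Pi.mul_apply]
        ring
      simp only [hexp]
      rw [integral_add (hint _) (hint _), integral_sub (hint _) (hint _),
        integral_sub (hint _) (hint _), integral_const_mul, integral_const_mul,
        integral_indicator_one (hm _), integral_indicator_one (hm _),
        integral_indicator_one (hm _), h1, h2, h3, integral_const, probReal_univ]
      simp only [smul_eq_mul]
      nlinarith
  have hsq : ∫ z, (∑ v, e v z) ^ 2 ∂m ≤ bad.card := by
    have h1 : ∀ z, (∑ v, e v z) ^ 2 = ∑ v, ∑ w, e v z * e w z := by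
      intro z
      rw [sq, Finset.sum_mul_sum]
    simp only [h1]
    rw [integral_finsetSum _ fun v _ => hint _]
    calc ∑ v, ∫ z, ∑ w, e v z * e w z ∂m = ∑ v, ∑ w, ∫ z, e v z * e w z ∂m :=
          Finset.sum_congr rfl fun v _ => integral_finsetSum _ fun w _ => hint _
      _ ≤ ∑ v, ∑ w, if (v, w) ∈ bad then (1 : ℝ) else 0 :=
          Finset.sum_le_sum fun v _ => Finset.sum_le_sum fun w _ => hpair v w
      _ = bad.card := by
          rw [← Fintype.sum_prod_type' (f := fun v w => if (v, w) ∈ bad then (1 : ℝ) else 0)]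
          simp
  have hmarkov := mul_meas_ge_le_integral_of_nonneg (μ := m)
    (f := fun z => (∑ v, e v z) ^ 2) (Eventually.of_forall fun z => sq_nonneg _) (hint _)
    ((ε * Fintype.card V) ^ 2)
  have hpos : 0 < (ε * Fintype.card V : ℝ) ^ 2 := by positivity
  rw [le_div_iff₀ hpos, mul_comm]
  refine le_trans (le_of_eq ?_) (hmarkov.trans hsq)
  congr 2
  ext z
  simp only [Set.mem_ofPred_eq]
  rw [hsum, ← abs_of_pos (mul_pos hε hN), sq_le_sq, abs_abs, abs_of_pos (mul_pos hε hN),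
    ← le_div_iff₀ hN, ← abs_of_pos hN, ← abs_div, abs_of_pos hN, sub_div,
    mul_div_cancel_left₀ _ hN.ne']

theorem localization_real (σ : UnifHom d k (Fin n)) (v : Fin n) (r : ℕ)
    (p : wordBall (gens d k) r → ZMod 2) [NeZero k] :
    (localization (fun g => σ.1 g) (codeMeasure σ.1) v : Measure (Gam d k → ZMod 2)).real
      (restr _ ⁻¹' {p}) =
      (codeMeasure σ.1 : Measure (Fin n → ZMod 2)).real (ballHom σ.1 r v ⁻¹' {p}) := by
  rw [localization, ProbabilityMeasure.toMeasure_map, measureReal_def, measureReal_def,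
    Measure.map_apply (measurable_pullback _ v) (measurableSet_restr _ p)]
  rfl

theorem eventually_le_mul (hk : 0 < k) (C : ℝ) {η : ℝ} (hη : 0 < η) :
    ∀ᶠ n : Size k in atTop, C ≤ η * n.1 := by
  have h := (tendsto_natCast_atTop_atTop (R := ℝ)).comp (tendsto_size (k := k) hk)
  exact (h.const_mul_atTop hη).eventually_ge_atTop C

theorem convergesLocally_of_isTypical {δ η η' : ℝ} (hc : AdmissibleConstants d δ η η')
    (hd : 0 < d) (hdk : d ≤ k) {σ : ∀ n : Size k, UnifHom d k (Fin n.1)}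
    (hσ : ∀ᶠ n in atTop, IsTypical δ η η' (σ n)) :
    ConvergesLocally (fun n g => (σ n).1 g) (fun n => codeMeasure (σ n).1) (haarX d k) := by
  intro O hO hμ
  have hk : 0 < k := by omega
  have : NeZero k := ⟨hk.ne'⟩
  obtain ⟨r, ε, hε, hν⟩ := exists_cylinder_nhds _ hO hμ
  have hlim : Tendsto (fun n : Size k => 1 - ((goodPoints (σ n) r)ᶜ.card : ℝ) / n.1) atTop
      (𝓝 1) := by
    simpa using (tendsto_compl_goodPoints hk hσ r).const_sub 1
  refine tendsto_of_tendsto_of_tendsto_of_le_of_le' hlim tendsto_const_nhds ?_ ?_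
  · filter_upwards [hσ, eventually_le_mul hk (wordBall (gens d k) r).ncard hc.η_pos] with n hn hnη
    have hn0 : (0 : ℝ) < n.1 := by exact_mod_cast n.2.1
    have hsub : (goodPoints (σ n) r : Set (Fin n.1)) ⊆
        {v | localization (fun g => (σ n).1 g) (codeMeasure (σ n).1) v ∈ O} := by
      intro v hv
      refine hν _ fun p => ?_
      rw [localization_real, hn.codeMeasure_real_ballHom hc hd hdk n.2.1
        (isSeparated_singleton hv) hnη, sub_self, abs_zero]
      exact hε
    have h1 := Set.ncard_le_ncard hsub (Set.toFinite _)
    rw [Set.ncard_coe_finset] at h1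
    have h2 := Finset.card_add_card_compl (goodPoints (σ n) r)
    rw [Fintype.card_fin] at h2
    have h3 : ((goodPoints (σ n) r).card : ℝ) + ((goodPoints (σ n) r)ᶜ.card : ℝ) = n.1 := by
      exact_mod_cast h2
    rw [Fintype.card_fin, le_div_iff₀ hn0, sub_mul, div_mul_cancel₀ _ hn0.ne', one_mul]
    refine le_trans ?_ (Nat.cast_le.2 h1)
    linarith
  · refine Eventually.of_forall fun n => ?_
    refine div_le_one_of_le₀ (Nat.cast_le.2 ?_) (by positivity)
    rw [← Nat.card_eq_fintype_card]
    exact Set.ncard_le_card _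

/-- The pairs of points whose balls of radius `r` may interact. -/
noncomputable def badPairs (σ : UnifHom d k (Fin n)) (r : ℕ) : Finset (Fin n × Fin n) := by
  classical
  exact Finset.univ.filter fun p => p.1 ∉ goodPoints σ r ∨ p.2 ∉ goodPoints σ r ∨
    ∃ g ∈ wordBall (gens d k) (2 * r + 1), σ.1 g p.2 = p.1

theorem mem_badPairs {σ : UnifHom d k (Fin n)} {r : ℕ} {v w : Fin n} : (v, w) ∈ badPairs σ r ↔
    v ∉ goodPoints σ r ∨ w ∉ goodPoints σ r ∨
      ∃ g ∈ wordBall (gens d k) (2 * r + 1), σ.1 g w = v := by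
  simp [badPairs]

theorem card_badPairs_le [NeZero k] (σ : UnifHom d k (Fin n)) (r : ℕ) :
    (badPairs σ r).card ≤ 2 * n * (goodPoints σ r)ᶜ.card +
      n * (wordBall (gens d k) (2 * r + 1)).ncard := by
  classical
  let B : Finset (Gam d k) := (finite_wordBall (d := d) (k := k) (2 * r + 1)).toFinset
  have hB : B.card = (wordBall (gens d k) (2 * r + 1)).ncard :=
    (Set.ncard_eq_toFinset_card _ (finite_wordBall _)).symm
  have hsub : badPairs σ r ⊆ ((goodPoints σ r)ᶜ ×ˢ Finset.univ ∪
      Finset.univ ×ˢ (goodPoints σ r)ᶜ) ∪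
      (Finset.univ ×ˢ B).image fun p => (σ.1 p.2 p.1, p.1) := by
    rintro ⟨v, w⟩ h
    rcases mem_badPairs.1 h with h | h | ⟨g, hg, rfl⟩
    · exact Finset.mem_union_left _ (Finset.mem_union_left _ (by simpa using h))
    · exact Finset.mem_union_left _ (Finset.mem_union_right _ (by simpa using h))
    · exact Finset.mem_union_right _ (Finset.mem_image.2 ⟨(w, g), Finset.mem_product.2
        ⟨Finset.mem_univ _, (Set.Finite.mem_toFinset _).2 hg⟩, rfl⟩)
  refine (Finset.card_le_card hsub).trans ((Finset.card_union_le _ _).trans ?_)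
  refine add_le_add ((Finset.card_union_le _ _).trans ?_) (Finset.card_image_le.trans ?_)
  · simp only [Finset.card_product, Finset.card_univ, Fintype.card_fin]
    exact le_of_eq (by ring)
  · rw [Finset.card_product, hB, Finset.card_univ, Fintype.card_fin]

theorem convergesEmpirically_of_isTypical {δ η η' : ℝ} (hc : AdmissibleConstants d δ η η')
    (hd : 0 < d) (hdk : d ≤ k) {σ : ∀ n : Size k, UnifHom d k (Fin n.1)}
    (hσ : ∀ᶠ n in atTop, IsTypical δ η η' (σ n)) :
    ConvergesEmpirically (fun n g => (σ n).1 g) (fun n => codeMeasure (σ n).1) (haarX d k) := by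
  classical
  intro O hO hμ
  have hk : 0 < k := by omega
  have : NeZero k := ⟨hk.ne'⟩
  obtain ⟨r, ε, hε, hν⟩ := exists_cylinder_nhds _ hO hμ
  have : Fintype (wordBall (gens d k) r) := Fintype.ofFinite _
  set M : ℝ := ((Fintype.card (wordBall (gens d k) r → ZMod 2) : ℕ) : ℝ) with hM
  set b : ℝ := ((wordBall (gens d k) (2 * r + 1)).ncard : ℝ) with hb
  have hlim : Tendsto (fun n : Size k => 1 - M / ε ^ 2 *
      (2 * (((goodPoints (σ n) r)ᶜ.card : ℝ) / n.1) + b * (n.1 : ℝ)⁻¹)) atTop (𝓝 1) := by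
    have h1 := (tendsto_compl_goodPoints hk hσ r).const_mul 2
    have h2 := ((tendsto_inv_atTop_zero.comp (tendsto_natCast_atTop_atTop (R := ℝ))).comp
      (tendsto_size (k := k) hk)).const_mul b
    simpa using ((h1.add h2).const_mul (M / ε ^ 2)).const_sub 1
  refine tendsto_of_tendsto_of_tendsto_of_le_of_le' hlim tendsto_const_nhds ?_ ?_
  · filter_upwards [hσ, eventually_le_mul hk (2 * (wordBall (gens d k) r).ncard) hc.η_pos]
      with n hn hnη
    have hn0 : (0 : ℝ) < n.1 := by exact_mod_cast n.2.1
    let m : Measure (Fin n.1 → ZMod 2) := codeMeasure (σ n).1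
    let c : (wordBall (gens d k) r → ZMod 2) → ℝ := fun p =>
      (haarX d k : Measure (Gam d k → ZMod 2)).real (restr _ ⁻¹' {p})
    let D : (wordBall (gens d k) r → ZMod 2) → Set (Fin n.1 → ZMod 2) := fun p =>
      {z | ε ≤ |((Finset.univ.filter fun v => z ∈ ballHom (σ n).1 r v ⁻¹' {p}).card : ℝ) /
        Fintype.card (Fin n.1) - c p|}
    have hD : ∀ p, m.real (D p) ≤ (badPairs (σ n) r).card / (ε * n.1) ^ 2 := by
      intro p
      have h := measureReal_abs_sub_ge_le m (fun v => ballHom (σ n).1 r v ⁻¹' {p}) (c := c p)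
        measureReal_nonneg measureReal_le_one (badPairs (σ n) r) ?_ hε
      · exact h.trans_eq (by rw [Fintype.card_fin])
      · intro v w hvw
        rw [mem_badPairs] at hvw
        push Not at hvw
        obtain ⟨hv, hw, hg⟩ := hvw
        have hη1 : ((wordBall (gens d k) r).ncard : ℝ) ≤ η * n.1 := by
          refine le_trans ?_ hnη
          have : (0 : ℝ) ≤ (wordBall (gens d k) r).ncard := by positivity
          linarith
        refine ⟨hn.codeMeasure_real_ballHom hc hd hdk n.2.1 (isSeparated_singleton hv) hη1 p,
          hn.codeMeasure_real_ballHom hc hd hdk n.2.1 (isSeparated_singleton hw) hη1 p,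
          hn.codeMeasure_real_ballHom_inter hc hd hdk n.2.1 ?_
            (isSeparated_insert hv (isSeparated_singleton hw) ?_) hnη p⟩
        · rintro rfl
          exact hg 1 (one_mem_wordBall _) (by simp)
        · intro s hs g hgB
          rw [Finset.mem_singleton] at hs
          exact hs ▸ hg g hgB
    have hsub : {z | empirical (fun g => (σ n).1 g) z ∈ O}ᶜ ⊆ ⋃ p ∈ Finset.univ, D p := by
      intro z hz
      by_contra hcon
      refine hz (hν _ fun p => ?_)
      rw [empirical_real _ _ (measurableSet_restr _ p)]
      by_contra hlt
      exact hcon (Set.mem_biUnion (Finset.mem_coe.2 (Finset.mem_univ p)) (not_lt.1 hlt))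
    have h1 : m.real {z | empirical (fun g => (σ n).1 g) z ∈ O}ᶜ ≤
        M * ((badPairs (σ n) r).card / (ε * n.1) ^ 2) := by
      refine (measureReal_mono hsub (measure_ne_top _ _)).trans
        ((measureReal_biUnion_finset_le _ _).trans ?_)
      refine (Finset.sum_le_sum fun p _ => hD p).trans_eq ?_
      rw [Finset.sum_const, nsmul_eq_mul, Finset.card_univ]
    rw [probReal_compl_eq_one_sub (Set.toFinite _).measurableSet] at h1
    have h2 : ((badPairs (σ n) r).card : ℝ) ≤
        2 * n.1 * (goodPoints (σ n) r)ᶜ.card + n.1 * b := by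
      rw [hb]
      exact_mod_cast card_badPairs_le (σ n) r
    have h3 : M * ((badPairs (σ n) r).card / (ε * n.1) ^ 2) ≤ M / ε ^ 2 *
        (2 * (((goodPoints (σ n) r)ᶜ.card : ℝ) / n.1) + b * (n.1 : ℝ)⁻¹) := by
      have hM0 : 0 ≤ M := by positivity
      calc M * ((badPairs (σ n) r).card / (ε * n.1) ^ 2) ≤
          M * ((2 * n.1 * (goodPoints (σ n) r)ᶜ.card + n.1 * b) / (ε * n.1) ^ 2) := by gcongr
        _ = _ := by field_simp
    change _ ≤ m.real _
    linarith
  · exact Eventually.of_forall fun n => measureReal_le_one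

end Convergence

/-! ### Property M -/

section PropM

variable {d k : ℕ}

theorem propertyM_of_isTypical {δ η η' : ℝ} (hc : AdmissibleConstants d δ η η')
    (hd : 0 < d) (hdk : d ≤ k) {σ : ∀ n : Size k, UnifHom d k (Fin n.1)}
    (hσ : ∀ᶠ n in atTop, IsTypical δ η η' (σ n)) :
    PropertyM (gens d k) (fun n g => (σ n).1 g) (fun n => codeMeasure (σ n).1) (haarX d k) := by
  classical
  intro ε hε r
  have hk : 0 < k := by omega
  have : NeZero k := ⟨hk.ne'⟩
  have : Nonempty (Size k) := ⟨⟨k, hk, dvd_rfl⟩⟩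
  have hball : ∀ r, (1 : ℝ) ≤ (wordBall (gens d k) r).ncard := by
    intro r
    have h : 0 < (wordBall (gens d k) r).ncard :=
      (Set.ncard_pos (finite_wordBall r)).2 ⟨1, one_mem_wordBall r⟩
    exact_mod_cast h
  have hb := hball r
  have hb' := hball (2 * r + 1)
  set b : ℝ := ((wordBall (gens d k) r).ncard : ℝ)
  set b' : ℝ := ((wordBall (gens d k) (2 * r + 1)).ncard : ℝ) with hb'_def
  have hη := hc.η_pos
  -- small enough for the spread of `S n` to be of moderate size, and for the greedy choice
  set c : ℝ := min (η / b) (1 / (2 * b')) with hc_def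
  have hc0 : 0 < c := lt_min (by positivity) (by positivity)
  have hcb : c * b ≤ η := (le_div_iff₀ (by positivity)).1 (min_le_left _ _)
  have hcb' : c * b' ≤ 1 / 2 := by
    have h := (le_div_iff₀ (by positivity)).1 (min_le_right (η / b) (1 / (2 * b')))
    rw [← hc_def] at h
    linarith
  let good : ∀ n : Size k, Finset (Fin n.1) → Prop := fun n S =>
    S.card = ⌊c * n.1⌋₊ ∧ IsSeparated (σ n).1 r S ∧ IsTypical δ η η' (σ n)
  refine ⟨fun n => if h : ∃ S, good n S then h.choose else ∅, ?_, fun n => ?_⟩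
  · refine lt_of_lt_of_le (half_pos hc0) (le_liminf_of_le
      (isCoboundedUnder_ge_of_le (x := 1) _ fun n => ?_) ?_)
    · exact div_le_one_of_le₀ (Nat.cast_le.2 (Finset.card_le_univ _)) (by positivity)
    · filter_upwards [hσ, eventually_le_mul hk 2 hc0,
        (tendsto_compl_goodPoints hk hσ r).eventually_lt_const one_half_pos] with n hn hcn hg
      have hn0 : (0 : ℝ) < n.1 := by exact_mod_cast n.2.1
      have h : ∃ S, good n S := by
        have h1 : ⌊c * n.1⌋₊ * (wordBall (gens d k) (2 * r + 1)).ncard ≤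
            (goodPoints (σ n) r).card := by
          have h2 := Finset.card_add_card_compl (goodPoints (σ n) r)
          rw [Fintype.card_fin] at h2
          have h3 : ((goodPoints (σ n) r).card : ℝ) + ((goodPoints (σ n) r)ᶜ.card : ℝ) = n.1 := by
            exact_mod_cast h2
          rw [div_lt_iff₀ hn0] at hg
          have h4 : (⌊c * n.1⌋₊ : ℝ) ≤ c * n.1 := Nat.floor_le (by positivity)
          rw [← Nat.cast_le (α := ℝ)]
          push_cast
          calc (⌊c * n.1⌋₊ : ℝ) * b' ≤ c * n.1 * b' := by gcongr
            _ = c * b' * n.1 := by ring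
            _ ≤ 1 / 2 * n.1 := by gcongr
            _ ≤ _ := by linarith
        obtain ⟨S, hS1, hS2⟩ := exists_isSeparated (σ n) r _ h1
        exact ⟨S, hS1, hS2, hn⟩
      rw [dif_pos h, h.choose_spec.1, Fintype.card_fin, le_div_iff₀ hn0]
      have := (Nat.lt_floor_add_one (c * n.1)).le
      linarith
  · beta_reduce
    split_ifs with h
    · obtain ⟨h1, h2, h3⟩ := h.choose_spec
      have h4 : ((h.choose.card : ℕ) : ℝ) ≤ c * n.1 := by
        rw [h1]
        exact Nat.floor_le (by positivity)
      have h5 := h3.le_marginalEntropy hc hd hdk n.2.1 h2 (by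
        calc (h.choose.card : ℝ) * b ≤ c * n.1 * b := by gcongr
          _ = c * b * n.1 := by ring
          _ ≤ η * n.1 := by gcongr)
      refine le_trans ?_ h5
      gcongr
      linarith
    · simpa using marginalEntropy_nonneg _ _

end PropM

/-! ### Shattering -/

section Shatter

variable {d k n : ℕ}

/-- Twice the number of blocks of a partition that meet `W` is at most the number of points of
`W` plus the number of points of `W` that are alone in their block. -/
theorem two_mul_card_image_le {V Q : Type*} [DecidableEq V] [DecidableEq Q] (W : Finset V)
    (f : V → Q) {U' : Finset V} (hU' : ∀ v ∈ W, (∀ w ∈ W, f w = f v → w = v) → v ∈ U') :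
    2 * (W.image f).card ≤ W.card + U'.card := by
  set U := W.filter fun v => ∀ w ∈ W, f w = f v → w = v with hU
  have hUU' : U ⊆ U' := fun v hv => hU' v (Finset.mem_filter.1 hv).1 (Finset.mem_filter.1 hv).2
  refine le_trans ?_ (Nat.add_le_add_left (Finset.card_le_card hUU') _)
  have h1 : W.card = ∑ c ∈ W.image f, (W.filter fun v => f v = c).card :=
    Finset.card_eq_sum_card_fiberwise fun v hv => Finset.mem_image_of_mem f hv
  have h2 : U.card = ∑ c ∈ W.image f, (U.filter fun v => f v = c).card :=
    Finset.card_eq_sum_card_fiberwise fun v hv =>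
      Finset.mem_image_of_mem f (Finset.mem_filter.1 hv).1
  rw [h1, h2, ← Finset.sum_add_distrib, mul_comm, ← smul_eq_mul]
  refine Finset.card_nsmul_le_sum _ _ _ fun c hcW => ?_
  obtain ⟨v, hv, rfl⟩ := Finset.mem_image.1 hcW
  have hvF : v ∈ W.filter fun w => f w = f v := Finset.mem_filter.2 ⟨hv, rfl⟩
  have hpos : 0 < (W.filter fun w => f w = f v).card := Finset.card_pos.2 ⟨v, hvF⟩
  by_cases hone : (W.filter fun w => f w = f v).card = 1
  · obtain ⟨a, ha⟩ := Finset.card_eq_one.1 hone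
    have hva : v = a := by rw [ha] at hvF; exact Finset.mem_singleton.1 hvF
    have hvU : v ∈ U.filter fun w => f w = f v := by
      refine Finset.mem_filter.2 ⟨Finset.mem_filter.2 ⟨hv, fun w hw hwv => ?_⟩, rfl⟩
      have : w ∈ W.filter fun w => f w = f v := Finset.mem_filter.2 ⟨hw, hwv⟩
      rw [ha] at this
      rw [Finset.mem_singleton.1 this, hva]
    have := Finset.card_pos.2 ⟨v, hvU⟩
    omega
  · omega

/-- The points of `V` at which `x` violates the check of the generator `i`. -/
def violations {V : Type*} [Fintype V] (σ : Gam d k →* Equiv.Perm V) (i : Fin d)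
    (x : V → ZMod 2) : Finset V :=
  Finset.univ.filter fun v => ∑ j ∈ Finset.range k, x ((σ (gen i) ^ j) v) ≠ 0

/-- In a typical homomorphism, few differing points force many violated checks. -/
theorem IsTypical.card_ne_lt [NeZero k] {δ η η' : ℝ} {σ : UnifHom d k (Fin n)}
    (hσ : IsTypical δ η η' σ) {x y : Fin n → ZMod 2}
    (h0 : 0 < (Finset.univ.filter fun v => x v ≠ y v).card)
    (hδ : ((Finset.univ.filter fun v => x v ≠ y v).card : ℝ) ≤ δ * n) :
    (Finset.univ.filter fun v => x v ≠ y v).card <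
      2 * ∑ i, ((violations σ.1 i x).card + (violations σ.1 i y).card) := by
  classical
  have hk := NeZero.pos k
  set W := Finset.univ.filter fun v => x v ≠ y v with hW
  have hmemW : ∀ v, v ∈ W ↔ x v ≠ y v := fun v => by simp [hW]
  let A : Fin d → Finset (Fin n) := fun i => W.biUnion (orb k (σ.1 (gen i)))
  have hA : InvTuple σ.1 A := fun i => isInv_biUnion fun v _ => isInv_orb hk (σ.2 i) v
  have hWA : ∀ i, W ⊆ A i := fun i v hv =>
    Finset.mem_biUnion.2 ⟨v, hv, self_mem_orb hk v⟩
  have hcover := hσ.cover A hA W h0 hδ hWA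
  have hi : ∀ i, 2 * ((A i).card / k) ≤
      W.card + ((violations σ.1 i x).card + (violations σ.1 i y).card) := by
    intro i
    have h1 : cycles k (σ.1 (gen i)) (A i) = W.image (orb k (σ.1 (gen i))) := by
      ext c
      simp only [cycles, Finset.mem_image]
      constructor
      · rintro ⟨v, hv, rfl⟩
        obtain ⟨w, hw, hvw⟩ := Finset.mem_biUnion.1 hv
        exact ⟨w, hw, (orb_eq_of_mem hk (σ.2 i) hvw).symm⟩
      · rintro ⟨w, hw, rfl⟩
        exact ⟨w, hWA i hw, rfl⟩
    rw [card_eq_mul_card_cycles hk (σ.2 i) (hA i), Nat.mul_div_cancel_left _ hk, h1]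
    refine (two_mul_card_image_le W _ (U' := violations σ.1 i x ∪ violations σ.1 i y)
      fun v hvW halone => ?_).trans (Nat.add_le_add_left (Finset.card_union_le _ _) _)
    by_contra hcon
    simp only [violations, Finset.mem_union, Finset.mem_filter, Finset.mem_univ, true_and,
      not_or, not_not, ← sum_orb (σ.2 i)] at hcon
    have h2 : ∑ w ∈ orb k (σ.1 (gen i)) v, (x w - y w) = x v - y v := by
      refine Finset.sum_eq_single v (fun w hw hwv => ?_) fun h => absurd (self_mem_orb hk v) h
      by_contra hne
      exact hwv (halone w ((hmemW w).2 fun h => hne (sub_eq_zero.2 h))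
        (orb_eq_of_mem hk (σ.2 i) hw))
    rw [Finset.sum_sub_distrib, hcon.1, hcon.2, sub_zero] at h2
    exact (hmemW v).1 hvW (sub_eq_zero.1 h2.symm)
  have hsum : 2 * numCycles k A ≤
      d * W.card + ∑ i, ((violations σ.1 i x).card + (violations σ.1 i y).card) := by
    rw [numCycles, Finset.mul_sum]
    refine (Finset.sum_le_sum fun i _ => hi i).trans_eq ?_
    rw [Finset.sum_add_distrib, Finset.sum_const, Finset.card_univ, Fintype.card_fin, smul_eq_mul]
  have h3 : (2 * d + 1) * W.card = 2 * (d * W.card) + W.card := by ring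
  omega

/-- The configurations that violate the check of the generator `i` at the identity. -/
def violated (d k : ℕ) (i : Fin d) : Set (Gam d k → ZMod 2) :=
  {x | ∑ j ∈ Finset.range k, x (gen i ^ j) ≠ 0}

theorem isClopen_violated (i : Fin d) : IsClopen (violated d k i) := by
  have h : Continuous fun x : Gam d k → ZMod 2 => ∑ j ∈ Finset.range k, x (gen i ^ j) := by
    fun_prop
  exact (isClopen_discrete {(0 : ZMod 2)}ᶜ).preimage h

theorem haarX_violated (i : Fin d) :
    (haarX d k : Measure (Gam d k → ZMod 2)).real (violated d k i) = 0 := by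
  have hm := (isClopen_violated (k := k) i).isOpen.measurableSet
  have h : (haarX d k : Measure (Gam d k → ZMod 2)) (violated d k i)ᶜ = 1 := by
    refine haarX_eq_one _ hm.compl fun x hx hv => hv ?_
    simpa using hx 1 i
  rw [measureReal_def, (prob_compl_eq_one_iff hm).1 h, ENNReal.toReal_zero]

theorem sum_pow_neg_eq_sum_pow {V : Type*} [Finite V] (hk : 0 < k) {τ : Equiv.Perm V}
    (hτ : IsUniformPerm k τ) (f : V → ZMod 2) (v : V) :
    ∑ j ∈ Finset.range k, f ((τ ^ j)⁻¹ v) = ∑ j ∈ Finset.range k, f ((τ ^ j) v) := by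
  classical
  have h : τ v ∈ orb k τ v := by simpa using pow_mem_orb hk hτ v 1
  rw [← Finset.sum_range_reflect, ← sum_orb hτ f v, ← orb_eq_of_mem hk hτ h, sum_orb hτ]
  refine Finset.sum_congr rfl fun j hj => ?_
  have hj' := Finset.mem_range.1 hj
  have h1 : (τ ^ (k - 1 - j))⁻¹ = τ ^ j * τ := by
    rw [inv_eq_iff_mul_eq_one, ← pow_succ, ← pow_add, ← hτ.pow_eq_one]
    congr 1
    omega
  rw [h1, Equiv.Perm.mul_apply]

theorem empirical_violated (hk : 0 < k) [Nonempty (Fin n)] (σ : UnifHom d k (Fin n))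
    (x : Fin n → ZMod 2) (i : Fin d) :
    (empirical (fun g => σ.1 g) x : Measure (Gam d k → ZMod 2)).real (violated d k i) =
      ((violations σ.1 i x).card : ℝ) / n := by
  classical
  rw [empirical_real _ _ (isClopen_violated i).isOpen.measurableSet, Fintype.card_fin]
  congr 3
  ext v
  have h := sum_pow_neg_eq_sum_pow hk (σ.2 i) x v
  simp only [← map_pow, ← map_inv] at h
  simp only [violations, Finset.mem_filter, Finset.mem_univ, true_and, ← map_pow, ← h]
  rfl

/-- The measures that give small mass to each violated check form an open set. -/
theorem isOpen_violated_lt (τ : ℝ) :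
    IsOpen {ν : ProbabilityMeasure (Gam d k → ZMod 2) |
      ∀ i, (ν : Measure (Gam d k → ZMod 2)).real (violated d k i) < τ} := by
  have h : ∀ i : Fin d, Continuous fun ν : ProbabilityMeasure (Gam d k → ZMod 2) =>
      (ν : Measure (Gam d k → ZMod 2)).real (violated d k i) := by
    intro i
    refine continuous_iff_continuousAt.2 fun ν => ?_
    exact (NNReal.tendsto_coe.2 (ProbabilityMeasure.tendsto_measure_of_isClopen_of_tendsto
      (μs := id) tendsto_id (isClopen_violated i)))
  simp only [Set.ofPred_forall]
  exact isOpen_iInter_of_finite fun i => isOpen_lt (h i) continuous_const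

theorem totallyShattered_of_isTypical {δ η η' : ℝ} (hc : AdmissibleConstants d δ η η')
    (hd : 0 < d) (hdk : d ≤ k) {σ : ∀ n : Size k, UnifHom d k (Fin n.1)}
    (hσ : ∀ᶠ n in atTop, IsTypical δ η η' (σ n)) :
    TotallyShattered (fun n g => (σ n).1 g) (haarX d k) := by
  classical
  have hk : 0 < k := by omega
  have : NeZero k := ⟨hk.ne'⟩
  have : Nonempty (Size k) := ⟨⟨k, hk, dvd_rfl⟩⟩
  refine ⟨fun O hO hμ => ?_, δ, hc.δ_pos, fun ε hε => ?_⟩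
  · have h := convergesEmpirically_of_isTypical hc hd hdk hσ O hO hμ
    filter_upwards [h.eventually_const_lt one_pos] with n hn
    by_contra hempty
    have h0 : {x | empirical (fun g => (σ n).1 g) x ∈ O} = ∅ :=
      Set.not_nonempty_iff_eq_empty.1 hempty
    rw [h0, measureReal_empty] at hn
    exact lt_irrefl _ hn
  · have hd' : (0 : ℝ) < d := by exact_mod_cast hd
    refine ⟨_, isOpen_violated_lt (ε / (4 * d)), fun i => ?_, ?_⟩
    · rw [haarX_violated]
      positivity
    · obtain ⟨n₀, hn₀⟩ := eventually_atTop.1 hσ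
      refine ⟨n₀, fun n hn x hx y hy => ?_⟩
      have hn0 : (0 : ℝ) < n.1 := by exact_mod_cast n.2.1
      rw [or_iff_not_imp_left, not_le]
      intro hlt
      have hham : normHamming x y =
          ((Finset.univ.filter fun v => x v ≠ y v).card : ℝ) / n.1 := by
        rw [normHamming, hammingDist, Fintype.card_fin]
      rw [hham] at hlt ⊢
      rcases Nat.eq_zero_or_pos (Finset.univ.filter fun v => x v ≠ y v).card with h0 | h0
      · rw [h0, Nat.cast_zero, zero_div]
        exact hε
      · have h1 := (hn₀ n hn).card_ne_lt h0 ((div_lt_iff₀ hn0).1 hlt).le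
        have hviol : ∀ z ∈ microstates (fun g => (σ n).1 g)
            {ν : ProbabilityMeasure (Gam d k → ZMod 2) |
              ∀ i, (ν : Measure (Gam d k → ZMod 2)).real (violated d k i) < ε / (4 * d)},
            ∀ i, ((violations (σ n).1 i z).card : ℝ) ≤ ε / (4 * d) * n.1 := by
          intro z hz i
          have h := hz i
          rw [empirical_violated hk, div_lt_iff₀ hn0] at h
          exact h.le
        rw [div_lt_iff₀ hn0]
        refine lt_of_lt_of_le (Nat.cast_lt.2 h1) ?_
        push_cast
        calc 2 * ∑ i, (((violations (σ n).1 i x).card : ℝ) + (violations (σ n).1 i y).card)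
            ≤ 2 * ∑ _i : Fin d, (ε / (4 * d) * n.1 + ε / (4 * d) * n.1) := by
              gcongr with i
              exacts [hviol x hx i, hviol y hy i]
          _ = ε * n.1 := by
              rw [Finset.sum_const, Finset.card_univ, Fintype.card_fin, nsmul_eq_mul]
              field_simp
              ring

end Shatter

end ParityCheck

theorem mainTheorem6 (d k : ℕ) (hd : 3 ≤ d) (hdk : d < k) :
    ∃ Ω : ∀ n : Size k, Set (UnifHom d k (Fin n.1)),
      Tendsto (fun n => unifProb (Ω n)) atTop (𝓝 1) ∧
      ∀ σ : ∀ n : Size k, UnifHom d k (Fin n.1), (∀ᶠ n in atTop, σ n ∈ Ω n) →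
        IsSoficApprox (fun n g => (σ n).1 g) ∧
        PropertyM (gens d k) (fun n g => (σ n).1 g) (fun n => codeMeasure (σ n).1)
          (haarX d k) ∧
        (ConvergesLocally (fun n g => (σ n).1 g) (fun n => codeMeasure (σ n).1) (haarX d k) ∧
          ConvergesEmpirically (fun n g => (σ n).1 g) (fun n => codeMeasure (σ n).1)
            (haarX d k)) ∧
        TotallyShattered (fun n g => (σ n).1 g) (haarX d k) := by
  obtain ⟨δ, η, η', h1, h2, h3, h4, h5, h6, h7, h⟩ := exists_tendsto_unifProb_isTypical hd hdk
  have hc : AdmissibleConstants d δ η η' := ⟨h1, h3, h4, h5, h6, h7⟩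
  refine ⟨fun n => {σ | IsTypical δ η η' σ}, h, fun σ hσ => ?_⟩
  have hd0 : 0 < d := by omega
  exact ⟨isSoficApprox_of_isTypical (by omega) hσ, propertyM_of_isTypical hc hd0 hdk.le hσ,
    ⟨convergesLocally_of_isTypical hc hd0 hdk.le hσ,
      convergesEmpirically_of_isTypical hc hd0 hdk.le hσ⟩,
    totallyShattered_of_isTypical hc hd0 hdk.le hσ⟩
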